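/- **Setting.** Let $(\mathcal X,\mathfrak S)$ be a measurable space with an increasing sequence of $\sigma$-algebras $\mathfrak S_n\subset\mathfrak S_{n+1}\subset\mathfrak S$, $n\in\mathbb Z$, each of them atomic: there is a countable collection $\mathcal L_n$ of disjoint nonempty sets (atoms) such that $\mathfrak S_n$ consists of all unions of members of $\mathcal L_n$. Put $\mathcal L=\bigcup_n\mathcal L_n$ and $\mathcal L(J)=\{I\in\mathcal L: I\subset J\}$. The children $\operatorname{ch}(I)$ of $I\in\mathcal L$ are the atoms $I'\in\mathcal L_{n+1}$ with $I'\subset I$, where $n$ is the largest index with $I\in\mathcal L_n$; if there is no largest such $n$, then $\operatorname{ch}(I)=\{I\}$. Let $\mu,\nu$ be measures on $\mathfrak S$ that are finite on every $I\in\mathcal L$. For $I\in\mathcal L$ write $\mathbb E_I^\mu f=\langle f\rangle_{I,\mu}\mathbf 1_I$ with $\langle f\rangle_{I,\mu}=\mu(I)^{-1}\int_I f\,d\mu$, understood as $0$ if $\mu(I)=0$, and similarly for $\nu$. Let the symbol $b$ be a family $\{\Delta_I^\nu b\}_{I\in\mathcal L}$ of real martingale differences: each $\Delta_I^\nu b$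 is $\nu$-integrable, supported on $I$, constant on the children of $I$, and $\int_I\Delta_I^\nu b\,d\nu=0$ (for example $\Delta_I^\nu b=\sum_{I'\in\operatorname{ch}(I)}\mathbb E_{I'}^\nu b-\mathbb E_I^\nu b$ for a function $b$ that is $\nu$-integrable on each $I\in\mathcal L$). Assume that $\Delta_I^\nu b=0$ $\nu$-a.e. for every $I\in\mathcal L$ with $\mu(I)=0$. The two-weight paraproduct is $$\pi_b^{\mu,\nu}f=\sum_{I\in\mathcal L}\bigl(\mathbb E_I^\mu f\bigr)\,\bigl(\Delta_I^\nu b\bigr).$$ This series, and the one in (2), are required to converge unconditionally in $L^p(\nu)$ as part of the corresponding condition. **Theorem 1.2.** Let $2<p<\infty$, $r=p/2$ and $1/r+1/r'=1$. The estimate $$\|\pi_b^{\mu,\nu}f\|_{L^p(\nu)}\le A\,\|f\|_{L^p(\mu)}\qquad\text{for all } f\in L^p(\mu) \tag{1}$$ holds with some finite $A$ if and only if the direct testing condition $$\int_J\Bigl|\sum_{I\in\mathcal L(J)}\Delta_I^\nu b\Bigr|^p d\nu\le B^p\mu(J)\qquad\text{for all } J\in\mathcal L \tag{2}$$ holds with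 some finite $B$ and the auxiliary adjoint testing condition $$\int_J\Bigl[\sum_{I\in\mathcal L(J)}\frac{\nu(I)}{\mu(I)}\,\mathbb E_I^\nu\bigl(|\Delta_I^\nu b|^2\bigr)\Bigr]^{r'}d\mu\le B_*^{r'}\,\nu(J)\qquad\text{for all } J\in\mathcal L \tag{3}$$ holds with some finite $B_*$. Moreover, the best (least) constants, with the value $\infty$ if there is none, satisfy $$c(p)\max\{B,B_*^{1/2}\}\le A\le C(p)\max\{B,B_*^{1/2}\},$$ where $0<c(p),C(p)<\infty$ depend only on $p$. -/

import Mathlib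

open MeasureTheory Filter Topology
open scoped ENNReal NNReal

/-- An atomic filtration indexed by `ℤ`: an increasing sequence of sub-σ-algebras, the `n`-th of
which consists exactly of the unions of members of a countable collection `atoms n` of pairwise
disjoint nonempty sets. -/
structure AtomicFiltration (X : Type*) [mX : MeasurableSpace X] where
  /-- The increasing sequence of σ-algebras. -/
  filtration : Filtration ℤ mX
  /-- The atoms of each generation. -/
  atoms : ℤ → Set (Set X)
  countable_atoms : ∀ n, (atoms n).Countable
  nonempty_of_mem : ∀ n, ∀ I ∈ atoms n, I.Nonempty
  pairwiseDisjoint : ∀ n, (atoms n).PairwiseDisjoint id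
  measurableSet_iff : ∀ n (A : Set X),
    MeasurableSet[filtration n] A ↔ ∃ S ⊆ atoms n, A = ⋃₀ S

namespace AtomicFiltration

variable {X : Type*} [MeasurableSpace X] (𝓕 : AtomicFiltration X)

/-- The collection of all atoms ("intervals") of all generations, treated as sets. -/
def intervals : Set (Set X) := ⋃ n, 𝓕.atoms n

/-- The measure is finite on every interval. -/
def LocallyFinite (μ : Measure X) : Prop := ∀ I ∈ 𝓕.intervals, μ I < ∞

/-- The children of an interval `I`. If there is a largest `n` with `I` an atom of generation `n`,
they are the atoms of generation `n + 1` contained in `I`; if `I` is an atom of arbitrarily large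
generations, the only child of `I` is `I` itself. -/
def children (I : Set X) : Set (Set X) :=
  {I' | (∃ n, IsGreatest {k | I ∈ 𝓕.atoms k} n ∧ I' ∈ 𝓕.atoms (n + 1) ∧ I' ⊆ I) ∨
    (¬ BddAbove {k | I ∈ 𝓕.atoms k} ∧ I' = I)}

/-- The averaging operator: `E_I f = ⟨f⟩_I 1_I`, where the average is `0` if `μ I = 0`. -/
noncomputable def avg (μ : Measure X) (I : Set X) (f : X → ℝ) : X → ℝ :=
  I.indicator fun _ => ⨍ y in I, f y ∂μ

/-- The martingale difference `Δ_I b = ∑_{I' ∈ ch I} E_{I'} b - E_I b` of a function `b`. -/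
noncomputable def martDiff (ν : Measure X) (b : X → ℝ) (I : Set X) : X → ℝ :=
  fun x => (∑' I' : 𝓕.children I, avg ν I' b x) - avg ν I b x

/-- A family of martingale differences `(b_I)`, indexed by the intervals (the values of `b` at
other sets play no role): each `b_I` is integrable, supported on `I`, constant on the children of
`I`, and has mean zero. -/
structure IsMartDiffFamily (ν : Measure X) (b : Set X → X → ℝ) : Prop where
  integrable : ∀ I ∈ 𝓕.intervals, Integrable (b I) ν
  support_subset : ∀ I ∈ 𝓕.intervals, Function.support (b I) ⊆ I
  const_on_children : ∀ I ∈ 𝓕.intervals, ∀ I' ∈ 𝓕.children I, ∀ x ∈ I', ∀ y ∈ I',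
    b I x = b I y
  integral_eq_zero : ∀ I ∈ 𝓕.intervals, ∫ x in I, b I x ∂ν = 0

/-- `g ∈ L^p(ν)` is the sum of the series `∑ u i`, converging unconditionally in `L^p(ν)`. -/
def IsLpSum {ι : Type*} (p : ℝ) (ν : Measure X) (u : ι → X → ℝ) (g : X → ℝ) : Prop :=
  MemLp g (ENNReal.ofReal p) ν ∧
    Tendsto (fun F : Finset ι => eLpNorm (fun x => ∑ i ∈ F, u i x - g x) (ENNReal.ofReal p) ν)
      atTop (𝓝 0)

/-- `g = π_b f = ∑_I (E_I^μ f) b_I`, the two weight paraproduct with symbol `b` applied to `f`. -/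
def IsParaproduct (p : ℝ) (μ ν : Measure X) (b : Set X → X → ℝ) (f g : X → ℝ) : Prop :=
  IsLpSum p ν (fun (I : 𝓕.intervals) x => avg μ I f x * b I x) g

/-- The paraproduct is defined on all of `L^p(μ)` and is bounded from `L^p(μ)` to `L^p(ν)` with
constant `A`. -/
def ParaproductBound (p : ℝ) (μ ν : Measure X) (b : Set X → X → ℝ) (A : ℝ≥0) : Prop :=
  ∀ f : X → ℝ, MemLp f (ENNReal.ofReal p) μ → ∃ g : X → ℝ, 𝓕.IsParaproduct p μ ν b f g ∧
    eLpNorm g (ENNReal.ofReal p) ν ≤ A * eLpNorm f (ENNReal.ofReal p) μ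

/-- The direct testing condition with constant `B`: for all intervals `J`,
`∫_J |∑_{I ⊆ J} b_I|^p dν ≤ B^p μ(J)`. -/
def DirectTesting (p : ℝ) (μ ν : Measure X) (b : Set X → X → ℝ) (B : ℝ≥0) : Prop :=
  ∀ J ∈ 𝓕.intervals, ∃ g : X → ℝ,
    IsLpSum p ν (fun I : {I : Set X // I ∈ 𝓕.intervals ∧ I ⊆ J} => b I) g ∧
    ∫⁻ x in J, ‖g x‖ₑ ^ p ∂ν ≤ (B : ℝ≥0∞) ^ p * μ J

/-- The auxiliary adjoint testing condition with constant `B`: with `r = p / 2` and `r'` its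
conjugate exponent, for all intervals `J`,
`∫_J [∑_{I ⊆ J} (ν(I)/μ(I)) E_I^ν(|b_I|²)]^{r'} dμ ≤ B^{r'} ν(J)`. -/
def AdjointTesting (p : ℝ) (μ ν : Measure X) (b : Set X → X → ℝ) (B : ℝ≥0) : Prop :=
  ∀ J ∈ 𝓕.intervals,
    ∫⁻ x in J, (∑' I : {I : Set X // I ∈ 𝓕.intervals ∧ I ⊆ J},
        ν I / μ I * (I : Set X).indicator (fun _ => ⨍⁻ y in (I : Set X), ‖b I y‖ₑ ^ 2 ∂ν) x)
          ^ (p / 2).conjExponent ∂μ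
      ≤ (B : ℝ≥0∞) ^ (p / 2).conjExponent * ν J

/-- The best (least) constant for which a condition holds, `∞` if there is none. -/
noncomputable def bestConst (P : ℝ≥0 → Prop) : ℝ≥0∞ := ⨅ (A : ℝ≥0) (_ : P A), (A : ℝ≥0∞)

theorem measurableSet_of_mem_atoms {n : ℤ} {I : Set X} (hI : I ∈ 𝓕.atoms n) :
    MeasurableSet[𝓕.filtration n] I :=
  (𝓕.measurableSet_iff n I).2 ⟨{I}, by simpa using hI, by simp⟩

theorem children_subset {I I' : Set X} (h : I' ∈ 𝓕.children I) : I' ⊆ I := by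
  rcases h with ⟨n, _, _, h⟩ | ⟨_, rfl⟩
  · exact h
  · exact subset_rfl

theorem children_countable (I : Set X) : (𝓕.children I).Countable := by
  refine Set.Countable.mono (s₂ := (⋃ n, 𝓕.atoms n) ∪ {I}) ?_
    ((Set.countable_iUnion 𝓕.countable_atoms).union (Set.countable_singleton I))
  rintro I' (⟨n, _, h, _⟩ | ⟨_, rfl⟩)
  · exact Or.inl (Set.mem_iUnion.2 ⟨_, h⟩)
  · exact Or.inr rfl

theorem children_disjoint (I : Set X) : (𝓕.children I).PairwiseDisjoint id := by
  rintro I₁ (⟨n, hn, h1, _⟩ | ⟨hb, rfl⟩) I₂ (⟨m, hm, h2, _⟩ | ⟨hb', rfl⟩) hne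
  · obtain rfl := hn.unique hm
    exact 𝓕.pairwiseDisjoint _ h1 h2 hne
  · exact absurd ⟨n, hn.2⟩ hb'
  · exact absurd ⟨m, hm.2⟩ hb
  · exact absurd rfl hne

theorem interval_measurable {I : Set X} (hI : I ∈ 𝓕.intervals) : MeasurableSet I := by
  obtain ⟨n, hn⟩ := Set.mem_iUnion.1 hI
  exact 𝓕.filtration.le n _ (𝓕.measurableSet_of_mem_atoms hn)

theorem children_mem_intervals {I I' : Set X} (hI : I ∈ 𝓕.intervals) (h : I' ∈ 𝓕.children I) :
    I' ∈ 𝓕.intervals := by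
  rcases h with ⟨n, _, h, _⟩ | ⟨_, rfl⟩
  · exact Set.mem_iUnion.2 ⟨_, h⟩
  · exact hI

theorem iUnion_children {I : Set X} (hI : I ∈ 𝓕.intervals) :
    ⋃ I' : 𝓕.children I, (I' : Set X) = I := by
  apply Set.Subset.antisymm
  · exact Set.iUnion_subset fun I' => 𝓕.children_subset I'.2
  · intro x hx
    obtain ⟨k, hk⟩ := Set.mem_iUnion.1 hI
    by_cases hb : BddAbove {k | I ∈ 𝓕.atoms k}
    · obtain ⟨n, hn, hmax⟩ := Int.exists_greatest_of_bdd (P := fun k => I ∈ 𝓕.atoms k)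
        (by obtain ⟨b, hb⟩ := hb; exact ⟨b, fun z hz => hb hz⟩) ⟨k, hk⟩
      have hm : MeasurableSet[𝓕.filtration (n + 1)] I :=
        𝓕.filtration.mono (by omega) _ (𝓕.measurableSet_of_mem_atoms hn)
      obtain ⟨S, hS, hIS⟩ := (𝓕.measurableSet_iff _ _).1 hm
      obtain ⟨I', hI', hxI'⟩ : ∃ I' ∈ S, x ∈ I' := by rw [hIS] at hx; simpa using hx
      refine Set.mem_iUnion.2 ⟨⟨I', Or.inl ⟨n, ⟨hn, fun z hz => hmax z hz⟩, hS hI', ?_⟩⟩, hxI'⟩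
      rw [hIS]
      exact Set.subset_sUnion_of_mem hI'
    · exact Set.mem_iUnion.2 ⟨⟨I, Or.inr ⟨hb, rfl⟩⟩, hx⟩

theorem martDiff_of_mem {ν : Measure X} {b : X → ℝ} {I I' : Set X} (h : I' ∈ 𝓕.children I)
    {x : X} (hx : x ∈ I') :
    𝓕.martDiff ν b I x = (⨍ y in I', b y ∂ν) - ⨍ y in I, b y ∂ν := by
  unfold martDiff avg
  rw [Set.indicator_of_mem (𝓕.children_subset h hx), tsum_eq_single ⟨I', h⟩,
    Set.indicator_of_mem hx]
  intro I'' hne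
  apply Set.indicator_of_notMem
  intro hx'
  exact Set.disjoint_left.1 (𝓕.children_disjoint I I''.2 h fun h' => hne (Subtype.ext h')) hx' hx

/-- The martingale differences of a locally integrable function form a family of martingale
differences. -/
theorem isMartDiffFamily_martDiff {ν : Measure X} (hν : 𝓕.LocallyFinite ν) {b : X → ℝ}
    (hb : ∀ I ∈ 𝓕.intervals, IntegrableOn b I ν) :
    𝓕.IsMartDiffFamily ν (𝓕.martDiff ν b) := by
  have hsupp : ∀ I, Function.support (𝓕.martDiff ν b I) ⊆ I := by
    intro I x hx
    by_contra hxI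
    apply hx
    unfold martDiff avg
    rw [Set.indicator_of_notMem hxI, sub_zero]
    convert tsum_zero with I'
    exact Set.indicator_of_notMem (fun h => hxI (𝓕.children_subset I'.2 h)) _
  have key : ∀ I ∈ 𝓕.intervals, IntegrableOn (𝓕.martDiff ν b I) I ν ∧
      ∫ x in I, 𝓕.martDiff ν b I x ∂ν = 0 := by
    intro I hI
    have hc : Countable (𝓕.children I) := (𝓕.children_countable I).to_subtype
    have hmeas : ∀ I' : 𝓕.children I, MeasurableSet (I' : Set X) := fun I' =>
      𝓕.interval_measurable (𝓕.children_mem_intervals hI I'.2)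
    have hdisj : Pairwise (Function.onFun Disjoint fun I' : 𝓕.children I => (I' : Set X)) := by
      intro I₁ I₂ hne
      exact 𝓕.children_disjoint I I₁.2 I₂.2 fun h => hne (Subtype.ext h)
    have hU := 𝓕.iUnion_children hI
    set a : 𝓕.children I → ℝ := fun I' => ⨍ y in (I' : Set X), b y ∂ν with ha
    have hfin : ∀ I' : 𝓕.children I, ν I' ≠ ∞ := fun I' =>
      (hν _ (𝓕.children_mem_intervals hI I'.2)).ne
    set h : X → ℝ := fun x => 𝓕.martDiff ν b I x + ⨍ y in I, b y ∂ν with hh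
    have hval : ∀ I' : 𝓕.children I, ∀ x ∈ (I' : Set X), h x = a I' := by
      intro I' x hx
      simp only [hh, ha]
      rw [𝓕.martDiff_of_mem I'.2 hx]
      ring
    have hint' : ∀ I' : 𝓕.children I, ∫ x in (I' : Set X), h x ∂ν = ∫ x in (I' : Set X), b x ∂ν := by
      intro I'
      rw [setIntegral_congr_fun (hmeas I') (hval I'), setIntegral_const, ha]
      exact measure_smul_setAverage b (hfin I')
    have hintOn : ∀ I' : 𝓕.children I, IntegrableOn h I' ν := by
      intro I'
      exact (integrableOn_const (hfin I')).congr_fun (fun x hx => (hval I' x hx).symm) (hmeas I')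
    have hbI := hb I hI
    rw [← hU] at hbI
    have hnorm : ∀ I' : 𝓕.children I, ∫ x in (I' : Set X), ‖h x‖ ∂ν
        ≤ ∫ x in (I' : Set X), ‖b x‖ ∂ν := by
      intro I'
      rw [setIntegral_congr_fun (g := fun _ => ‖a I'‖) (hmeas I')
        (fun x hx => by simp only [hval I' x hx]), setIntegral_const]
      have h1 : ν.real (I' : Set X) • a I' = ∫ x in (I' : Set X), b x ∂ν :=
        measure_smul_setAverage b (hfin I')
      calc ν.real (I' : Set X) • ‖a I'‖ = ‖ν.real (I' : Set X) • a I'‖ := by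
            rw [norm_smul, Real.norm_of_nonneg measureReal_nonneg, smul_eq_mul]
        _ ≤ _ := by rw [h1]; exact norm_integral_le_integral_norm _
    have hsum : Summable fun I' : 𝓕.children I => ∫ x in (I' : Set X), ‖h x‖ ∂ν :=
      Summable.of_nonneg_of_le (fun I' => integral_nonneg fun x => norm_nonneg _) hnorm
        (hasSum_integral_iUnion hmeas hdisj hbI.norm).summable
    have hIh : IntegrableOn h (⋃ I' : 𝓕.children I, (I' : Set X)) ν :=
      integrableOn_iUnion_of_summable_integral_norm hintOn hsum
    have heq : ∫ x in I, h x ∂ν = ∫ x in I, b x ∂ν := by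
      have e1 := integral_iUnion hmeas hdisj hIh
      have e2 := integral_iUnion hmeas hdisj hbI
      rw [hU] at e1 e2
      rw [e1, e2]
      exact tsum_congr hint'
    rw [hU] at hIh
    have hcI : IntegrableOn (fun _ : X => ⨍ y in I, b y ∂ν) I ν := integrableOn_const (hν I hI).ne
    have hmd : 𝓕.martDiff ν b I = fun x => h x - ⨍ y in I, b y ∂ν := by
      funext x; simp [hh]
    rw [hmd]
    refine ⟨hIh.sub hcI, ?_⟩
    rw [integral_sub hIh hcI, heq, setIntegral_const, measure_smul_setAverage b (hν I hI).ne,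
      sub_self]
  refine ⟨fun I hI => ?_, fun I _ => hsupp I, fun I _ I' h x hx y hy => ?_, fun I hI => (key I hI).2⟩
  · exact (integrableOn_iff_integrable_of_support_subset (hsupp I)).1 (key I hI).1
  · rw [𝓕.martDiff_of_mem h hx, 𝓕.martDiff_of_mem h hy]

end AtomicFiltration

/-! Write `r = p/2` and `t = r'`. Multiplying each `b_I` by a constant preserves the martingale
difference structure, so Burkholder's inequality makes the `L^p(ν)` norm of the paraproduct
comparable to that of its square function, with `p`-th power `∫ (∑ |⟨f⟩_I|² |b_I|²)^r dν`. The
problem thereby becomes one about the positive operator `F ↦ ∑ ⟨F⟩_I β_I`, with `β_I = |b_I|²`, from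
`L^r(μ)` to `L^r(ν)`. In one direction Jensen gives `|⟨f⟩_I|² ≤ ⟨|f|²⟩_I`. In the other, `f =
(Mφ)^{1/2}` with `M` the maximal operator gives `⟨φ⟩_I ≤ ⟨f⟩_I²`, and the maximal theorem controls
the norm of `f`.

Necessity. Applying the bound to `f = 1_J` and passing through square functions yields direct
testing. Adjoint testing follows by duality: with `S` the function being tested, take `φ = S^{t-1}`,
pass to `f = (Mφ)^{1/2}`, and absorb.

Sufficiency. The bilinear form `∑ ⟨F⟩_I ∫ β_I φ dν` is split according to which of `⟨F⟩_I^r μ(I)`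
and `⟨φ⟩_I^t ν(I)` is larger. Where `F` dominates, stopping intervals are chosen by the doubling of
the averages of `F`. Between stops the weight is essentially constant and direct testing applies; on
the next stops `φ` may be replaced by its averages, which the splitting controls. Where `φ`
dominates, the roles are exchanged. The adjoint condition only sees the mean of `β_I`, whereas `β_I`
varies over the children of `I`. Hence the child averages of `φ` are split into a part below the
supremum of averages over the ancestors of `I`, handled by adjoint testing, and a positive excess.
The excesses telescope pointwise to at most `Mφ`, and are paired with a Carleson embedding that
follows from direct testing.

The carrying lemmas are `exists_burkholder`, `exists_maximal`, `IsCorona.sum_mul_lintegral_le`,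
`IsTested.exists_operator_bound`, `exists_adjoint_finset` and `exists_paraproductBound`. -/

namespace AtomicFiltration

/-! ### Nestedness of atoms and measurability of martingale differences. -/

variable {X : Type*} [MeasurableSpace X] (𝓕 : AtomicFiltration X)

theorem subset_of_mem_atoms {n : ℤ} {I K : Set X} (hI : I ∈ 𝓕.atoms n)
    (hK : MeasurableSet[𝓕.filtration n] K) {x : X} (hxI : x ∈ I) (hxK : x ∈ K) : I ⊆ K := by
  obtain ⟨S, hS, rfl⟩ := (𝓕.measurableSet_iff n K).1 hK
  obtain ⟨L, hL, hxL⟩ := hxK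
  have : I = L := by
    by_contra hne
    exact Set.disjoint_left.1 (𝓕.pairwiseDisjoint n hI (hS hL) hne) hxI hxL
  subst this
  exact Set.subset_sUnion_of_mem hL

theorem subset_of_atoms_le {n m : ℤ} (hnm : n ≤ m) {I K : Set X} (hI : I ∈ 𝓕.atoms n)
    (hK : K ∈ 𝓕.atoms m) {x : X} (hxI : x ∈ I) (hxK : x ∈ K) : K ⊆ I :=
  𝓕.subset_of_mem_atoms hK (𝓕.filtration.mono hnm _ (𝓕.measurableSet_of_mem_atoms hI)) hxK hxI

theorem intervals_countable : 𝓕.intervals.Countable := Set.countable_iUnion 𝓕.countable_atoms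

theorem subset_or_subset {I J : Set X} (hI : I ∈ 𝓕.intervals) (hJ : J ∈ 𝓕.intervals) {x : X}
    (hxI : x ∈ I) (hxJ : x ∈ J) : I ⊆ J ∨ J ⊆ I := by
  obtain ⟨n, hn⟩ := Set.mem_iUnion.1 hI
  obtain ⟨m, hm⟩ := Set.mem_iUnion.1 hJ
  rcases le_total n m with h | h
  · exact Or.inr (𝓕.subset_of_atoms_le h hn hm hxI hxJ)
  · exact Or.inl (𝓕.subset_of_atoms_le h hm hn hxJ hxI)

theorem nonempty_of_mem_intervals {I : Set X} (hI : I ∈ 𝓕.intervals) : I.Nonempty := by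
  obtain ⟨n, hn⟩ := Set.mem_iUnion.1 hI
  exact 𝓕.nonempty_of_mem n I hn

/-- An interval strictly contained in `I` is contained in a child of `I`. -/
theorem exists_child_of_ssubset {I K : Set X} (hI : I ∈ 𝓕.intervals) (hK : K ∈ 𝓕.intervals)
    (h : K ⊂ I) : ∃ I' ∈ 𝓕.children I, K ⊆ I' := by
  obtain ⟨x, hx⟩ := 𝓕.nonempty_of_mem_intervals hK
  obtain ⟨m, hm⟩ := Set.mem_iUnion.1 hK
  -- The generations of `I` are bounded by that of `K`, so `I` has a last generation and the
  -- degenerate case of a single child `I` cannot occur.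
  have key : ∀ n, I ∈ 𝓕.atoms n → n < m := by
    intro n hn
    by_contra hlt
    exact h.2 (𝓕.subset_of_atoms_le (not_lt.1 hlt) hm hn hx (h.1 hx))
  have hx' : x ∈ ⋃ I' : 𝓕.children I, (I' : Set X) := by
    rw [𝓕.iUnion_children hI]; exact h.1 hx
  obtain ⟨⟨I', hI'⟩, hxI'⟩ := Set.mem_iUnion.1 hx'
  refine ⟨I', hI', ?_⟩
  rcases hI' with ⟨n, hn, hI'n, _⟩ | ⟨hb, _⟩
  · exact 𝓕.subset_of_atoms_le (by have := key n hn.1; omega) hI'n hm hxI' hx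
  · exact absurd ⟨m, fun n hn => (key n hn).le⟩ hb

theorem child_eq_of_mem {I I' I'' : Set X} (h' : I' ∈ 𝓕.children I) (h'' : I'' ∈ 𝓕.children I)
    {x : X} (hx' : x ∈ I') (hx'' : x ∈ I'') : I' = I'' := by
  by_contra hne
  exact Set.disjoint_left.1 (𝓕.children_disjoint I h' h'' hne) hx' hx''

theorem exists_child_mem {I : Set X} (hI : I ∈ 𝓕.intervals) {x : X} (hx : x ∈ I) :
    ∃ I' ∈ 𝓕.children I, x ∈ I' := by
  rw [← 𝓕.iUnion_children hI] at hx
  obtain ⟨⟨I', hI'⟩, hxI'⟩ := Set.mem_iUnion.1 hx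
  exact ⟨I', hI', hxI'⟩

/-- A function supported on an interval and constant on its children is measurable. -/
theorem measurable_of_const_on_children {E : Type*} [MeasurableSpace E] [Zero E] {I : Set X}
    (hI : I ∈ 𝓕.intervals) {f : X → E} (hsupp : ∀ x, x ∉ I → f x = 0)
    (hconst : ∀ I' ∈ 𝓕.children I, ∀ x ∈ I', ∀ y ∈ I', f x = f y) : Measurable f := by
  intro s _
  have hIm := 𝓕.interval_measurable hI
  have h1 : f ⁻¹' s = (⋃ I' ∈ {I' | I' ∈ 𝓕.children I ∧ I' ⊆ f ⁻¹' s}, I') ∪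
      (Iᶜ ∩ {_x | (0 : E) ∈ s}) := by
    ext x
    simp only [Set.mem_preimage, Set.mem_union, Set.mem_iUnion, Set.mem_ofPred_eq, Set.mem_inter_iff,
      Set.mem_compl_iff, exists_prop]
    constructor
    · intro hx
      by_cases hxI : x ∈ I
      · obtain ⟨I', hI', hxI'⟩ := 𝓕.exists_child_mem hI hxI
        refine Or.inl ⟨I', ⟨hI', fun y hy => ?_⟩, hxI'⟩
        rw [Set.mem_preimage, ← hconst I' hI' x hxI' y hy]
        exact hx
      · exact Or.inr ⟨hxI, by rwa [hsupp x hxI] at hx⟩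
    · rintro (⟨I', ⟨_, h⟩, hx⟩ | ⟨hxI, h0⟩)
      · exact h hx
      · rwa [hsupp x hxI]
  rw [h1]
  refine MeasurableSet.union (MeasurableSet.biUnion ?_ ?_) (hIm.compl.inter (MeasurableSet.const _))
  · exact (𝓕.children_countable I).mono fun _ h => h.1
  · exact fun I' h => 𝓕.interval_measurable (𝓕.children_mem_intervals hI h.1)

variable {𝓕} in
theorem IsMartDiffFamily.eq_zero {ν : Measure X} {b : Set X → X → ℝ}
    (hb : 𝓕.IsMartDiffFamily ν b) {I : Set X} (hI : I ∈ 𝓕.intervals) {x : X} (hx : x ∉ I) :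
    b I x = 0 := by
  by_contra h
  exact hx (hb.support_subset I hI h)

variable {𝓕} in
theorem IsMartDiffFamily.measurable {ν : Measure X} {b : Set X → X → ℝ}
    (hb : 𝓕.IsMartDiffFamily ν b) {I : Set X} (hI : I ∈ 𝓕.intervals) : Measurable (b I) :=
  𝓕.measurable_of_const_on_children hI (fun _ => hb.eq_zero hI) (hb.const_on_children I hI)

variable {𝓕} in
theorem IsMartDiffFamily.eq_on_ssubset {ν : Measure X} {b : Set X → X → ℝ}
    (hb : 𝓕.IsMartDiffFamily ν b) {I K : Set X} (hI : I ∈ 𝓕.intervals) (hK : K ∈ 𝓕.intervals)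
    (h : K ⊂ I) {x y : X} (hx : x ∈ K) (hy : y ∈ K) : b I x = b I y := by
  obtain ⟨I', hI', hKI'⟩ := 𝓕.exists_child_of_ssubset hI hK h
  exact hb.const_on_children I hI I' hI' x (hKI' hx) y (hKI' hy)

end AtomicFiltration

/-! ### Scalar inequalities: Young, Taylor, and the one-step Bellman estimates. -/

section RealInequalities

theorem mul_rpow_sub_one_le {q x y : ℝ} (hq : 1 ≤ q) (hx : 0 ≤ x) (hy : 0 ≤ y) :
    q * (x * y ^ (q - 1)) ≤ x ^ q + (q - 1) * y ^ q := by
  have hq0 : 0 < q := by linarith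
  have h := Real.geom_mean_le_arith_mean2_weighted (w₁ := 1 / q) (w₂ := (q - 1) / q)
    (p₁ := x ^ q) (p₂ := y ^ q) (by positivity) (div_nonneg (by linarith) hq0.le) (by positivity)
    (by positivity) (by field_simp; ring)
  rw [← Real.rpow_mul hx, ← Real.rpow_mul hy, mul_one_div_cancel hq0.ne', Real.rpow_one,
    mul_div_cancel₀ _ hq0.ne'] at h
  calc q * (x * y ^ (q - 1)) ≤ q * (1 / q * x ^ q + (q - 1) / q * y ^ q) := by gcongr
    _ = _ := by field_simp

theorem exists_mul_rpow_le {α β ε : ℝ} (hα : 0 < α) (hβ : 0 < β) (hε : 0 < ε) :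
    ∃ C : ℝ, 0 < C ∧ ∀ x y : ℝ, 0 ≤ x → 0 ≤ y →
      x ^ α * y ^ β ≤ ε * x ^ (α + β) + C * y ^ (α + β) := by
  -- The threshold is chosen so that `δ ^ β = ε`: below it the first term on the right dominates,
  -- above it the second.
  set δ : ℝ := ε ^ (1 / β) with hδ
  have hδ0 : 0 < δ := Real.rpow_pos_of_pos hε _
  refine ⟨(δ⁻¹) ^ α, by positivity, fun x y hx hy => ?_⟩
  rcases le_total y (δ * x) with h | h
  · calc x ^ α * y ^ β ≤ x ^ α * (δ * x) ^ β := by gcongr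
      _ = ε * x ^ (α + β) := by
        rw [Real.mul_rpow hδ0.le hx, hδ, ← Real.rpow_mul hε.le, one_div_mul_cancel hβ.ne',
          Real.rpow_one, Real.rpow_add_of_nonneg hx hα.le hβ.le]
        ring
      _ ≤ _ := le_add_of_nonneg_right (by positivity)
  · have hx' : x ≤ δ⁻¹ * y := by
      rw [inv_mul_eq_div, le_div_iff₀ hδ0]; linarith
    calc x ^ α * y ^ β ≤ (δ⁻¹ * y) ^ α * y ^ β := by gcongr
      _ = (δ⁻¹) ^ α * y ^ (α + β) := by
        rw [Real.mul_rpow (by positivity) hy, Real.rpow_add_of_nonneg hy hα.le hβ.le]; ring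
      _ ≤ _ := le_add_of_nonneg_left (by positivity)

/-- One step for Doob's Bellman function `(p-1) m^p - p |g| m^(p-1)`. If a new maximum is reached,
Young's inequality shows that keeping the old `m` only increases the value; then `|g + t| ≥ |g| +
sign(g) t` produces the term linear in `t`. -/
theorem doob_step {p g m t : ℝ} (hp : 1 < p) (hgm : |g| ≤ m) :
    (p - 1) * max m |g + t| ^ p - p * (|g + t| * max m |g + t| ^ (p - 1)) ≤
      (p - 1) * m ^ p - p * (|g| * m ^ (p - 1)) + -(p * (SignType.sign g * m ^ (p - 1))) * t := by
  have hm : 0 ≤ m := (abs_nonneg g).trans hgm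
  have h1 : |g| + SignType.sign g * t ≤ |g + t| := by
    rcases lt_trichotomy g 0 with h | h | h
    · have := neg_le_abs (g + t)
      simp only [h, abs_of_neg, sign_neg, SignType.coe_neg_one]
      linarith
    · simp [h]
    · have := le_abs_self (g + t)
      simp only [h, abs_of_pos, sign_pos, SignType.coe_one]
      linarith
  have h2 : (p - 1) * max m |g + t| ^ p - p * (|g + t| * max m |g + t| ^ (p - 1)) ≤
      (p - 1) * m ^ p - p * (|g + t| * m ^ (p - 1)) := by
    rcases le_total |g + t| m with h | h
    · rw [max_eq_left h]
    · rw [max_eq_right h]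
      have h3 := mul_rpow_sub_one_le hp.le (abs_nonneg (g + t)) hm
      have h4 : |g + t| * |g + t| ^ (p - 1) = |g + t| ^ p := by
        rw [← Real.rpow_one_add' (abs_nonneg _) (by linarith)]; congr 1; ring
      rw [h4]; linarith
  have h3 : 0 ≤ p * m ^ (p - 1) := by have := Real.rpow_nonneg hm (p - 1); nlinarith
  nlinarith [mul_le_mul_of_nonneg_left h1 h3]

theorem rpow_sub_rpow_le {q x y : ℝ} (hq : 1 ≤ q) (hx : 0 ≤ x) (hy : 0 ≤ y) :
    y ^ q - x ^ q ≤ q * y ^ (q - 1) * (y - x) := by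
  have h := mul_rpow_sub_one_le hq hx hy
  have h4 : y * y ^ (q - 1) = y ^ q := by
    rw [← Real.rpow_one_add' hy (by linarith)]; congr 1; ring
  nlinarith

theorem abs_rpow_taylor_of_nonneg {p g y : ℝ} (hp : 2 ≤ p) (hg : 0 ≤ g) :
    |y| ^ p ≤ g ^ p + p * g ^ (p - 1) * (y - g) +
      p * (p - 1) * (max g |y| ^ (p - 2) * (y - g) ^ 2) := by
  have h5 : ∀ z : ℝ, 0 ≤ z → z * z ^ (p - 1) = z ^ p := fun z hz => by
    rw [← Real.rpow_one_add' hz (by linarith)]; congr 1; ring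
  have h6 : ∀ z : ℝ, 0 ≤ z → z * z ^ (p - 2) = z ^ (p - 1) := fun z hz => by
    rw [← Real.rpow_one_add' hz (by linarith)]; congr 1; ring
  rcases le_total 0 y with hy | hy
  · rw [abs_of_nonneg hy]
    have h1 := rpow_sub_rpow_le (q := p) (by linarith) hg hy
    have h2 : (y ^ (p - 1) - g ^ (p - 1)) * (y - g) ≤
        (p - 1) * (max g y ^ (p - 2) * (y - g) ^ 2) := by
      rcases le_total g y with h | h
      · rw [max_eq_right h]
        have h3 := rpow_sub_rpow_le (q := p - 1) (by linarith) hg hy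
        rw [show p - 1 - 1 = p - 2 by ring] at h3
        nlinarith [mul_le_mul_of_nonneg_right h3 (sub_nonneg.2 h)]
      · rw [max_eq_left h]
        have h3 := rpow_sub_rpow_le (q := p - 1) (by linarith) hy hg
        rw [show p - 1 - 1 = p - 2 by ring] at h3
        nlinarith [mul_le_mul_of_nonneg_right h3 (sub_nonneg.2 h)]
    nlinarith
  -- With opposite signs, each power is bounded by `m ^ (p - 2)` times a quadratic form in `g` and
  -- `z = |y|`; the claim reduces to such a form having nonnegative coefficients, as `p ≥ 2`.
  · rw [abs_of_nonpos hy]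
    obtain ⟨z, rfl⟩ : ∃ z, y = -z := ⟨-y, by ring⟩
    rw [neg_neg]
    have hz : 0 ≤ z := by linarith
    set m := max g z with hm
    have hm0 : 0 ≤ m := le_max_of_le_left hg
    have e1 : z ^ (p - 1) ≤ m ^ (p - 2) * z := by
      rw [← h6 z hz, mul_comm]
      gcongr
      exact le_max_right _ _
    have e2 : g ^ (p - 1) ≤ m ^ (p - 2) * g := by
      rw [← h6 g hg, mul_comm]
      gcongr
      exact le_max_left _ _
    have hQ : 0 ≤ m ^ (p - 2) := by positivity
    rw [← h5 z hz]
    have hgp : 0 ≤ g ^ p := by positivity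
    have e3 : z * z ^ (p - 1) ≤ m ^ (p - 2) * z ^ 2 := by nlinarith
    have e4 : p * g ^ (p - 1) * (z + g) ≤ p * (m ^ (p - 2) * g) * (z + g) := by gcongr
    have e5 : 0 ≤ m ^ (p - 2) * (g * z) := by positivity
    have e6 : 0 ≤ m ^ (p - 2) * (z ^ 2) := by positivity
    have e7 : 0 ≤ m ^ (p - 2) * (g ^ 2) := by positivity
    have e8 : p * (m ^ (p - 2) * (g * (z + g))) ≤ p * (p - 1) * (m ^ (p - 2) * (z + g) ^ 2) -
        m ^ (p - 2) * z ^ 2 := by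
      have : 0 ≤ (p - 2) * (p + 1) * (m ^ (p - 2) * z ^ 2) +
          p * (2 * (p - 2) + 1) * (m ^ (p - 2) * (g * z)) +
          p * (p - 2) * (m ^ (p - 2) * g ^ 2) := by
        have : 0 ≤ p - 2 := by linarith
        positivity
      nlinarith
    nlinarith

theorem abs_rpow_taylor {p : ℝ} (hp : 2 ≤ p) (g t : ℝ) :
    |g + t| ^ p ≤ |g| ^ p + p * (SignType.sign g * |g| ^ (p - 1)) * t +
      p * (p - 1) * (max |g| |g + t| ^ (p - 2) * t ^ 2) := by
  rcases lt_trichotomy g 0 with h | h | h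
  · have := abs_rpow_taylor_of_nonneg (y := -(g + t)) hp (neg_nonneg.2 h.le)
    rw [abs_neg, ← abs_of_neg h, show -(g + t) - |g| = -t by rw [abs_of_neg h]; ring,
      neg_sq] at this
    rw [sign_neg h]
    simp only [SignType.coe_neg_one]
    linarith
  · have := abs_rpow_taylor_of_nonneg (y := t) hp le_rfl
    subst h
    rw [Real.zero_rpow (by linarith : p - 1 ≠ 0)] at this
    simpa using this
  · have := abs_rpow_taylor_of_nonneg (y := g + t) hp h.le
    rw [abs_of_pos h, sign_pos h]
    simp only [SignType.coe_one]
    simpa using this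

/-- The second-order Taylor remainder of `|g|^p` is at most `p(p-1) m^(p-2) t²` with the updated
maximum `m`, which is exactly what the increase of `a` by `t²` pays for. -/
theorem burkholder_reverse_step {p g a m t : ℝ} (hp : 2 < p) (hgm : |g| ≤ m) (ha : 0 ≤ a) :
    |g + t| ^ p - p * (p - 1) * (max m |g + t| ^ (p - 2) * (a + t ^ 2)) ≤
      |g| ^ p - p * (p - 1) * (m ^ (p - 2) * a) + p * (SignType.sign g * |g| ^ (p - 1)) * t := by
  have hm : 0 ≤ m := (abs_nonneg g).trans hgm
  have h := abs_rpow_taylor hp.le g t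
  have h1 : max |g| |g + t| ^ (p - 2) ≤ max m |g + t| ^ (p - 2) := by
    gcongr
  have h2 : m ^ (p - 2) ≤ max m |g + t| ^ (p - 2) := by
    gcongr
    exact le_max_left _ _
  have h3 := mul_le_mul_of_nonneg_right h1 (sq_nonneg t)
  have h4 := mul_le_mul_of_nonneg_right h2 ha
  have h5 : 0 ≤ p * (p - 1) := by nlinarith
  nlinarith [mul_le_mul_of_nonneg_left h3 h5, mul_le_mul_of_nonneg_left h4 h5]

theorem burkholder_step {r g a m t : ℝ} (hr : 1 < r) (hgm : |g| ≤ m) (ha : 0 ≤ a) :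
    (a + t ^ 2) ^ r - r * ((g + t) ^ 2 * (a + t ^ 2) ^ (r - 1)) -
        4 * r * (max m |g + t| ^ 2 * (a + t ^ 2) ^ (r - 1)) ≤
      a ^ r - r * (g ^ 2 * a ^ (r - 1)) - 4 * r * (m ^ 2 * a ^ (r - 1)) +
        -(2 * r * (g * a ^ (r - 1))) * t := by
  have hm : 0 ≤ m := (abs_nonneg g).trans hgm
  have h1 := rpow_sub_rpow_le (q := r) (x := a) (y := a + t ^ 2) hr.le ha (by positivity)
  set P := a ^ (r - 1)
  set Q := (a + t ^ 2) ^ (r - 1)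
  set m' := max m |g + t|
  have hPQ : P ≤ Q := Real.rpow_le_rpow ha (by nlinarith [sq_nonneg t]) (by linarith)
  have hP : 0 ≤ P := Real.rpow_nonneg ha _
  have hmm : m ≤ m' := le_max_left _ _
  -- The jump is at most twice the updated maximum. This is what the correction `4 r m² a^(r-1)` is
  -- for: it absorbs the part of `t²` multiplied by the increment `Q - P`.
  have ht : t ^ 2 ≤ 4 * m' ^ 2 := by
    have : |t| ≤ 2 * m' := by
      calc |t| = |(g + t) - g| := by ring_nf
        _ ≤ |g + t| + |g| := abs_sub _ _
        _ ≤ 2 * m' := by have := le_max_right m |g + t|; linarith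
    calc t ^ 2 = |t| ^ 2 := (sq_abs t).symm
      _ ≤ (2 * m') ^ 2 := by gcongr
      _ = _ := by ring
  have h2 : m ^ 2 * P ≤ m' ^ 2 * P := by gcongr
  have h3 : (Q - P) * (t ^ 2 - 4 * m' ^ 2) ≤ 0 :=
    mul_nonpos_of_nonneg_of_nonpos (by linarith) (by linarith)
  have h4 : 0 ≤ (Q - P) * (g + t) ^ 2 := mul_nonneg (by linarith) (sq_nonneg _)
  have h5 : Q * t ^ 2 - (g + t) ^ 2 * Q + g ^ 2 * P - 4 * (m' ^ 2 * Q) + 4 * (m ^ 2 * P) +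
      2 * (g * P) * t ≤ 0 := by nlinarith
  have h6 := mul_le_mul_of_nonneg_left h5 (by linarith : 0 ≤ r)
  nlinarith

end RealInequalities

/-! ### The state process of a finite martingale and the Bellman function method. -/

section Burkholder

variable {X ι : Type*}

/-- The state `(g, a, m)` of the process with increments `d i` (the head of the list being the
last increment): the sum, the sum of squares and the running maximum of `|g|`. -/
def runState (d : ι → X → ℝ) : List ι → X → ℝ × ℝ × ℝ
  | [], _ => (0, 0, 0)
  | i :: l, x => ((runState d l x).1 + d i x, (runState d l x).2.1 + d i x ^ 2,
      max (runState d l x).2.2 |(runState d l x).1 + d i x|)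

theorem runState_fst (d : ι → X → ℝ) (l : List ι) (x : X) :
    (runState d l x).1 = (l.map fun i => d i x).sum := by
  induction l with
  | nil => rfl
  | cons i l ih => simp [runState, ih, add_comm]

theorem runState_snd_fst (d : ι → X → ℝ) (l : List ι) (x : X) :
    (runState d l x).2.1 = (l.map fun i => d i x ^ 2).sum := by
  induction l with
  | nil => rfl
  | cons i l ih => simp [runState, ih, add_comm]

theorem runState_congr {d : ι → X → ℝ} {l : List ι} {x y : X} (h : ∀ i ∈ l, d i x = d i y) :
    runState d l x = runState d l y := by
  induction l with
  | nil => rfl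
  | cons i l ih =>
    have h1 := ih fun j hj => h j (List.mem_cons_of_mem _ hj)
    simp [runState, h1, h i List.mem_cons_self]

theorem abs_runState_le (d : ι → X → ℝ) (l : List ι) (x : X) :
    |(runState d l x).1| ≤ (runState d l x).2.2 := by
  cases l with
  | nil => simp [runState]
  | cons i l => exact le_max_right _ _

theorem runState_snd_fst_nonneg (d : ι → X → ℝ) (l : List ι) (x : X) :
    0 ≤ (runState d l x).2.1 := by
  induction l with
  | nil => simp [runState]
  | cons i l ih => exact add_nonneg ih (sq_nonneg _)

theorem runState_le (d : ι → X → ℝ) (l : List ι) (x : X) :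
    (runState d l x).2.2 ≤ (l.map fun i => |d i x|).sum ∧
      (runState d l x).2.1 ≤ (l.map fun i => |d i x|).sum ^ 2 := by
  induction l with
  | nil => simp [runState]
  | cons i l ih =>
    have h0 : 0 ≤ (l.map fun i => |d i x|).sum := List.sum_nonneg (by simp)
    have h1 := abs_nonneg (d i x)
    simp only [runState, List.map_cons, List.sum_cons]
    refine ⟨max_le (by linarith) ?_, ?_⟩
    · have := abs_add_le (runState d l x).1 (d i x)
      have := abs_runState_le d l x
      linarith
    · rw [← sq_abs (d i x)]
      nlinarith

variable [MeasurableSpace X] {ν : Measure X}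

theorem measurable_runState {d : ι → X → ℝ} {l : List ι} (h : ∀ i ∈ l, Measurable (d i)) :
    Measurable (runState d l) := by
  induction l with
  | nil => exact measurable_const
  | cons i l ih =>
    have h1 := ih fun j hj => h j (List.mem_cons_of_mem _ hj)
    have h2 := h i List.mem_cons_self
    have h3 : Measurable fun x => (runState d l x).1 + d i x := h1.fst.add h2
    exact h3.prodMk ((h1.snd.fst.add (h2.pow_const 2)).prodMk (h1.snd.snd.max h3.abs))

theorem memLp_list_sum {d : ι → X → ℝ} {l : List ι} {q : ℝ≥0∞} (h : ∀ i ∈ l, MemLp (d i) q ν) :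
    MemLp (fun x => (l.map fun i => |d i x|).sum) q ν := by
  induction l with
  | nil => simp
  | cons i l ih =>
    have h1 := ih fun j hj => h j (List.mem_cons_of_mem _ hj)
    have h2 := h i List.mem_cons_self
    simpa using! h2.abs.add h1

theorem integrable_rpow_of_memLp {f : X → ℝ} {p : ℝ} (hp : 0 < p)
    (h : MemLp f (ENNReal.ofReal p) ν) : Integrable (fun x => |f x| ^ p) ν := by
  have := h.integrable_norm_rpow (by simpa using hp) ENNReal.ofReal_ne_top
  simpa [ENNReal.toReal_ofReal hp.le] using this

/-- Both `m^p` and `a^(p/2)` are at most the `p`-th power of `∑ |d i|`, which is in `L^p` since the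
sum is finite. -/
theorem integrable_runState {p : ℝ} (hp : 2 < p) {d : ι → X → ℝ} {l : List ι}
    (hd : ∀ i ∈ l, Measurable (d i)) (hLp : ∀ i ∈ l, MemLp (d i) (ENNReal.ofReal p) ν)
    {Φ : ℝ × ℝ × ℝ → ℝ} (hΦ : Continuous Φ) {C : ℝ} (hC : 0 ≤ C)
    (hb : ∀ g a m, |g| ≤ m → 0 ≤ a → |Φ (g, a, m)| ≤ C * (m ^ p + a ^ (p / 2))) :
    Integrable (fun x => Φ (runState d l x)) ν := by
  have h1 := (integrable_rpow_of_memLp (by linarith) (memLp_list_sum hLp)).const_mul (2 * C)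
  refine h1.mono' (hΦ.measurable.comp (measurable_runState hd)).aestronglyMeasurable
    (Eventually.of_forall fun x => ?_)
  have h2 := abs_runState_le d l x
  have h3 := runState_snd_fst_nonneg d l x
  obtain ⟨h4, h5⟩ := runState_le d l x
  have hD : 0 ≤ (l.map fun i => |d i x|).sum := List.sum_nonneg (by simp)
  simp only [abs_of_nonneg hD, Real.norm_eq_abs]
  set D := (l.map fun i => |d i x|).sum
  have e1 : (runState d l x).2.2 ^ p ≤ D ^ p :=
    Real.rpow_le_rpow ((abs_nonneg _).trans h2) h4 (by linarith)
  have e2 : (runState d l x).2.1 ^ (p / 2) ≤ D ^ p := by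
    calc _ ≤ (D ^ 2) ^ (p / 2) := Real.rpow_le_rpow h3 h5 (by linarith)
      _ = D ^ p := by rw [← Real.rpow_natCast, ← Real.rpow_mul hD]; congr 1; push_cast; ring
  calc |Φ (runState d l x)| ≤ C * ((runState d l x).2.2 ^ p + (runState d l x).2.1 ^ (p / 2)) :=
        hb _ _ _ h2 h3
    _ ≤ C * (D ^ p + D ^ p) := by gcongr
    _ = 2 * C * D ^ p := by ring

/-- The list `l` of sets, with functions `d i` living on `K i`, is ordered like a martingale: on
`K i` all the previous increments are constant, and `d i` has mean zero. -/
structure IsMartingaleList (ν : Measure X) (d : ι → X → ℝ) (K : ι → Set X) (l : List ι) :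
    Prop where
  measurable : ∀ i ∈ l, Measurable (d i)
  integrable : ∀ i ∈ l, Integrable (d i) ν
  eq_zero : ∀ i ∈ l, ∀ x, x ∉ K i → d i x = 0
  integral_eq_zero : ∀ i ∈ l, ∫ x, d i x ∂ν = 0
  pairwise : l.Pairwise fun i j => ∀ x ∈ K i, ∀ y ∈ K i, d j x = d j y

theorem IsMartingaleList.tail {d : ι → X → ℝ} {K : ι → Set X} {i : ι} {l : List ι}
    (h : IsMartingaleList ν d K (i :: l)) : IsMartingaleList ν d K l where
  measurable j hj := h.measurable j (List.mem_cons_of_mem _ hj)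
  integrable j hj := h.integrable j (List.mem_cons_of_mem _ hj)
  eq_zero j hj := h.eq_zero j (List.mem_cons_of_mem _ hj)
  integral_eq_zero j hj := h.integral_eq_zero j (List.mem_cons_of_mem _ hj)
  pairwise := (List.pairwise_cons.1 h.pairwise).2

/-- The Bellman function method: a function of the state that is a supermartingale in the sense of
a pointwise one-step inequality has nonpositive integral. -/
theorem IsMartingaleList.integral_nonpos {p : ℝ} (hp : 2 < p) {d : ι → X → ℝ} {K : ι → Set X}
    {l : List ι} (h : IsMartingaleList ν d K l)
    (hLp : ∀ i ∈ l, MemLp (d i) (ENNReal.ofReal p) ν)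
    {Φ Λ : ℝ × ℝ × ℝ → ℝ} (hΦ : Continuous Φ) {C : ℝ} (hC : 0 ≤ C)
    (hb : ∀ g a m, |g| ≤ m → 0 ≤ a → |Φ (g, a, m)| ≤ C * (m ^ p + a ^ (p / 2)))
    (h0 : Φ (0, 0, 0) = 0)
    (hstep : ∀ g a m t, |g| ≤ m → 0 ≤ a →
      Φ (g + t, a + t ^ 2, max m |g + t|) ≤ Φ (g, a, m) + Λ (g, a, m) * t) :
    ∫ x, Φ (runState d l x) ∂ν ≤ 0 := by
  induction l with
  | nil => simp [runState, h0]
  | cons i l ih =>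
    have hLp' : ∀ j ∈ l, MemLp (d j) (ENNReal.ofReal p) ν := fun j hj =>
      hLp j (List.mem_cons_of_mem _ hj)
    have hi : i ∈ i :: l := List.mem_cons_self
    have ih' := ih h.tail hLp'
    have hI := integrable_runState hp h.measurable hLp hΦ hC hb
    have hI' := integrable_runState hp h.tail.measurable hLp' hΦ hC hb
    -- The earlier increments are constant on `K i`, hence so is the coefficient of `d i`, and the
    -- linear term integrates to zero.
    obtain ⟨c, hc⟩ : ∃ c : ℝ, ∀ x ∈ K i, Λ (runState d l x) = c := by
      by_cases hne : (K i).Nonempty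
      · obtain ⟨y, hy⟩ := hne
        refine ⟨Λ (runState d l y), fun x hx => ?_⟩
        rw [runState_congr fun j hj => (List.pairwise_cons.1 h.pairwise).1 j hj x hx y hy]
      · exact ⟨0, fun x hx => absurd ⟨x, hx⟩ hne⟩
    have hle : ∀ x, Φ (runState d (i :: l) x) ≤ Φ (runState d l x) + c * d i x := by
      intro x
      have hm := abs_runState_le d l x
      by_cases hx : x ∈ K i
      · rw [← hc x hx]
        exact hstep _ _ _ _ hm (runState_snd_fst_nonneg d l x)
      · have : runState d (i :: l) x = runState d l x := by
          simp [runState, h.eq_zero i hi x hx, max_eq_left hm]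
        rw [this, h.eq_zero i hi x hx]
        simp
    calc ∫ x, Φ (runState d (i :: l) x) ∂ν ≤ ∫ x, (Φ (runState d l x) + c * d i x) ∂ν :=
          integral_mono hI (hI'.add ((h.integrable i hi).const_mul c)) hle
      _ = ∫ x, Φ (runState d l x) ∂ν := by
          rw [integral_add hI' ((h.integrable i hi).const_mul c), integral_const_mul,
            h.integral_eq_zero i hi]
          simp
      _ ≤ 0 := ih'

/-- Bellman functions contain mixed terms such as `|g| m^(p-1)`. It suffices that `Φ` dominates a
difference `u - v` of pure powers, which Young's inequality supplies. -/
theorem IsMartingaleList.integral_le_integral {p : ℝ} (hp : 2 < p) {d : ι → X → ℝ}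
    {K : ι → Set X} {l : List ι} (h : IsMartingaleList ν d K l)
    (hLp : ∀ i ∈ l, MemLp (d i) (ENNReal.ofReal p) ν)
    {Φ Λ u v : ℝ × ℝ × ℝ → ℝ} (hΦ : Continuous Φ) {C : ℝ} (hC : 0 ≤ C)
    (hb : ∀ g a m, |g| ≤ m → 0 ≤ a → |Φ (g, a, m)| ≤ C * (m ^ p + a ^ (p / 2)))
    (h0 : Φ (0, 0, 0) = 0)
    (hstep : ∀ g a m t, |g| ≤ m → 0 ≤ a →
      Φ (g + t, a + t ^ 2, max m |g + t|) ≤ Φ (g, a, m) + Λ (g, a, m) * t)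
    (hu : Integrable (fun x => u (runState d l x)) ν)
    (hv : Integrable (fun x => v (runState d l x)) ν)
    (huv : ∀ g a m, |g| ≤ m → 0 ≤ a → u (g, a, m) - v (g, a, m) ≤ Φ (g, a, m)) :
    ∫ x, u (runState d l x) ∂ν ≤ ∫ x, v (runState d l x) ∂ν := by
  rw [← sub_nonpos, ← integral_sub hu hv]
  refine le_trans (integral_mono (hu.sub hv) (integrable_runState hp h.measurable hLp hΦ hC hb)
    fun x => ?_) (h.integral_nonpos hp hLp hΦ hC hb h0 hstep)
  exact huv _ _ _ (abs_runState_le d l x) (runState_snd_fst_nonneg d l x)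

end Burkholder

/-! ### Doob's and Burkholder's inequalities for finite martingales. -/

section BurkholderIneq

/-- Young's inequality for the homogeneous pair `a^(1/2)` and `m`. -/
theorem exists_sq_mul_rpow_le {p ε : ℝ} (hp : 2 < p) (hε : 0 < ε) :
    ∃ C : ℝ, 0 < C ∧ ∀ m a : ℝ, 0 ≤ m → 0 ≤ a →
      m ^ 2 * a ^ (p / 2 - 1) ≤ ε * a ^ (p / 2) + C * m ^ p := by
  obtain ⟨C, hC, h⟩ := exists_mul_rpow_le (α := p - 2) (β := 2) (by linarith) (by norm_num) hε
  refine ⟨C, hC, fun m a hm ha => ?_⟩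
  have h1 := h (a ^ (1 / 2 : ℝ)) m (by positivity) hm
  rw [← Real.rpow_mul ha, ← Real.rpow_mul ha, show p - 2 + 2 = p by ring, Real.rpow_two,
    show 1 / 2 * (p - 2) = p / 2 - 1 by ring, show 1 / 2 * p = p / 2 by ring] at h1
  linarith

theorem exists_rpow_mul_le {p ε : ℝ} (hp : 2 < p) (hε : 0 < ε) :
    ∃ C : ℝ, 0 < C ∧ ∀ m a : ℝ, 0 ≤ m → 0 ≤ a →
      m ^ (p - 2) * a ≤ ε * m ^ p + C * a ^ (p / 2) := by
  obtain ⟨C, hC, h⟩ := exists_mul_rpow_le (α := p - 2) (β := 2) (by linarith) (by norm_num) hε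
  refine ⟨C, hC, fun m a hm ha => ?_⟩
  have h1 := h m (a ^ (1 / 2 : ℝ)) hm (by positivity)
  rw [← Real.rpow_mul ha, ← Real.rpow_mul ha, show p - 2 + 2 = p by ring,
    show 1 / 2 * p = p / 2 by ring, show (1 / 2 : ℝ) * 2 = 1 by norm_num, Real.rpow_one] at h1
  linarith

theorem exists_mul_rpow_sub_one_le {p ε : ℝ} (hp : 1 < p) (hε : 0 < ε) :
    ∃ C : ℝ, 0 < C ∧ ∀ m g : ℝ, 0 ≤ m → 0 ≤ g →
      g * m ^ (p - 1) ≤ ε * m ^ p + C * g ^ p := by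
  obtain ⟨C, hC, h⟩ := exists_mul_rpow_le (α := p - 1) (β := 1) (by linarith) (by norm_num) hε
  refine ⟨C, hC, fun m g hm hg => ?_⟩
  have h1 := h m g hm hg
  rw [show p - 1 + 1 = p by ring, Real.rpow_one] at h1
  linarith

variable {p : ℝ}

section Integrability

variable {X ι : Type*} [MeasurableSpace X] {ν : Measure X} {d : ι → X → ℝ} {l : List ι}

theorem integrable_runState_max (hp : 2 < p) (hd : ∀ i ∈ l, Measurable (d i))
    (hLp : ∀ i ∈ l, MemLp (d i) (ENNReal.ofReal p) ν) :
    Integrable (fun x => (runState d l x).2.2 ^ p) ν :=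
  integrable_runState hp hd hLp (Φ := fun s => s.2.2 ^ p) (C := 1)
    (continuous_snd.snd.rpow_const fun _ => Or.inr (by linarith)) zero_le_one
    (fun g a m hg ha => by
      have hm : 0 ≤ m := (abs_nonneg g).trans hg
      rw [abs_of_nonneg (by positivity), one_mul]
      exact le_add_of_nonneg_right (by positivity))

theorem integrable_runState_sq (hp : 2 < p) (hd : ∀ i ∈ l, Measurable (d i))
    (hLp : ∀ i ∈ l, MemLp (d i) (ENNReal.ofReal p) ν) :
    Integrable (fun x => (runState d l x).2.1 ^ (p / 2)) ν :=
  integrable_runState hp hd hLp (Φ := fun s => s.2.1 ^ (p / 2)) (C := 1)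
    (continuous_snd.fst.rpow_const fun _ => Or.inr (by linarith)) zero_le_one
    (fun g a m hg ha => by
      have hm : 0 ≤ m := (abs_nonneg g).trans hg
      rw [abs_of_nonneg (by positivity), one_mul]
      exact le_add_of_nonneg_left (by positivity))

theorem integrable_runState_fst (hp : 2 < p) (hd : ∀ i ∈ l, Measurable (d i))
    (hLp : ∀ i ∈ l, MemLp (d i) (ENNReal.ofReal p) ν) :
    Integrable (fun x => |(runState d l x).1| ^ p) ν :=
  integrable_runState hp hd hLp (Φ := fun s => |s.1| ^ p) (C := 1)
    (continuous_fst.abs.rpow_const fun _ => Or.inr (by linarith)) zero_le_one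
    (fun g a m hg ha => by
      have hm : 0 ≤ m := (abs_nonneg g).trans hg
      rw [abs_of_nonneg (by positivity), one_mul]
      have : |g| ^ p ≤ m ^ p := by gcongr
      have : 0 ≤ a ^ (p / 2) := by positivity
      linarith)

end Integrability

universe u v

/-- Doob's maximal inequality in `L^p`. -/
theorem IsMartingaleList.exists_doob (hp : 2 < p) : ∃ C : ℝ, 0 < C ∧
    ∀ {X : Type u} {ι : Type v} [MeasurableSpace X] {ν : Measure X} {d : ι → X → ℝ}
      {K : ι → Set X} {l : List ι}, IsMartingaleList ν d K l →
      (∀ i ∈ l, MemLp (d i) (ENNReal.ofReal p) ν) →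
      ∫ x, (runState d l x).2.2 ^ p ∂ν ≤ C * ∫ x, |(runState d l x).1| ^ p ∂ν := by
  -- After multiplication by `p`, this `ε` costs half of the coefficient `p - 1` of `m^p`.
  obtain ⟨C, hC, hY⟩ := exists_mul_rpow_sub_one_le (p := p) (ε := (p - 1) / (2 * p)) (by linarith)
    (div_pos (by linarith) (by linarith))
  refine ⟨2 * p * C / (p - 1), div_pos (by nlinarith) (by linarith), ?_⟩
  intro X ι _ ν d K l h hLp
  have hmain := h.integral_le_integral hp hLp
    (Φ := fun s => (p - 1) * s.2.2 ^ p - p * (|s.1| * s.2.2 ^ (p - 1)))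
    (Λ := fun s => -(p * (SignType.sign s.1 * s.2.2 ^ (p - 1)))) (C := 2 * p)
    (u := fun s => (p - 1) / 2 * s.2.2 ^ p) (v := fun s => p * C * |s.1| ^ p)
    (((continuous_snd.snd.rpow_const fun _ => Or.inr (by linarith)).const_mul _).sub
      ((continuous_fst.abs.mul
        (continuous_snd.snd.rpow_const fun _ => Or.inr (by linarith))).const_mul _))
    (by linarith) (fun g a m hg ha => by
      have hm : 0 ≤ m := (abs_nonneg g).trans hg
      have h1 : |g| * m ^ (p - 1) ≤ m ^ p := by
        calc |g| * m ^ (p - 1) ≤ m * m ^ (p - 1) := by gcongr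
          _ = m ^ p := by rw [← Real.rpow_one_add' hm (by linarith)]; congr 1; ring
      have h2 : 0 ≤ m ^ p := by positivity
      have h3 : 0 ≤ a ^ (p / 2) := by positivity
      have h4 : 0 ≤ |g| * m ^ (p - 1) := by positivity
      rw [abs_le]
      constructor <;> nlinarith)
    (by simp [Real.zero_rpow (by linarith : p ≠ 0)])
    (fun g a m t hg _ => doob_step (by linarith) hg)
    ((integrable_runState_max hp h.measurable hLp).const_mul _)
    ((integrable_runState_fst hp h.measurable hLp).const_mul _)
    (fun g a m hg ha => by
      have hy := mul_le_mul_of_nonneg_left (hY m |g| ((abs_nonneg g).trans hg) (abs_nonneg g))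
        (by linarith : 0 ≤ p)
      have e : p * ((p - 1) / (2 * p) * m ^ p + C * |g| ^ p) =
          (p - 1) / 2 * m ^ p + p * C * |g| ^ p := by
        have : p ≠ 0 := by linarith
        field_simp
      simp only
      linarith)
  rw [integral_const_mul, integral_const_mul] at hmain
  rw [div_mul_eq_mul_div, le_div_iff₀ (by linarith)]
  linarith

/-- The square function is bounded by the maximal function in `L^p`. -/
theorem IsMartingaleList.exists_square_le_max (hp : 2 < p) : ∃ C : ℝ, 0 < C ∧
    ∀ {X : Type u} {ι : Type v} [MeasurableSpace X] {ν : Measure X} {d : ι → X → ℝ}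
      {K : ι → Set X} {l : List ι}, IsMartingaleList ν d K l →
      (∀ i ∈ l, MemLp (d i) (ENNReal.ofReal p) ν) →
      ∫ x, (runState d l x).2.1 ^ (p / 2) ∂ν ≤ C * ∫ x, (runState d l x).2.2 ^ p ∂ν := by
  -- As `g² ≤ m²`, the two mixed terms together have coefficient at most `p/2 + 4(p/2) = 5p/2`; this
  -- `ε` makes them cost half of `a^(p/2)`.
  obtain ⟨C, hC, hY⟩ := exists_sq_mul_rpow_le (p := p) (ε := 1 / (5 * p)) hp (by positivity)
  obtain ⟨C₁, hC₁, hY₁⟩ := exists_sq_mul_rpow_le (p := p) (ε := 1) hp one_pos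
  refine ⟨5 * p * C, by nlinarith [mul_pos (by linarith : 0 < p) hC], ?_⟩
  intro X ι _ ν d K l h hLp
  have hr : 0 ≤ p / 2 - 1 := by linarith
  have hmain := h.integral_le_integral hp hLp
    (Φ := fun s => s.2.1 ^ (p / 2) - p / 2 * (s.1 ^ 2 * s.2.1 ^ (p / 2 - 1)) -
      4 * (p / 2) * (s.2.2 ^ 2 * s.2.1 ^ (p / 2 - 1)))
    (Λ := fun s => -(2 * (p / 2) * (s.1 * s.2.1 ^ (p / 2 - 1)))) (C := 1 + 5 * p * (1 + C₁))
    (u := fun s => 1 / 2 * s.2.1 ^ (p / 2)) (v := fun s => 5 * p / 2 * C * s.2.2 ^ p)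
    (((continuous_snd.fst.rpow_const fun _ => Or.inr (by linarith)).sub
      (((continuous_fst.pow 2).mul (continuous_snd.fst.rpow_const fun _ => Or.inr hr)).const_mul
        _)).sub (((continuous_snd.snd.pow 2).mul
        (continuous_snd.fst.rpow_const fun _ => Or.inr hr)).const_mul _))
    (by positivity) (fun g a m hg ha => by
      have hm : 0 ≤ m := (abs_nonneg g).trans hg
      have h1 := hY₁ m a hm ha
      have h2 : g ^ 2 * a ^ (p / 2 - 1) ≤ m ^ 2 * a ^ (p / 2 - 1) := by
        gcongr ?_ * _
        exact sq_le_sq.2 (by rwa [abs_of_nonneg hm])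
      have h3 : 0 ≤ a ^ (p / 2) := by positivity
      have h4 : 0 ≤ g ^ 2 * a ^ (p / 2 - 1) := by positivity
      have h5 : 0 ≤ m ^ p := by positivity
      have h6 : m ^ 2 * a ^ (p / 2 - 1) ≤ (1 + C₁) * (m ^ p + a ^ (p / 2)) := by nlinarith
      have h7 := mul_le_mul_of_nonneg_left h6 (by linarith : 0 ≤ p)
      have h8 := mul_le_mul_of_nonneg_left h2 (by linarith : 0 ≤ p)
      have h9 := mul_nonneg (by linarith : 0 ≤ p) h4
      have h10 : 0 ≤ p * ((1 + C₁) * (m ^ p + a ^ (p / 2))) := by positivity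
      simp only
      rw [abs_le]
      constructor <;> linarith)
    (by simp [Real.zero_rpow (by linarith : p / 2 ≠ 0)])
    (fun g a m t hg ha => burkholder_step (by linarith) hg ha)
    ((integrable_runState_sq hp h.measurable hLp).const_mul _)
    ((integrable_runState_max hp h.measurable hLp).const_mul _)
    (fun g a m hg ha => by
      have hm : 0 ≤ m := (abs_nonneg g).trans hg
      have hy := mul_le_mul_of_nonneg_left (hY m a hm ha) (by linarith : 0 ≤ 5 / 2 * p)
      have h2 : g ^ 2 * a ^ (p / 2 - 1) ≤ m ^ 2 * a ^ (p / 2 - 1) := by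
        gcongr ?_ * _
        exact sq_le_sq.2 (by rwa [abs_of_nonneg hm])
      have h8 := mul_le_mul_of_nonneg_left h2 (by linarith : 0 ≤ p / 2)
      have e : 5 / 2 * p * (1 / (5 * p) * a ^ (p / 2) + C * m ^ p) =
          1 / 2 * a ^ (p / 2) + 5 * p / 2 * C * m ^ p := by
        have : p ≠ 0 := by linarith
        field_simp
      simp only
      linarith)
  rw [integral_const_mul, integral_const_mul] at hmain
  linarith

/-- The sum of a martingale is bounded by its square function in `L^p`, up to an arbitrarily small
multiple of the maximal function. -/
theorem IsMartingaleList.exists_sum_le (hp : 2 < p) {ε : ℝ} (hε : 0 < ε) : ∃ C : ℝ, 0 < C ∧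
    ∀ {X : Type u} {ι : Type v} [MeasurableSpace X] {ν : Measure X} {d : ι → X → ℝ}
      {K : ι → Set X} {l : List ι}, IsMartingaleList ν d K l →
      (∀ i ∈ l, MemLp (d i) (ENNReal.ofReal p) ν) →
      ∫ x, |(runState d l x).1| ^ p ∂ν ≤ ε * ∫ x, (runState d l x).2.2 ^ p ∂ν +
        C * ∫ x, (runState d l x).2.1 ^ (p / 2) ∂ν := by
  have hpp : 0 < p * (p - 1) := mul_pos (by linarith) (by linarith)
  obtain ⟨C, hC, hY⟩ := exists_rpow_mul_le (p := p) (ε := ε / (p * (p - 1))) hp (by positivity)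
  obtain ⟨C₁, hC₁, hY₁⟩ := exists_rpow_mul_le (p := p) (ε := 1) hp one_pos
  refine ⟨p * (p - 1) * C, by positivity, ?_⟩
  intro X ι _ ν d K l h hLp
  have i1 := (integrable_runState_max hp h.measurable hLp).const_mul ε
  have i2 := (integrable_runState_sq hp h.measurable hLp).const_mul (p * (p - 1) * C)
  have hmain := h.integral_le_integral hp hLp
    (Φ := fun s => |s.1| ^ p - p * (p - 1) * (s.2.2 ^ (p - 2) * s.2.1))
    (Λ := fun s => p * (SignType.sign s.1 * |s.1| ^ (p - 1))) (C := 1 + p * (p - 1) * (1 + C₁))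
    (u := fun s => |s.1| ^ p)
    (v := fun s => ε * s.2.2 ^ p + p * (p - 1) * C * s.2.1 ^ (p / 2))
    ((continuous_fst.abs.rpow_const fun _ => Or.inr (by linarith)).sub
      (((continuous_snd.snd.rpow_const fun _ => Or.inr (by linarith)).mul
        continuous_snd.fst).const_mul _))
    (by positivity) (fun g a m hg ha => by
      have hm : 0 ≤ m := (abs_nonneg g).trans hg
      have h1 := hY₁ m a hm ha
      have h2 : |g| ^ p ≤ m ^ p := by gcongr
      have h3 : 0 ≤ a ^ (p / 2) := by positivity
      have h4 : 0 ≤ m ^ (p - 2) * a := by positivity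
      have h5 : 0 ≤ |g| ^ p := by positivity
      have h5' : 0 ≤ m ^ p := by positivity
      have h6 : m ^ (p - 2) * a ≤ (1 + C₁) * (m ^ p + a ^ (p / 2)) := by nlinarith
      have h7 := mul_le_mul_of_nonneg_left h6 hpp.le
      have h9 := mul_nonneg hpp.le h4
      have h10 : 0 ≤ p * (p - 1) * ((1 + C₁) * (m ^ p + a ^ (p / 2))) := by positivity
      simp only
      rw [abs_le]
      constructor <;> linarith)
    (by simp [Real.zero_rpow (by linarith : p ≠ 0)])
    (fun g a m t hg ha => burkholder_reverse_step hp hg ha)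
    (integrable_runState_fst hp h.measurable hLp) (i1.add i2)
    (fun g a m hg ha => by
      have hm : 0 ≤ m := (abs_nonneg g).trans hg
      have hy := mul_le_mul_of_nonneg_left (hY m a hm ha) hpp.le
      have e : p * (p - 1) * (ε / (p * (p - 1)) * m ^ p + C * a ^ (p / 2)) =
          ε * m ^ p + p * (p - 1) * C * a ^ (p / 2) := by
        have h1 : p ≠ 0 := by linarith
        have h2 : p - 1 ≠ 0 := by linarith
        field_simp
      rw [e] at hy
      simp only
      linarith)
  rwa [integral_add i1 i2, integral_const_mul, integral_const_mul] at hmain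

/-- **Burkholder's inequality**: for `2 < p < ∞` the sum and the square function of a finite
martingale have comparable `L^p` norms. -/
theorem IsMartingaleList.exists_burkholder (hp : 2 < p) : ∃ C : ℝ, 0 < C ∧
    ∀ {X : Type u} {ι : Type v} [MeasurableSpace X] {ν : Measure X} {d : ι → X → ℝ}
      {K : ι → Set X} {l : List ι}, IsMartingaleList ν d K l →
      (∀ i ∈ l, MemLp (d i) (ENNReal.ofReal p) ν) →
      ∫ x, |(runState d l x).1| ^ p ∂ν ≤ C * ∫ x, (runState d l x).2.1 ^ (p / 2) ∂ν ∧
      ∫ x, (runState d l x).2.1 ^ (p / 2) ∂ν ≤ C * ∫ x, |(runState d l x).1| ^ p ∂ν := by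
  obtain ⟨C₁, hC₁, h₁⟩ := IsMartingaleList.exists_doob.{u, v} hp
  obtain ⟨C₂, hC₂, h₂⟩ := IsMartingaleList.exists_square_le_max.{u, v} hp
  -- Doob's inequality turns this multiple of the maximal term into half of the left-hand side,
  -- which is then absorbed.
  obtain ⟨C₃, hC₃, h₃⟩ := IsMartingaleList.exists_sum_le.{u, v} hp (ε := 1 / (2 * C₁))
    (by positivity)
  refine ⟨max (2 * C₃) (C₂ * C₁), by positivity, ?_⟩
  intro X ι _ ν d K l h hLp
  have e₁ := h₁ h hLp
  have e₂ := h₂ h hLp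
  have e₃ := h₃ h hLp
  have n₁ : 0 ≤ ∫ x, |(runState d l x).1| ^ p ∂ν := integral_nonneg fun x => by positivity
  have n₂ : 0 ≤ ∫ x, (runState d l x).2.1 ^ (p / 2) ∂ν := integral_nonneg fun x =>
    Real.rpow_nonneg (runState_snd_fst_nonneg d l x) _
  constructor
  · have e₄ := mul_le_mul_of_nonneg_left e₁ (by positivity : 0 ≤ 1 / (2 * C₁))
    have e₅ : 1 / (2 * C₁) * (C₁ * ∫ x, |(runState d l x).1| ^ p ∂ν) =
        1 / 2 * ∫ x, |(runState d l x).1| ^ p ∂ν := by field_simp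
    have := mul_le_mul_of_nonneg_right (le_max_left (2 * C₃) (C₂ * C₁)) n₂
    linarith
  · have e₄ := mul_le_mul_of_nonneg_left e₁ hC₂.le
    have := mul_le_mul_of_nonneg_right (le_max_right (2 * C₃) (C₂ * C₁)) n₁
    linarith

end BurkholderIneq

/-- A finite partially ordered set can be listed so that no element is above an earlier one. -/
theorem Finset.exists_list_pairwise_not_le {α : Type*} [PartialOrder α] (F : Finset α) :
    ∃ l : List α, l.Nodup ∧ (∀ a, a ∈ l ↔ a ∈ F) ∧ l.Pairwise fun a b => ¬ b ≤ a := by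
  classical
  induction F using Finset.strongInduction with
  | H F ih =>
    rcases F.eq_empty_or_nonempty with rfl | hne
    · exact ⟨[], by simp⟩
    · obtain ⟨a, ha⟩ := F.exists_minimal hne
      obtain ⟨l, hl, hmem, hp⟩ := ih (F.erase a) (Finset.erase_ssubset ha.1)
      refine ⟨a :: l, List.nodup_cons.2 ⟨by simp [hmem], hl⟩, fun b => ?_,
        List.pairwise_cons.2 ⟨fun b hb hba => ?_, hp⟩⟩
      · rw [List.mem_cons, hmem, Finset.mem_erase]
        by_cases h : b = a
        · simp [h, ha.1]
        · simp [h]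
      · have hb' := Finset.mem_erase.1 ((hmem b).1 hb)
        exact hb'.1 (le_antisymm hba (ha.2 hb'.2 hba))

/-! ### Burkholder's inequality for families indexed by intervals. -/

namespace AtomicFiltration

section

variable {X : Type*} [MeasurableSpace X] {𝓕 : AtomicFiltration X} {ν : Measure X}
  {b : Set X → X → ℝ}

theorem IsMartDiffFamily.const_mul (hb : 𝓕.IsMartDiffFamily ν b) (a : Set X → ℝ) :
    𝓕.IsMartDiffFamily ν fun I x => a I * b I x where
  integrable I hI := (hb.integrable I hI).const_mul _
  support_subset I hI := by
    intro x hx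
    exact hb.support_subset I hI fun h => hx (by simp [h])
  const_on_children I hI I' hI' x hx y hy := by
    rw [hb.const_on_children I hI I' hI' x hx y hy]
  integral_eq_zero I hI := by rw [integral_const_mul, hb.integral_eq_zero I hI, mul_zero]

theorem IsMartDiffFamily.integral_eq_zero' (hb : 𝓕.IsMartDiffFamily ν b) {I : Set X}
    (hI : I ∈ 𝓕.intervals) : ∫ x, b I x ∂ν = 0 := by
  rw [← hb.integral_eq_zero I hI, setIntegral_eq_integral_of_forall_compl_eq_zero]
  exact fun x hx => hb.eq_zero hI hx

/-- By nestedness, an `I` not contained in `K` is either disjoint from `K` or strictly contains it.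
This is why ordering a finite family by inclusion, small intervals last in time, gives a martingale.
-/
theorem IsMartDiffFamily.eq_on_of_not_subset (hb : 𝓕.IsMartDiffFamily ν b) {I K : Set X}
    (hI : I ∈ 𝓕.intervals) (hK : K ∈ 𝓕.intervals) (h : ¬ I ⊆ K) {x y : X} (hx : x ∈ K)
    (hy : y ∈ K) : b I x = b I y := by
  by_cases hd : ∃ z, z ∈ I ∧ z ∈ K
  · obtain ⟨z, hzI, hzK⟩ := hd
    have hKI : K ⊆ I := (𝓕.subset_or_subset hI hK hzI hzK).resolve_left h
    exact hb.eq_on_ssubset hI hK ⟨hKI, h⟩ hx hy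
  · rw [hb.eq_zero hI fun h' => hd ⟨x, h', hx⟩, hb.eq_zero hI fun h' => hd ⟨y, h', hy⟩]

theorem IsMartDiffFamily.isMartingaleList (hb : 𝓕.IsMartDiffFamily ν b) {l : List (Set X)}
    (hl : ∀ I ∈ l, I ∈ 𝓕.intervals) (hp : l.Pairwise fun I J => ¬ J ≤ I) :
    IsMartingaleList ν b id l where
  measurable I hI := hb.measurable (hl I hI)
  integrable I hI := hb.integrable I (hl I hI)
  eq_zero I hI x hx := hb.eq_zero (hl I hI) hx
  integral_eq_zero I hI := hb.integral_eq_zero' (hl I hI)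
  pairwise := hp.imp_of_mem fun {I J} hI hJ h x hx y hy =>
    hb.eq_on_of_not_subset (hl J hJ) (hl I hI) h hx hy

/-- If a finite sum of martingale differences is in `L^p`, then so is each of them. -/
theorem IsMartDiffFamily.memLp_of_sum (hb : 𝓕.IsMartDiffFamily ν b) (hν : 𝓕.LocallyFinite ν)
    {q : ℝ≥0∞} {F : Finset (Set X)} (hF : ∀ I ∈ F, I ∈ 𝓕.intervals)
    (h : MemLp (fun x => ∑ I ∈ F, b I x) q ν) : ∀ I ∈ F, MemLp (b I) q ν := by
  classical
  induction F using Finset.strongInduction with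
  | H F ih =>
    rcases F.eq_empty_or_nonempty with rfl | hne
    · simp
    obtain ⟨K, hK⟩ := F.exists_minimal hne
    have hKF := hK.1
    have hKi := hF K hKF
    have hKm := 𝓕.interval_measurable hKi
    have hbK : MemLp (b K) q ν := by
      obtain ⟨y, hy⟩ := 𝓕.nonempty_of_mem_intervals hKi
      -- On a minimal `K` all the other terms are constant, so `b K` is recovered from the full sum
      -- by cutting off to `K` and subtracting a constant.
      have h1 : b K = fun x => K.indicator (fun x => ∑ I ∈ F, b I x) x -
          K.indicator (fun _ => ∑ I ∈ F.erase K, b I y) x := by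
        funext x
        by_cases hx : x ∈ K
        · rw [Set.indicator_of_mem hx, Set.indicator_of_mem hx, ← Finset.add_sum_erase F _ hKF]
          have : ∑ I ∈ F.erase K, b I x = ∑ I ∈ F.erase K, b I y := by
            refine Finset.sum_congr rfl fun I hI => ?_
            obtain ⟨hIK, hIF⟩ := Finset.mem_erase.1 hI
            exact hb.eq_on_of_not_subset (hF I hIF) hKi
              (fun hs => hIK (le_antisymm hs (hK.2 hIF hs))) hx hy
          rw [this]; ring
        · rw [Set.indicator_of_notMem hx, Set.indicator_of_notMem hx, hb.eq_zero hKi hx, sub_zero]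
      rw [h1]
      exact (h.indicator hKm).sub (memLp_indicator_const _ hKm _ (Or.inr (hν K hKi).ne))
    have hrest : MemLp (fun x => ∑ I ∈ F.erase K, b I x) q ν := by
      have h1 : (fun x => ∑ I ∈ F.erase K, b I x) = fun x => (∑ I ∈ F, b I x) - b K x := by
        funext x
        rw [← Finset.add_sum_erase F _ hKF]; ring
      rw [h1]
      exact h.sub hbK
    intro I hI
    by_cases hIK : I = K
    · rw [hIK]; exact hbK
    · exact ih (F.erase K) (Finset.erase_ssubset hKF)
        (fun J hJ => hF J (Finset.mem_of_mem_erase hJ)) hrest I (Finset.mem_erase.2 ⟨hIK, hI⟩)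

end

universe u

/-- **Burkholder's inequality** for finite sums of martingale differences. -/
theorem exists_burkholder {p : ℝ} (hp : 2 < p) : ∃ C : ℝ≥0, 0 < C ∧
    ∀ {X : Type u} [MeasurableSpace X] {𝓕 : AtomicFiltration X} {ν : Measure X}
      {b : Set X → X → ℝ}, 𝓕.IsMartDiffFamily ν b → ∀ {F : Finset (Set X)},
      (∀ I ∈ F, I ∈ 𝓕.intervals) → (∀ I ∈ F, MemLp (b I) (ENNReal.ofReal p) ν) →
      ∫⁻ x, ‖∑ I ∈ F, b I x‖ₑ ^ p ∂ν ≤ C * ∫⁻ x, (∑ I ∈ F, ‖b I x‖ₑ ^ 2) ^ (p / 2) ∂ν ∧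
      ∫⁻ x, (∑ I ∈ F, ‖b I x‖ₑ ^ 2) ^ (p / 2) ∂ν ≤ C * ∫⁻ x, ‖∑ I ∈ F, b I x‖ₑ ^ p ∂ν := by
  obtain ⟨C, hC, h⟩ := IsMartingaleList.exists_burkholder.{u, u} hp
  refine ⟨C.toNNReal, by simpa using hC, ?_⟩
  intro X _ 𝓕 ν b hb F hF hLp
  obtain ⟨l, hnd, hmem, hpw⟩ := F.exists_list_pairwise_not_le
  have hl : IsMartingaleList ν b id l :=
    hb.isMartingaleList (fun I hI => hF I ((hmem I).1 hI)) hpw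
  have hlLp : ∀ I ∈ l, MemLp (b I) (ENNReal.ofReal p) ν := fun I hI => hLp I ((hmem I).1 hI)
  have hFl : F = l.toFinset := by
    ext I
    rw [List.mem_toFinset, hmem]
  have e1 : ∫⁻ x, ‖∑ I ∈ F, b I x‖ₑ ^ p ∂ν =
      ENNReal.ofReal (∫ x, |(runState b l x).1| ^ p ∂ν) := by
    rw [ofReal_integral_eq_lintegral_ofReal (integrable_runState_fst hp hl.measurable hlLp)
      (Eventually.of_forall fun x => by positivity)]
    refine lintegral_congr fun x => ?_
    rw [← ENNReal.ofReal_rpow_of_nonneg (abs_nonneg _) (by linarith), ← Real.norm_eq_abs,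
      ofReal_norm, runState_fst, hFl, List.sum_toFinset _ hnd]
  have e2 : ∫⁻ x, (∑ I ∈ F, ‖b I x‖ₑ ^ 2) ^ (p / 2) ∂ν =
      ENNReal.ofReal (∫ x, (runState b l x).2.1 ^ (p / 2) ∂ν) := by
    rw [ofReal_integral_eq_lintegral_ofReal (integrable_runState_sq hp hl.measurable hlLp)
      (Eventually.of_forall fun x => Real.rpow_nonneg (runState_snd_fst_nonneg b l x) _)]
    refine lintegral_congr fun x => ?_
    rw [← ENNReal.ofReal_rpow_of_nonneg (runState_snd_fst_nonneg b l x) (by linarith),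
      runState_snd_fst, hFl, ← List.sum_toFinset _ hnd,
      ENNReal.ofReal_sum_of_nonneg fun I _ => sq_nonneg _]
    congr 1
    refine Finset.sum_congr rfl fun I _ => ?_
    rw [← sq_abs, ENNReal.ofReal_pow (abs_nonneg _), ← Real.norm_eq_abs, ofReal_norm]
  rw [e1, e2]
  obtain ⟨h1, h2⟩ := h hl hlLp
  have e3 : ((C.toNNReal : ℝ≥0) : ℝ≥0∞) = ENNReal.ofReal C := rfl
  rw [e3, ← ENNReal.ofReal_mul hC.le, ← ENNReal.ofReal_mul hC.le]
  exact ⟨ENNReal.ofReal_le_ofReal h1, ENNReal.ofReal_le_ofReal h2⟩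

end AtomicFiltration

/-! ### From weak-type to strong-type estimates. -/

theorem ENNReal.exists_mul_rpow_sub_one_le {s ε : ℝ} (hs : 1 < s) (hε : 0 < ε) :
    ∃ C : ℝ≥0, 0 < C ∧ ∀ m g : ℝ≥0∞,
      g * m ^ (s - 1) ≤ ENNReal.ofReal ε * m ^ s + C * g ^ s := by
  obtain ⟨C, hC, h⟩ := _root_.exists_mul_rpow_sub_one_le hs hε
  refine ⟨C.toNNReal, by simpa using hC, fun m g => ?_⟩
  have hs0 : 0 < s := by linarith
  by_cases hm : m = ∞
  · simp [hm, hs0, ENNReal.mul_top, hε]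
  by_cases hg : g = ∞
  · have : (C.toNNReal : ℝ≥0∞) ≠ 0 := by simpa using hC
    rw [hg, ENNReal.top_rpow_of_pos hs0, ENNReal.mul_top this]
    simp
  lift m to ℝ≥0 using hm
  lift g to ℝ≥0 using hg
  have h1 := h m g m.2 g.2
  rw [← ENNReal.coe_rpow_of_nonneg _ (by linarith), ← ENNReal.coe_rpow_of_nonneg _ hs0.le,
    ← ENNReal.coe_rpow_of_nonneg _ hs0.le, ENNReal.ofReal]
  norm_cast
  rw [← NNReal.coe_le_coe]
  push_cast
  rw [Real.coe_toNNReal _ hε.le, Real.coe_toNNReal _ hC.le]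
  exact h1

section WeakToStrong

variable {X : Type*} [MeasurableSpace X] {μ : Measure X}

/-- Both sides are expanded by the layer cake formula, the right one for the measure with density
`φ`; the weak inequality compares the integrands at each level. -/
theorem lintegral_rpow_le_of_weak {f φ : X → ℝ≥0∞} (hf : Measurable f) (hφ : Measurable φ)
    {s : ℝ} (hs : 1 < s) (hfin : ∀ x, f x ≠ ∞)
    (hw : ∀ t : ℝ≥0∞, t * μ {x | t < f x} ≤ ∫⁻ x in {x | t < f x}, φ x ∂μ) :
    ∫⁻ x, f x ^ s ∂μ ≤ ENNReal.ofReal (s / (s - 1)) * ∫⁻ x, φ x * f x ^ (s - 1) ∂μ := by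
  have hs1 : 0 < s - 1 := by linarith
  have hs0 : 0 < s := by linarith
  have hpow : ∀ (q : ℝ), 0 < q → ∀ x, f x ^ q = ENNReal.ofReal ((f x).toReal ^ q) := by
    intro q hq x
    rw [← ENNReal.ofReal_rpow_of_nonneg ENNReal.toReal_nonneg hq.le, ENNReal.ofReal_toReal (hfin x)]
  have hset : ∀ t : ℝ, 0 < t → {x | t < (f x).toReal} = {x | ENNReal.ofReal t < f x} := by
    intro t ht
    ext x
    simp only [Set.mem_ofPred_eq]
    rw [ENNReal.ofReal_lt_iff_lt_toReal ht.le (hfin x)]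
  have hmeas : ∀ t : ℝ≥0∞, MeasurableSet {x | t < f x} := fun t =>
    measurableSet_lt measurable_const hf
  have e1 : ∫⁻ x, f x ^ s ∂μ = ENNReal.ofReal s *
      ∫⁻ t in Set.Ioi 0, μ {x | t < (f x).toReal} * ENNReal.ofReal (t ^ (s - 1)) := by
    rw [← lintegral_rpow_eq_lintegral_meas_lt_mul μ (Eventually.of_forall fun x =>
      ENNReal.toReal_nonneg) hf.ennreal_toReal.aemeasurable hs0]
    exact lintegral_congr (hpow s hs0)
  have e2 : ∫⁻ x, φ x * f x ^ (s - 1) ∂μ = ENNReal.ofReal (s - 1) *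
      ∫⁻ t in Set.Ioi 0, μ.withDensity φ {x | t < (f x).toReal} *
        ENNReal.ofReal (t ^ (s - 1 - 1)) := by
    rw [← lintegral_rpow_eq_lintegral_meas_lt_mul (μ.withDensity φ) (Eventually.of_forall fun x =>
      ENNReal.toReal_nonneg) hf.ennreal_toReal.aemeasurable hs1,
      ← lintegral_congr (hpow (s - 1) hs1),
      lintegral_withDensity_eq_lintegral_mul μ hφ (hf.pow_const _)]
    rfl
  have h3 : ∫⁻ t in Set.Ioi 0, μ {x | t < (f x).toReal} * ENNReal.ofReal (t ^ (s - 1)) ≤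
      ∫⁻ t in Set.Ioi 0, μ.withDensity φ {x | t < (f x).toReal} *
        ENNReal.ofReal (t ^ (s - 1 - 1)) := by
    refine setLIntegral_mono' measurableSet_Ioi fun t ht => ?_
    have ht : (0 : ℝ) < t := ht
    rw [hset t ht, withDensity_apply _ (hmeas _)]
    have : ENNReal.ofReal (t ^ (s - 1)) =
        ENNReal.ofReal t * ENNReal.ofReal (t ^ (s - 1 - 1)) := by
      rw [← ENNReal.ofReal_mul ht.le, ← Real.rpow_one_add' ht.le (by linarith)]
      congr 2; ring
    rw [this, ← mul_assoc, mul_comm (μ _)]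
    gcongr
    exact hw _
  rw [e1, e2, ← mul_assoc, ← ENNReal.ofReal_mul (by positivity), div_mul_cancel₀ _ hs1.ne']
  gcongr

/-- Young's inequality leaves half of `∫ f^s` on the right. It is absorbed, which is where the a
priori finiteness is needed. -/
theorem exists_lintegral_rpow_le_of_weak {s : ℝ} (hs : 1 < s) : ∃ C : ℝ≥0, 0 < C ∧
    ∀ {X : Type*} [MeasurableSpace X] {μ : Measure X} {f φ : X → ℝ≥0∞}, Measurable f →
      Measurable φ → (∀ x, f x ≠ ∞) → ∫⁻ x, f x ^ s ∂μ ≠ ∞ →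
      (∀ t : ℝ≥0∞, t * μ {x | t < f x} ≤ ∫⁻ x in {x | t < f x}, φ x ∂μ) →
      ∫⁻ x, f x ^ s ∂μ ≤ C * ∫⁻ x, φ x ^ s ∂μ := by
  have hs1 : 0 < s - 1 := by linarith
  set k : ℝ := s / (s - 1) with hk
  have hk0 : 0 < k := by positivity
  obtain ⟨C, hC, h⟩ := ENNReal.exists_mul_rpow_sub_one_le hs (ε := 1 / (2 * k)) (by positivity)
  refine ⟨2 * k.toNNReal * C, by have : 0 < k.toNNReal := by simpa using hk0
                                 positivity, ?_⟩
  intro X _ μ f φ hf hφ hfin hint hw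
  have h1 := lintegral_rpow_le_of_weak hf hφ hs hfin hw
  have h2 : ∫⁻ x, φ x * f x ^ (s - 1) ∂μ ≤
      ENNReal.ofReal (1 / (2 * k)) * ∫⁻ x, f x ^ s ∂μ + C * ∫⁻ x, φ x ^ s ∂μ := by
    rw [← lintegral_const_mul _ (hf.pow_const _), ← lintegral_const_mul _ (hφ.pow_const _),
      ← lintegral_add_left ((hf.pow_const _).const_mul _)]
    exact lintegral_mono fun x => h _ _
  have h3 : ENNReal.ofReal k * ENNReal.ofReal (1 / (2 * k)) = 2⁻¹ := by
    rw [← ENNReal.ofReal_mul hk0.le, show k * (1 / (2 * k)) = 2⁻¹ by field_simp,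
      ENNReal.ofReal_inv_of_pos two_pos]
    simp
  have h4 : ∫⁻ x, f x ^ s ∂μ ≤ 2⁻¹ * ∫⁻ x, f x ^ s ∂μ +
      ENNReal.ofReal k * (C * ∫⁻ x, φ x ^ s ∂μ) := by
    calc _ ≤ _ := h1
      _ ≤ ENNReal.ofReal k * (ENNReal.ofReal (1 / (2 * k)) * ∫⁻ x, f x ^ s ∂μ +
          C * ∫⁻ x, φ x ^ s ∂μ) := by gcongr
      _ = _ := by rw [mul_add, ← mul_assoc, h3]
  have h5 : 2⁻¹ * ∫⁻ x, f x ^ s ∂μ ≤ ENNReal.ofReal k * (C * ∫⁻ x, φ x ^ s ∂μ) := by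
    have h6 : ∫⁻ x, f x ^ s ∂μ = 2⁻¹ * ∫⁻ x, f x ^ s ∂μ + 2⁻¹ * ∫⁻ x, f x ^ s ∂μ := by
      rw [← add_mul, ENNReal.inv_two_add_inv_two, one_mul]
    nth_rw 1 [h6] at h4
    exact (ENNReal.add_le_add_iff_left (ENNReal.mul_ne_top (by simp) hint)).1 h4
  calc ∫⁻ x, f x ^ s ∂μ = 2 * (2⁻¹ * ∫⁻ x, f x ^ s ∂μ) := by
        rw [← mul_assoc, ENNReal.mul_inv_cancel (by simp) (by simp), one_mul]
    _ ≤ 2 * (ENNReal.ofReal k * (C * ∫⁻ x, φ x ^ s ∂μ)) := by gcongr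
    _ = _ := by push_cast; rw [ENNReal.ofReal]; ring

end WeakToStrong

/-! ### The maximal theorem. -/

namespace AtomicFiltration

variable {X : Type*} [MeasurableSpace X] (𝓕 : AtomicFiltration X)

/-- The maximal function associated with the filtration. -/
noncomputable def maximalFn (μ : Measure X) (φ : X → ℝ≥0∞) (x : X) : ℝ≥0∞ :=
  ⨆ J : 𝓕.intervals, (J : Set X).indicator (fun _ => ⨍⁻ y in (J : Set X), φ y ∂μ) x

theorem measurable_maximalFn (μ : Measure X) (φ : X → ℝ≥0∞) : Measurable (𝓕.maximalFn μ φ) := by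
  have := 𝓕.intervals_countable.to_subtype
  exact Measurable.iSup fun J => measurable_const.indicator (𝓕.interval_measurable J.2)

theorem setLAverage_le_maximalFn (μ : Measure X) (φ : X → ℝ≥0∞) {J : Set X}
    (hJ : J ∈ 𝓕.intervals) {x : X} (hx : x ∈ J) : ⨍⁻ y in J, φ y ∂μ ≤ 𝓕.maximalFn μ φ x := by
  refine le_trans ?_ (le_iSup _ (⟨J, hJ⟩ : 𝓕.intervals))
  simp [Set.indicator_of_mem hx]

/-- A minimal interval of `F` is either disjoint from the union of the others or contained in it, so
it can be split off or discarded. -/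
theorem mul_measure_biUnion_le {μ : Measure X} {φ : X → ℝ≥0∞} {t : ℝ≥0∞} {F : Finset (Set X)}
    (hF : ∀ I ∈ F, I ∈ 𝓕.intervals) (h : ∀ I ∈ F, t * μ I ≤ ∫⁻ x in I, φ x ∂μ) :
    t * μ (⋃ I ∈ F, I) ≤ ∫⁻ x in ⋃ I ∈ F, I, φ x ∂μ := by
  classical
  induction F using Finset.strongInduction with
  | H F ih =>
    rcases F.eq_empty_or_nonempty with rfl | hne
    · simp
    obtain ⟨K, hK⟩ := F.exists_minimal hne
    have hKF := hK.1
    have ih' := ih (F.erase K) (Finset.erase_ssubset hKF)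
      (fun J hJ => hF J (Finset.mem_of_mem_erase hJ)) (fun J hJ => h J (Finset.mem_of_mem_erase hJ))
    have hU : ⋃ I ∈ F, I = K ∪ ⋃ I ∈ F.erase K, I := by
      conv_lhs => rw [← Finset.insert_erase hKF]
      rw [Finset.set_biUnion_insert]
    by_cases hd : Disjoint K (⋃ I ∈ F.erase K, I)
    · have hm : MeasurableSet (⋃ I ∈ F.erase K, I) := Finset.measurableSet_biUnion _ fun I hI =>
        𝓕.interval_measurable (hF I (Finset.mem_of_mem_erase hI))
      rw [hU, measure_union hd hm, lintegral_union hm hd, mul_add]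
      exact add_le_add (h K hKF) ih'
    · rw [Set.not_disjoint_iff] at hd
      obtain ⟨x, hxK, hx⟩ := hd
      simp only [Set.mem_iUnion] at hx
      obtain ⟨J, hJ, hxJ⟩ := hx
      obtain ⟨hJK, hJF⟩ := Finset.mem_erase.1 hJ
      have hKJ : K ⊆ J := by
        rcases 𝓕.subset_or_subset (hF K hKF) (hF J hJF) hxK hxJ with h | h
        · exact h
        · exact hK.2 hJF h
      have : K ⊆ ⋃ I ∈ F.erase K, I := fun y hy => by
        simp only [Set.mem_iUnion]
        exact ⟨J, hJ, hKJ hy⟩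
      rw [hU, Set.union_eq_self_of_subset_left this]
      exact ih'

theorem setLIntegral_ne_top {μ : Measure X} {φ : X → ℝ≥0∞} {s : ℝ} (hs : 1 < s)
    (hφ : ∫⁻ x, φ x ^ s ∂μ ≠ ∞) {J : Set X} (hJ : μ J ≠ ∞) :
    ∫⁻ x in J, φ x ∂μ ≠ ∞ := by
  have h1 : ∫⁻ x in J, φ x ∂μ ≤ ∫⁻ x in J, (1 + φ x ^ s) ∂μ := by
    refine lintegral_mono fun x => ?_
    rcases le_total (φ x) 1 with h | h
    · exact h.trans le_self_add
    · calc φ x = φ x ^ (1 : ℝ) := (ENNReal.rpow_one _).symm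
        _ ≤ φ x ^ s := ENNReal.rpow_le_rpow_of_exponent_le h hs.le
        _ ≤ _ := le_add_self
  refine ne_top_of_le_ne_top ?_ h1
  rw [lintegral_add_left measurable_const]
  refine ENNReal.add_ne_top.2 ⟨by simpa using hJ, ne_top_of_le_ne_top hφ (setLIntegral_le_lintegral _ _)⟩

/-- The maximal theorem: the maximal function is bounded in `L^s` for `1 < s < ∞`. -/
theorem exists_maximal {s : ℝ} (hs : 1 < s) : ∃ C : ℝ≥0, 0 < C ∧
    ∀ {X : Type*} [MeasurableSpace X] {𝓕 : AtomicFiltration X} {μ : Measure X},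
      𝓕.LocallyFinite μ → ∀ {φ : X → ℝ≥0∞}, Measurable φ →
      ∫⁻ x, 𝓕.maximalFn μ φ x ^ s ∂μ ≤ C * ∫⁻ x, φ x ^ s ∂μ := by
  classical
  obtain ⟨C, hC, h⟩ := exists_lintegral_rpow_le_of_weak hs
  refine ⟨C, hC, ?_⟩
  intro X _ 𝓕 μ hμ φ hφ
  have hs0 : 0 < s := by linarith
  by_cases htop : ∫⁻ x, φ x ^ s ∂μ = ∞
  · rw [htop, ENNReal.mul_top (by simpa using hC.ne')]
    exact le_top
  have := 𝓕.intervals_countable.to_subtype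
  set a : 𝓕.intervals → X → ℝ≥0∞ := fun J =>
    (J : Set X).indicator (fun _ => ⨍⁻ y in (J : Set X), φ y ∂μ) with ha
  have ham : ∀ J, Measurable (a J) := fun J =>
    measurable_const.indicator (𝓕.interval_measurable J.2)
  have hat : ∀ J x, a J x ≠ ∞ := by
    intro J x
    by_cases hx : x ∈ (J : Set X)
    · simp only [ha, Set.indicator_of_mem hx]
      exact (setLAverage_lt_top (setLIntegral_ne_top hs htop (hμ J J.2).ne)).ne
    · simp [ha, Set.indicator_of_notMem hx]
  -- Maxima over finitely many intervals have finite `L^s` norm, as absorption requires, and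
  -- superlevel sets that are finite unions of intervals. Monotone convergence gives the full
  -- maximal function.
  set M : Finset 𝓕.intervals → X → ℝ≥0∞ := fun G x => G.sup fun J => a J x with hM
  have hMm : ∀ G, Measurable (M G) := fun G => by
    simp only [hM, Finset.sup_eq_iSup]
    exact Measurable.iSup fun J => Measurable.iSup fun _ => ham J
  have key : ∀ G, ∫⁻ x, M G x ^ s ∂μ ≤ C * ∫⁻ x, φ x ^ s ∂μ := by
    intro G
    refine h (hMm G) hφ (fun x => ?_) ?_ fun t => ?_
    · exact ((Finset.sup_lt_iff ENNReal.zero_lt_top).2 fun J _ => (hat J x).lt_top).ne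
    · have h1 : ∀ x, M G x ^ s ≤ ∑ J ∈ G, a J x ^ s := by
        intro x
        rcases G.eq_empty_or_nonempty with rfl | hne
        · simp [hM, hs0]
        · obtain ⟨J, hJ, hJx⟩ := G.exists_mem_eq_sup hne fun J => a J x
          simp only [hM, hJx]
          exact Finset.single_le_sum (f := fun J => a J x ^ s) (fun _ _ => zero_le) hJ
      refine ne_top_of_le_ne_top ?_ (lintegral_mono h1)
      rw [lintegral_finsetSum _ fun J _ => (ham J).pow_const s]
      refine ENNReal.sum_ne_top.2 fun J _ => ?_
      have h2 : ∀ x, a J x ^ s = (J : Set X).indicator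
          (fun _ => (⨍⁻ y in (J : Set X), φ y ∂μ) ^ s) x := by
        intro x
        by_cases hx : x ∈ (J : Set X)
        · simp [ha, hx]
        · simp [ha, hx, hs0]
      rw [lintegral_congr h2, lintegral_indicator_const (𝓕.interval_measurable J.2)]
      exact ENNReal.mul_ne_top (ENNReal.rpow_ne_top_of_nonneg hs0.le
        (setLAverage_lt_top (setLIntegral_ne_top hs htop (hμ J J.2).ne)).ne) (hμ J J.2).ne
    · set F : Finset (Set X) :=
        (G.filter fun J : 𝓕.intervals => t < ⨍⁻ y in (J : Set X), φ y ∂μ).image Subtype.val with hF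
      have hset : {x | t < M G x} = ⋃ I ∈ F, I := by
        ext x
        simp only [Set.mem_ofPred_eq, hM, Finset.lt_sup_iff, Set.mem_iUnion, hF, Finset.mem_image,
          Finset.mem_filter, exists_prop]
        constructor
        · rintro ⟨J, hJ, hlt⟩
          have hx : x ∈ (J : Set X) := by
            by_contra hx
            simp [ha, hx] at hlt
          simp only [ha, Set.indicator_of_mem hx] at hlt
          exact ⟨J, ⟨J, ⟨hJ, hlt⟩, rfl⟩, hx⟩
        · rintro ⟨_, ⟨J, ⟨hJ, hlt⟩, rfl⟩, hx⟩
          exact ⟨J, hJ, by simpa only [ha, Set.indicator_of_mem hx] using hlt⟩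
      rw [hset]
      refine 𝓕.mul_measure_biUnion_le ?_ ?_
      · intro I hI
        obtain ⟨J, _, rfl⟩ := Finset.mem_image.1 hI
        exact J.2
      · intro I hI
        obtain ⟨J, hJ, rfl⟩ := Finset.mem_image.1 hI
        rw [← measure_mul_setLAverage φ (hμ J J.2).ne, mul_comm]
        gcongr
        exact (Finset.mem_filter.1 hJ).2.le
  have e1 : ∀ x, 𝓕.maximalFn μ φ x ^ s = ⨆ G, M G x ^ s := by
    intro x
    have : 𝓕.maximalFn μ φ x = ⨆ G, M G x := by
      simp only [hM, Finset.sup_eq_iSup]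
      exact iSup_eq_iSup_finset _
    rw [this]
    exact (ENNReal.orderIsoRpow s hs0).map_iSup _
  rw [lintegral_congr e1, lintegral_iSup_directed fun G => ((hMm G).pow_const s).aemeasurable]
  · exact iSup_le key
  · refine Monotone.directed_le fun G G' hGG' x => ?_
    exact ENNReal.rpow_le_rpow (Finset.sup_mono hGG') hs0.le

end AtomicFiltration

/-! ### Young's inequality and sums of powers in `[0, ∞]`. -/

theorem ENNReal.mul_le_rpow_add_rpow {s t : ℝ} (hst : s.HolderConjugate t) (a b : ℝ≥0∞) :
    a * b ≤ a ^ s + b ^ t := by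
  refine (ENNReal.young_inequality a b hst).trans (add_le_add ?_ ?_)
  · refine ENNReal.div_le_of_le_mul (le_mul_of_one_le_right' ?_)
    exact ENNReal.one_le_ofReal.2 hst.lt.le
  · refine ENNReal.div_le_of_le_mul (le_mul_of_one_le_right' ?_)
    exact ENNReal.one_le_ofReal.2 hst.symm.lt.le

theorem ENNReal.sum_rpow_le_rpow_sum {ι : Type*} (T : Finset ι) (f : ι → ℝ≥0∞) {s : ℝ}
    (hs : 1 ≤ s) : ∑ i ∈ T, f i ^ s ≤ (∑ i ∈ T, f i) ^ s := by
  classical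
  induction T using Finset.induction_on with
  | empty => simp [zero_lt_one.trans_le hs]
  | insert i T hi ih =>
    rw [Finset.sum_insert hi, Finset.sum_insert hi]
    exact (add_le_add le_rfl ih).trans (ENNReal.add_rpow_le_rpow_add _ _ hs)

/-- A finite family growing geometrically has the sum of its powers bounded by its largest
member. -/
theorem ENNReal.sum_rpow_le_of_doubling {ι : Type*} {T : Finset ι} {N : ι → ℝ≥0∞} {H : ℝ≥0∞}
    {s : ℝ} (hs : 1 ≤ s) (hH : ∀ i ∈ T, N i ≤ H)
    (hd : ∀ i ∈ T, ∀ j ∈ T, i ≠ j → 2 * N i ≤ N j ∨ 2 * N j ≤ N i) :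
    ∑ i ∈ T, N i ^ s ≤ 2 * H ^ s := by
  classical
  have hs0 : 0 < s := by linarith
  induction T using Finset.strongInduction generalizing H with
  | H T ih =>
    rcases T.eq_empty_or_nonempty with rfl | hne
    · simp
    obtain ⟨j, hj, hmax⟩ := T.exists_max_image N hne
    by_cases htop : H = ∞
    · simp [htop, hs0]
    have hjtop : N j ≠ ∞ := ne_top_of_le_ne_top htop (hH j hj)
    -- Besides the largest member, everything is at most half of it, so induction with bound `N j /
    -- 2` gives `2 (N j / 2)^s ≤ N j^s`, using `s ≥ 1`. The reversed alternative forces `N j = 0`.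
    have hrest : ∀ i ∈ T.erase j, N i ≤ N j / 2 := by
      intro i hi
      obtain ⟨hij, hiT⟩ := Finset.mem_erase.1 hi
      rw [ENNReal.le_div_iff_mul_le (by simp) (by simp), mul_comm]
      rcases hd i hiT j hj hij with h | h
      · exact h
      · have h1 : N j + N j ≤ N j := by
          rw [← two_mul]; exact h.trans (hmax i hiT)
        have h2 : N j = 0 := by
          by_contra h0
          exact absurd h1 (not_le.2 (ENNReal.lt_add_right hjtop h0))
        have h3 : N i = 0 := le_antisymm (h2 ▸ hmax i hiT) zero_le
        simp [h3]
    have h1 := ih (T.erase j) (Finset.erase_ssubset hj) hrest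
      (fun a ha b hb => hd a (Finset.mem_of_mem_erase ha) b (Finset.mem_of_mem_erase hb))
    have h2 : 2 * (N j / 2) ^ s ≤ N j ^ s := by
      rw [ENNReal.div_rpow_of_nonneg _ _ hs0.le, ← mul_div_assoc]
      refine ENNReal.div_le_of_le_mul ?_
      rw [mul_comm]
      gcongr
      calc (2 : ℝ≥0∞) = 2 ^ (1 : ℝ) := (ENNReal.rpow_one _).symm
        _ ≤ 2 ^ s := ENNReal.rpow_le_rpow_of_exponent_le one_le_two hs
    rw [← Finset.add_sum_erase T _ hj]
    calc N j ^ s + ∑ i ∈ T.erase j, N i ^ s ≤ N j ^ s + N j ^ s := by gcongr; exact h1.trans h2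
      _ = 2 * N j ^ s := (two_mul _).symm
      _ ≤ 2 * H ^ s := by gcongr; exact hH j hj

/-! ### Stopping families, the Carleson embedding and the corona estimate. -/

section Corona

variable {X : Type*}

open Classical in
/-- The maximal sets among those with a given value of `N`. -/
noncomputable def stops (A : Finset (Set X)) (N : Set X → ℝ≥0∞) : Finset (Set X) :=
  A.filter fun K => ∀ J ∈ A, K ⊂ J → N J ≠ N K

open Classical in
/-- The subsets of `J` with the same value of `N`. -/
noncomputable def level (A : Finset (Set X)) (N : Set X → ℝ≥0∞) (J : Set X) : Finset (Set X) :=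
  A.filter fun I => I ⊆ J ∧ N I = N J

open Classical in
/-- The maximal stopping sets strictly inside `J`. -/
noncomputable def stopChildren (A : Finset (Set X)) (N : Set X → ℝ≥0∞) (J : Set X) :
    Finset (Set X) :=
  (stops A N).filter fun K => K ⊂ J ∧ ∀ L ∈ stops A N, K ⊂ L → ¬ L ⊂ J

/-- A finite laminar family `A` of measurable sets, with weights `N` which increase by a factor of
at least two whenever they increase. -/
structure IsCorona [MeasurableSpace X] (A : Finset (Set X)) (N : Set X → ℝ≥0∞) : Prop where
  measurable : ∀ I ∈ A, MeasurableSet I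
  nonempty : ∀ I ∈ A, I.Nonempty
  laminar : ∀ I ∈ A, ∀ J ∈ A, ∀ x, x ∈ I → x ∈ J → I ⊆ J ∨ J ⊆ I
  anti : ∀ I ∈ A, ∀ J ∈ A, I ⊆ J → N J ≤ N I
  doubling : ∀ I ∈ A, ∀ J ∈ A, N I < N J → 2 * N I ≤ N J

variable {A : Finset (Set X)} {N : Set X → ℝ≥0∞}

theorem mem_stops {K : Set X} : K ∈ stops A N ↔ K ∈ A ∧ ∀ J ∈ A, K ⊂ J → N J ≠ N K := by
  classical
  simp [stops]

theorem mem_level {I J : Set X} : I ∈ level A N J ↔ I ∈ A ∧ I ⊆ J ∧ N I = N J := by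
  classical
  simp [level]

theorem mem_stopChildren {K J : Set X} : K ∈ stopChildren A N J ↔
    K ∈ stops A N ∧ K ⊂ J ∧ ∀ L ∈ stops A N, K ⊂ L → ¬ L ⊂ J := by
  classical
  simp [stopChildren]

theorem exists_mem_level {I : Set X} (hI : I ∈ A) : ∃ J ∈ stops A N, I ∈ level A N J := by
  classical
  obtain ⟨J, hJ⟩ := (A.filter fun J => I ⊆ J ∧ N J = N I).exists_maximal
    ⟨I, by simp [hI]⟩
  obtain ⟨hJA, hIJ, hNJ⟩ := Finset.mem_filter.1 hJ.1
  refine ⟨J, mem_stops.2 ⟨hJA, fun K hK hJK hN => hJK.2 ?_⟩, mem_level.2 ⟨hI, hIJ, hNJ.symm⟩⟩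
  exact hJ.2 (Finset.mem_filter.2 ⟨hK, hIJ.trans hJK.1, hN.trans hNJ⟩) hJK.1

/-- The levels of the stopping sets cover `A`, and the weight is constant on each level. Only
covering is used, so no structure on `A` is needed. -/
theorem sum_le_sum_stops_level (g : ℝ≥0∞ → ℝ≥0∞) (c : Set X → ℝ≥0∞) :
    ∑ I ∈ A, g (N I) * c I ≤ ∑ J ∈ stops A N, g (N J) * ∑ I ∈ level A N J, c I := by
  classical
  have h1 : ∀ J ∈ stops A N, g (N J) * ∑ I ∈ level A N J, c I =
      ∑ I ∈ A, if I ⊆ J ∧ N I = N J then g (N I) * c I else 0 := by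
    intro J _
    rw [Finset.mul_sum, ← Finset.sum_filter]
    refine Finset.sum_congr rfl fun I hI => ?_
    rw [(mem_level.1 hI).2.2]
  rw [Finset.sum_congr rfl h1, Finset.sum_comm]
  refine Finset.sum_le_sum fun I hI => ?_
  obtain ⟨J, hJ, hIJ⟩ := exists_mem_level (N := N) hI
  refine le_trans ?_ (Finset.single_le_sum
    (f := fun J => if I ⊆ J ∧ N I = N J then g (N I) * c I else 0) (fun _ _ => zero_le) hJ)
  rw [if_pos (mem_level.1 hIJ).2]

namespace IsCorona

variable [MeasurableSpace X] {σ ω : Measure X} (hA : IsCorona A N)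

include hA

theorem ssubset_or_ssubset {I J : Set X} (hI : I ∈ A) (hJ : J ∈ A) (hne : I ≠ J) {x : X}
    (hxI : x ∈ I) (hxJ : x ∈ J) : I ⊂ J ∨ J ⊂ I := by
  rcases hA.laminar I hI J hJ x hxI hxJ with h | h
  · exact Or.inl (h.ssubset_of_ne hne)
  · exact Or.inr (h.ssubset_of_ne hne.symm)

theorem two_mul_le_of_stop {K L : Set X} (hK : K ∈ stops A N) (hL : L ∈ stops A N) (h : K ⊂ L) :
    2 * N L ≤ N K := by
  obtain ⟨hKA, hKs⟩ := mem_stops.1 hK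
  have hLA := (mem_stops.1 hL).1
  exact hA.doubling L hLA K hKA (lt_of_le_of_ne (hA.anti K hKA L hLA h.1) (hKs L hLA h))

/-- The stopping sets containing a point form a chain along which `N` at least doubles, so the
pointwise sum of `N^s` is geometric with top term at most `h^s`. -/
theorem sum_stops_le {s : ℝ} (hs : 1 ≤ s) {h : X → ℝ≥0∞} (hh : ∀ I ∈ A, ∀ x ∈ I, N I ≤ h x) :
    ∑ K ∈ stops A N, N K ^ s * σ K ≤ 2 * ∫⁻ x, h x ^ s ∂σ := by
  classical
  have hs0 : 0 < s := by linarith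
  have hm : ∀ K ∈ stops A N, MeasurableSet K := fun K hK => hA.measurable K (mem_stops.1 hK).1
  have e1 : ∑ K ∈ stops A N, N K ^ s * σ K =
      ∫⁻ x, ∑ K ∈ stops A N, K.indicator (fun _ => N K ^ s) x ∂σ := by
    rw [lintegral_finsetSum' _ fun K hK => (measurable_const.indicator (hm K hK)).aemeasurable]
    exact Finset.sum_congr rfl fun K hK => (lintegral_indicator_const (hm K hK) _).symm
  rw [e1, ← lintegral_const_mul' _ _ (by simp)]
  refine lintegral_mono fun x => ?_
  have e2 : ∑ K ∈ stops A N, K.indicator (fun _ => N K ^ s) x =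
      ∑ K ∈ (stops A N).filter (x ∈ ·), N K ^ s := by
    rw [Finset.sum_filter]
    exact Finset.sum_congr rfl fun K _ => by simp [Set.indicator_apply]
  rw [e2]
  refine ENNReal.sum_rpow_le_of_doubling hs (fun K hK => ?_) fun K hK L hL hne => ?_
  · obtain ⟨hK, hx⟩ := Finset.mem_filter.1 hK
    exact hh K (mem_stops.1 hK).1 x hx
  · obtain ⟨hK, hxK⟩ := Finset.mem_filter.1 hK
    obtain ⟨hL, hxL⟩ := Finset.mem_filter.1 hL
    rcases hA.ssubset_or_ssubset (mem_stops.1 hK).1 (mem_stops.1 hL).1 hne hxK hxL with h | h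
    · exact Or.inr (hA.two_mul_le_of_stop hK hL h)
    · exact Or.inl (hA.two_mul_le_of_stop hL hK h)

variable {β : Set X → X → ℝ≥0∞} {s : ℝ} {h : X → ℝ≥0∞}

open Classical in
theorem sum_stops_lintegral_le (hs : 1 ≤ s)
    (htest : ∀ J ∈ A, ∫⁻ x in J, (∑ I ∈ A with I ⊆ J, β I x) ^ s ∂ω ≤ σ J)
    (hh : ∀ I ∈ A, ∀ x ∈ I, N I ≤ h x) :
    ∑ J ∈ stops A N, N J ^ s * ∫⁻ x in J, (∑ I ∈ level A N J, β I x) ^ s ∂ω ≤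
      2 * ∫⁻ x, h x ^ s ∂σ := by
  refine le_trans (Finset.sum_le_sum fun J hJ => ?_) (hA.sum_stops_le hs hh)
  gcongr
  refine le_trans (lintegral_mono fun x => ?_) (htest J (mem_stops.1 hJ).1)
  gcongr
  intro I hI
  obtain ⟨h1, h2, _⟩ := mem_level.1 hI
  simp [h1, h2]

open Classical in
/-- A Carleson embedding. -/
theorem carleson_embedding (hs : 1 ≤ s) (hβ : ∀ I ∈ A, Measurable (β I))
    (hsupp : ∀ I ∈ A, ∀ x, x ∉ I → β I x = 0)
    (htest : ∀ J ∈ A, ∫⁻ x in J, (∑ I ∈ A with I ⊆ J, β I x) ^ s ∂ω ≤ σ J)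
    (hh : ∀ I ∈ A, ∀ x ∈ I, N I ≤ h x) :
    ∑ I ∈ A, N I ^ s * ∫⁻ x, β I x ^ s ∂ω ≤ 2 * ∫⁻ x, h x ^ s ∂σ := by
  refine le_trans ?_ (hA.sum_stops_lintegral_le hs htest hh)
  refine (sum_le_sum_stops_level (fun t => t ^ s) _).trans (Finset.sum_le_sum fun J hJ => ?_)
  gcongr
  have hJm := hA.measurable J (mem_stops.1 hJ).1
  have e : ∀ I ∈ level A N J, ∫⁻ x, β I x ^ s ∂ω = ∫⁻ x in J, β I x ^ s ∂ω := by
    intro I hI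
    obtain ⟨h1, h2, _⟩ := mem_level.1 hI
    rw [setLIntegral_eq_of_support_subset]
    intro x hx
    by_contra hxJ
    exact hx (by simp [hsupp I h1 x fun h' => hxJ (h2 h'), zero_lt_one.trans_le hs])
  rw [Finset.sum_congr rfl e, ← lintegral_finsetSum' _ fun I hI =>
    ((hβ I (mem_level.1 hI).1).pow_const s).aemeasurable]
  -- Since `s ≥ 1`, the sum of powers is below the power of the sum, which testing controls.
  exact lintegral_mono fun x => ENNReal.sum_rpow_le_rpow_sum _ _ hs

theorem stopChildren_pairwiseDisjoint (J : Set X) :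
    (stopChildren A N J : Set (Set X)).PairwiseDisjoint fun K => K := by
  intro K hK L hL hne
  obtain ⟨hK, hKJ, hKm⟩ := mem_stopChildren.1 hK
  obtain ⟨hL, hLJ, hLm⟩ := mem_stopChildren.1 hL
  refine Set.disjoint_left.2 fun x hxK hxL => ?_
  rcases hA.ssubset_or_ssubset (mem_stops.1 hK).1 (mem_stops.1 hL).1 hne hxK hxL with h | h
  · exact hKm L hL h hLJ
  · exact hLm K hK h hKJ

/-- A sum of functions of the level of `J` is constant on the stopping sets inside `J`. -/
theorem sum_level_eq (hsupp : ∀ I ∈ A, ∀ x, x ∉ I → β I x = 0)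
    (hconst : ∀ I ∈ A, ∀ K ∈ A, K ⊂ I → ∀ x ∈ K, ∀ y ∈ K, β I x = β I y)
    {J K : Set X} (hJ : J ∈ stops A N) (hK : K ∈ stops A N) (hKJ : K ⊂ J) {x y : X} (hx : x ∈ K)
    (hy : y ∈ K) : ∑ I ∈ level A N J, β I x = ∑ I ∈ level A N J, β I y := by
  refine Finset.sum_congr rfl fun I hI => ?_
  obtain ⟨hIA, hIJ, hIN⟩ := mem_level.1 hI
  obtain ⟨hKA, hKs⟩ := mem_stops.1 hK
  have hJA := (mem_stops.1 hJ).1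
  by_cases hd : ∃ z, z ∈ I ∧ z ∈ K
  · obtain ⟨z, hzI, hzK⟩ := hd
    -- If `I ⊆ K ⊂ J`, monotonicity would squeeze `N K` between the equal values `N J` and `N I`,
    -- and `K` would not be a stopping set.
    have hnot : ¬ I ⊆ K := fun h => hKs J hJA hKJ
      (le_antisymm (hA.anti K hKA J hJA hKJ.1) (hIN ▸ hA.anti I hIA K hKA h))
    exact hconst I hIA K hKA ⟨(hA.laminar I hIA K hKA z hzI hzK).resolve_left hnot, hnot⟩ x hx y hy
  · rw [hsupp I hIA x fun h' => hd ⟨x, h', hx⟩, hsupp I hIA y fun h' => hd ⟨y, h', hy⟩]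

open Classical in
-- Off the smaller stopping sets Young's inequality is applied pointwise. On each maximal one `K`
-- the level sum is constant, so `φ` can be replaced by its average over `K` before Young's
-- inequality is applied.
theorem setLIntegral_level_le {t : ℝ} (hst : s.HolderConjugate t) {φ : X → ℝ≥0∞}
    (hφ : Measurable φ) (hω : ∀ I ∈ A, ω I ≠ ∞)
    (hβ : ∀ I ∈ A, Measurable (β I)) (hsupp : ∀ I ∈ A, ∀ x, x ∉ I → β I x = 0)
    (hconst : ∀ I ∈ A, ∀ K ∈ A, K ⊂ I → ∀ x ∈ K, ∀ y ∈ K, β I x = β I y)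
    {J : Set X} (hJ : J ∈ stops A N) :
    N J * ∫⁻ x in J, (∑ I ∈ level A N J, β I x) * φ x ∂ω ≤
      2 * (N J ^ s * ∫⁻ x in J, (∑ I ∈ level A N J, β I x) ^ s ∂ω) +
      ∫⁻ x in J \ ⋃ K ∈ (stops A N).filter (· ⊂ J), K, φ x ^ t ∂ω +
      ∑ K ∈ stopChildren A N J, (⨍⁻ x in K, φ x ∂ω) ^ t * ω K := by
  have hs0 : 0 < s := hst.pos
  have hJA := (mem_stops.1 hJ).1
  have hJm := hA.measurable J hJA
  set H : X → ℝ≥0∞ := fun x => ∑ I ∈ level A N J, β I x with hH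
  have hHm : Measurable H := Finset.measurable_fun_sum _ fun I hI => hβ I (mem_level.1 hI).1
  set D := J \ ⋃ K ∈ (stops A N).filter (· ⊂ J), K with hD
  have hKm : ∀ K ∈ stopChildren A N J, MeasurableSet K := fun K hK =>
    hA.measurable K (mem_stops.1 (mem_stopChildren.1 hK).1).1
  have hcover : J ⊆ D ∪ ⋃ K ∈ stopChildren A N J, K := by
    intro x hx
    by_cases hxD : x ∈ D
    · exact Or.inl hxD
    right
    have hx' : ∃ K ∈ (stops A N).filter (· ⊂ J), x ∈ K := by
      by_contra hcon
      push Not at hcon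
      exact hxD ⟨hx, by simpa using hcon⟩
    obtain ⟨K, hK, hxK⟩ := hx'
    obtain ⟨L, hL⟩ := (((stops A N).filter (· ⊂ J)).filter (x ∈ ·)).exists_maximal
      ⟨K, Finset.mem_filter.2 ⟨hK, hxK⟩⟩
    obtain ⟨hL1, hxL⟩ := Finset.mem_filter.1 hL.1
    obtain ⟨hLs, hLJ⟩ := Finset.mem_filter.1 hL1
    refine Set.mem_biUnion (mem_stopChildren.2 ⟨hLs, hLJ, fun L' hL' hLL' hL'J => hLL'.2 ?_⟩) hxL
    exact hL.2 (Finset.mem_filter.2 ⟨Finset.mem_filter.2 ⟨hL', hL'J⟩, hLL'.1 hxL⟩) hLL'.1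
  have hint : ∀ S : Set X, N J ^ s * ∫⁻ x in S, H x ^ s ∂ω = ∫⁻ x in S, (N J * H x) ^ s ∂ω := by
    intro S
    rw [← lintegral_const_mul _ (hHm.pow_const _)]
    exact lintegral_congr fun x => (ENNReal.mul_rpow_of_nonneg _ _ hs0.le).symm
  have h1 : ∫⁻ x in D, N J * H x * φ x ∂ω ≤
      N J ^ s * ∫⁻ x in J, H x ^ s ∂ω + ∫⁻ x in D, φ x ^ t ∂ω := by
    calc _ ≤ ∫⁻ x in D, ((N J * H x) ^ s + φ x ^ t) ∂ω :=
          lintegral_mono fun x => ENNReal.mul_le_rpow_add_rpow hst _ _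
      _ = ∫⁻ x in D, (N J * H x) ^ s ∂ω + ∫⁻ x in D, φ x ^ t ∂ω :=
          lintegral_add_right _ (hφ.pow_const _)
      _ ≤ _ := by
          rw [hint]
          gcongr
          exact Set.sdiff_subset
  have h2 : ∀ K ∈ stopChildren A N J, ∫⁻ x in K, N J * H x * φ x ∂ω ≤
      ∫⁻ x in K, (N J * H x) ^ s ∂ω + (⨍⁻ x in K, φ x ∂ω) ^ t * ω K := by
    intro K hK
    obtain ⟨hKs, hKJ, _⟩ := mem_stopChildren.1 hK
    obtain ⟨y, hy⟩ := hA.nonempty K (mem_stops.1 hKs).1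
    have hc : ∀ x ∈ K, H x = H y := fun x hx =>
      hA.sum_level_eq hsupp hconst hJ hKs hKJ hx hy
    rw [setLIntegral_congr_fun (f := fun x => N J * H x * φ x)
        (g := fun x => N J * H y * φ x) (hKm K hK)
        (fun x hx => by simp only [hc x hx]),
      setLIntegral_congr_fun (f := fun x => (N J * H x) ^ s)
        (g := fun _ => (N J * H y) ^ s) (hKm K hK)
        (fun x hx => by simp only [hc x hx]),
      lintegral_const_mul _ hφ, setLIntegral_const,
      ← measure_mul_setLAverage φ (hω K (mem_stops.1 hKs).1), ← add_mul]
    calc N J * H y * (ω K * ⨍⁻ x in K, φ x ∂ω) = N J * H y * (⨍⁻ x in K, φ x ∂ω) * ω K := by ring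
      _ ≤ _ := by gcongr; exact ENNReal.mul_le_rpow_add_rpow hst _ _
  have h3 : ∑ K ∈ stopChildren A N J, ∫⁻ x in K, (N J * H x) ^ s ∂ω ≤
      N J ^ s * ∫⁻ x in J, H x ^ s ∂ω := by
    rw [← lintegral_biUnion_finset (hA.stopChildren_pairwiseDisjoint J) hKm, hint]
    refine lintegral_mono_set (Set.iUnion₂_subset fun K hK => ?_)
    exact (mem_stopChildren.1 hK).2.1.1
  calc N J * ∫⁻ x in J, H x * φ x ∂ω = ∫⁻ x in J, N J * H x * φ x ∂ω := by
        simp_rw [mul_assoc]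
        exact (lintegral_const_mul _ (hHm.mul hφ)).symm
    _ ≤ ∫⁻ x in D ∪ ⋃ K ∈ stopChildren A N J, K, N J * H x * φ x ∂ω := lintegral_mono_set hcover
    _ ≤ ∫⁻ x in D, N J * H x * φ x ∂ω +
        ∫⁻ x in ⋃ K ∈ stopChildren A N J, K, N J * H x * φ x ∂ω := lintegral_union_le _ _ _
    _ = ∫⁻ x in D, N J * H x * φ x ∂ω +
        ∑ K ∈ stopChildren A N J, ∫⁻ x in K, N J * H x * φ x ∂ω := by
        rw [lintegral_biUnion_finset (hA.stopChildren_pairwiseDisjoint J) hKm]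
    _ ≤ (N J ^ s * ∫⁻ x in J, H x ^ s ∂ω + ∫⁻ x in D, φ x ^ t ∂ω) +
        (∑ K ∈ stopChildren A N J, ∫⁻ x in K, (N J * H x) ^ s ∂ω +
          ∑ K ∈ stopChildren A N J, (⨍⁻ x in K, φ x ∂ω) ^ t * ω K) := by
        rw [← Finset.sum_add_distrib]
        exact add_le_add h1 (Finset.sum_le_sum h2)
    _ ≤ (N J ^ s * ∫⁻ x in J, H x ^ s ∂ω + ∫⁻ x in D, φ x ^ t ∂ω) +
        (N J ^ s * ∫⁻ x in J, H x ^ s ∂ω +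
          ∑ K ∈ stopChildren A N J, (⨍⁻ x in K, φ x ∂ω) ^ t * ω K) := by gcongr
    _ = _ := by ring

open Classical in
/-- The corona estimate for a bilinear form: testing over sets suffices for the part of the form
where the averages of `φ` are controlled by the weights `N`. -/
theorem sum_mul_lintegral_le {t : ℝ} (hst : s.HolderConjugate t) {φ : X → ℝ≥0∞}
    (hφ : Measurable φ) (hω : ∀ I ∈ A, ω I ≠ ∞)
    (hβ : ∀ I ∈ A, Measurable (β I)) (hsupp : ∀ I ∈ A, ∀ x, x ∉ I → β I x = 0)
    (hconst : ∀ I ∈ A, ∀ K ∈ A, K ⊂ I → ∀ x ∈ K, ∀ y ∈ K, β I x = β I y)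
    (htest : ∀ J ∈ A, ∫⁻ x in J, (∑ I ∈ A with I ⊆ J, β I x) ^ s ∂ω ≤ σ J)
    (hh : ∀ I ∈ A, ∀ x ∈ I, N I ≤ h x) {c : ℝ≥0∞}
    (hc : ∀ K ∈ A, (⨍⁻ x in K, φ x ∂ω) ^ t * ω K ≤ c * (N K ^ s * σ K)) :
    ∑ I ∈ A, N I * ∫⁻ x, β I x * φ x ∂ω ≤
      (4 + 2 * c) * ∫⁻ x, h x ^ s ∂σ + ∫⁻ x, φ x ^ t ∂ω := by
  have hs : 1 ≤ s := hst.lt.le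
  set D : Set X → Set X := fun J => J \ ⋃ K ∈ (stops A N).filter (· ⊂ J), K with hD
  have hm : ∀ K ∈ stops A N, MeasurableSet K := fun K hK => hA.measurable K (mem_stops.1 hK).1
  have h0 : ∀ J ∈ stops A N, ∑ I ∈ level A N J, ∫⁻ x, β I x * φ x ∂ω =
      ∫⁻ x in J, (∑ I ∈ level A N J, β I x) * φ x ∂ω := by
    intro J hJ
    have e : ∀ I ∈ level A N J, ∫⁻ x, β I x * φ x ∂ω = ∫⁻ x in J, β I x * φ x ∂ω := by
      intro I hI
      obtain ⟨h1, h2, _⟩ := mem_level.1 hI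
      rw [setLIntegral_eq_of_support_subset]
      intro x hx
      by_contra hxJ
      exact hx (by simp [hsupp I h1 x fun h' => hxJ (h2 h')])
    simp_rw [Finset.sum_mul]
    rw [Finset.sum_congr rfl e]
    exact (lintegral_finsetSum' _ fun I hI =>
      ((hβ I (mem_level.1 hI).1).mul hφ).aemeasurable).symm
  -- The sets `D J` are disjoint: each excludes all stopping sets strictly inside `J`.
  have h1 : ∑ J ∈ stops A N, ∫⁻ x in D J, φ x ^ t ∂ω ≤ ∫⁻ x, φ x ^ t ∂ω := by
    rw [← lintegral_biUnion_finset]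
    · exact setLIntegral_le_lintegral _ _
    · intro J hJ L hL hne
      refine Set.disjoint_left.2 fun x hxJ hxL => ?_
      have key : ∀ K ∈ stops A N, ∀ L, x ∈ D L → x ∈ K → ¬ K ⊂ L := by
        intro K hK L hxL hxK hKL
        exact hxL.2 (Set.mem_biUnion (Finset.mem_filter.2 ⟨hK, hKL⟩) hxK)
      rcases hA.ssubset_or_ssubset (mem_stops.1 hJ).1 (mem_stops.1 hL).1 hne hxJ.1 hxL.1 with h | h
      · exact key J hJ L hxL hxJ.1 h
      · exact key L hL J hxJ hxL.1 h
    · exact fun J hJ => (hm J hJ).diff (Finset.measurableSet_biUnion _ fun K hK =>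
        hm K (Finset.mem_filter.1 hK).1)
  have h2 : ∑ J ∈ stops A N, ∑ K ∈ stopChildren A N J, (⨍⁻ x in K, φ x ∂ω) ^ t * ω K ≤
      c * (2 * ∫⁻ x, h x ^ s ∂σ) := by
    -- A stopping set has only one stopping parent: of two nested candidates, the smaller would
    -- contradict maximality inside the larger. Hence each `K` is counted once.
    have hdisj : (stops A N : Set (Set X)).PairwiseDisjoint (stopChildren A N) := by
      intro J hJ L hL hne
      refine Finset.disjoint_left.2 fun K hKJ hKL => ?_
      obtain ⟨hK, hKJ, hKJm⟩ := mem_stopChildren.1 hKJ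
      obtain ⟨_, hKL, hKLm⟩ := mem_stopChildren.1 hKL
      obtain ⟨x, hx⟩ := hA.nonempty K (mem_stops.1 hK).1
      rcases hA.ssubset_or_ssubset (mem_stops.1 hJ).1 (mem_stops.1 hL).1 hne (hKJ.1 hx)
        (hKL.1 hx) with h | h
      · exact hKLm J hJ hKJ h
      · exact hKJm L hL hKL h
    rw [← Finset.sum_biUnion hdisj]
    calc _ ≤ ∑ K ∈ stops A N, (⨍⁻ x in K, φ x ∂ω) ^ t * ω K := by
          refine Finset.sum_le_sum_of_subset fun K hK => ?_
          obtain ⟨J, _, hKJ⟩ := Finset.mem_biUnion.1 hK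
          exact (mem_stopChildren.1 hKJ).1
      _ ≤ ∑ K ∈ stops A N, c * (N K ^ s * σ K) :=
          Finset.sum_le_sum fun K hK => hc K (mem_stops.1 hK).1
      _ ≤ _ := by
          rw [← Finset.mul_sum]
          gcongr
          exact hA.sum_stops_le hs hh
  calc ∑ I ∈ A, N I * ∫⁻ x, β I x * φ x ∂ω ≤
        ∑ J ∈ stops A N, N J * ∑ I ∈ level A N J, ∫⁻ x, β I x * φ x ∂ω :=
        sum_le_sum_stops_level (fun t => t) _
    _ ≤ ∑ J ∈ stops A N, (2 * (N J ^ s * ∫⁻ x in J, (∑ I ∈ level A N J, β I x) ^ s ∂ω) +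
        ∫⁻ x in D J, φ x ^ t ∂ω +
        ∑ K ∈ stopChildren A N J, (⨍⁻ x in K, φ x ∂ω) ^ t * ω K) := by
        refine Finset.sum_le_sum fun J hJ => ?_
        rw [h0 J hJ]
        exact hA.setLIntegral_level_le hst hφ hω hβ hsupp hconst hJ
    _ ≤ 2 * (2 * ∫⁻ x, h x ^ s ∂σ) + ∫⁻ x, φ x ^ t ∂ω + c * (2 * ∫⁻ x, h x ^ s ∂σ) := by
        rw [Finset.sum_add_distrib, Finset.sum_add_distrib, ← Finset.mul_sum]
        gcongr
        exact hA.sum_stops_lintegral_le hs htest hh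
    _ = _ := by ring

end IsCorona

end Corona

/-! ### Rounding down to powers of two. -/

section DyadicFloor

theorem ENNReal.exists_dyadicFloor (v : ℝ≥0∞) :
    ∃ N : ℝ≥0∞, v ≠ 0 → v ≠ ∞ → ∃ n : ℤ, N = 2 ^ n ∧ 2 ^ n ≤ v ∧ v < 2 ^ (n + 1) := by
  by_cases h : v ≠ 0 ∧ v ≠ ∞
  · obtain ⟨n, hn⟩ := ENNReal.exists_mem_Ico_zpow h.1 h.2 one_lt_two ENNReal.ofNat_ne_top
    exact ⟨2 ^ n, fun _ _ => ⟨n, rfl, hn⟩⟩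
  · exact ⟨0, fun h0 ht => absurd ⟨h0, ht⟩ h⟩

/-- The largest integer power of `2` which is at most `v` (for `0 < v < ∞`). -/
noncomputable def ENNReal.dyadicFloor (v : ℝ≥0∞) : ℝ≥0∞ := (ENNReal.exists_dyadicFloor v).choose

namespace ENNReal

variable {v w : ℝ≥0∞}

theorem dyadicFloor_spec (h0 : v ≠ 0) (ht : v ≠ ∞) :
    ∃ n : ℤ, dyadicFloor v = 2 ^ n ∧ 2 ^ n ≤ v ∧ v < 2 ^ (n + 1) :=
  (exists_dyadicFloor v).choose_spec h0 ht

theorem two_zpow_add_one (n : ℤ) : (2 : ℝ≥0∞) ^ (n + 1) = 2 * 2 ^ n := by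
  rw [ENNReal.zpow_add two_ne_zero ofNat_ne_top, zpow_one, mul_comm]

theorem dyadicFloor_le (h0 : v ≠ 0) (ht : v ≠ ∞) : dyadicFloor v ≤ v := by
  obtain ⟨n, h1, h2, _⟩ := dyadicFloor_spec h0 ht
  rwa [h1]

theorem le_two_mul_dyadicFloor (h0 : v ≠ 0) (ht : v ≠ ∞) : v ≤ 2 * dyadicFloor v := by
  obtain ⟨n, h1, _, h3⟩ := dyadicFloor_spec h0 ht
  rw [h1, ← two_zpow_add_one]
  exact h3.le

theorem dyadicFloor_mono (h0 : v ≠ 0) (ht : w ≠ ∞) (h : v ≤ w) :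
    dyadicFloor v ≤ dyadicFloor w := by
  obtain ⟨n, h1, h2, _⟩ := dyadicFloor_spec h0 (ne_top_of_le_ne_top ht h)
  obtain ⟨m, h1', _, h3⟩ := dyadicFloor_spec (pos_of_ne_zero h0 |>.trans_le h).ne' ht
  rw [h1, h1']
  refine zpow_le_of_le one_le_two ?_
  by_contra hlt
  exact absurd (h3.trans_le (zpow_le_of_le one_le_two (by omega : m + 1 ≤ n)))
    (not_lt.2 (h2.trans h))

theorem two_mul_dyadicFloor_le (hv0 : v ≠ 0) (hvt : v ≠ ∞) (hw0 : w ≠ 0) (hwt : w ≠ ∞)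
    (h : dyadicFloor v < dyadicFloor w) : 2 * dyadicFloor v ≤ dyadicFloor w := by
  obtain ⟨n, h1, _, _⟩ := dyadicFloor_spec hv0 hvt
  obtain ⟨m, h1', _, _⟩ := dyadicFloor_spec hw0 hwt
  rw [h1, h1'] at h
  rw [h1, h1', ← two_zpow_add_one]
  refine zpow_le_of_le one_le_two ?_
  by_contra hlt
  exact absurd h (not_lt.2 (zpow_le_of_le one_le_two (by omega)))

end ENNReal

end DyadicFloor

/-! ### Testing for positive bilinear forms. -/

namespace AtomicFiltration

variable {X : Type*} [MeasurableSpace X] (𝓕 : AtomicFiltration X)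

/-- The supremum of the averages over the intervals containing `I`. -/
noncomputable def supAvg (μ : Measure X) (φ : X → ℝ≥0∞) (I : Set X) : ℝ≥0∞ :=
  ⨆ J ∈ 𝓕.intervals, ⨆ _ : I ⊆ J, ⨍⁻ y in J, φ y ∂μ

theorem setLAverage_le_supAvg (μ : Measure X) (φ : X → ℝ≥0∞) {I J : Set X}
    (hJ : J ∈ 𝓕.intervals) (h : I ⊆ J) : ⨍⁻ y in J, φ y ∂μ ≤ 𝓕.supAvg μ φ I :=
  le_iSup₂_of_le J hJ (le_iSup_of_le h le_rfl)

theorem supAvg_anti (μ : Measure X) (φ : X → ℝ≥0∞) {I J : Set X} (h : I ⊆ J) :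
    𝓕.supAvg μ φ J ≤ 𝓕.supAvg μ φ I :=
  iSup₂_le fun _ hK => iSup_le fun hJK => 𝓕.setLAverage_le_supAvg μ φ hK (h.trans hJK)

theorem supAvg_le_maximalFn (μ : Measure X) (φ : X → ℝ≥0∞) {I : Set X} {x : X} (hx : x ∈ I) :
    𝓕.supAvg μ φ I ≤ 𝓕.maximalFn μ φ x :=
  iSup₂_le fun _ hK => iSup_le fun hIK => 𝓕.setLAverage_le_maximalFn μ φ hK (hIK hx)

/-- The maximal function is finite almost everywhere, hence at some point of a set of positive
measure, and there it dominates the supremum. -/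
theorem supAvg_ne_top {μ : Measure X} {φ : X → ℝ≥0∞} {s : ℝ} (hs : 0 < s)
    (h : ∫⁻ x, 𝓕.maximalFn μ φ x ^ s ∂μ ≠ ∞) {I : Set X} (hI : μ I ≠ 0) :
    𝓕.supAvg μ φ I ≠ ∞ := by
  have h1 := ae_lt_top ((𝓕.measurable_maximalFn μ φ).pow_const s) h
  have h2 : ¬ ∀ᵐ x ∂μ, x ∉ I := fun h' => hI (measure_eq_zero_iff_ae_notMem.2 h')
  have h3 : ∃ x, 𝓕.maximalFn μ φ x ^ s < ∞ ∧ x ∈ I := by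
    by_contra hcon
    push Not at hcon
    exact h2 (h1.mono fun x hx => hcon x hx)
  obtain ⟨x, hx, hxI⟩ := h3
  refine ne_top_of_le_ne_top ?_ (𝓕.supAvg_le_maximalFn μ φ hxI)
  intro htop
  simp [htop, hs] at hx

/-- Taking suprema over ancestors makes the weights monotone under inclusion; rounding to powers of
two turns every strict increase into a doubling. -/
theorem isCorona_dyadicFloor {A : Finset (Set X)} (hA : ∀ I ∈ A, I ∈ 𝓕.intervals) {μ : Measure X}
    {φ : X → ℝ≥0∞} (h0 : ∀ I ∈ A, 𝓕.supAvg μ φ I ≠ 0) (ht : ∀ I ∈ A, 𝓕.supAvg μ φ I ≠ ∞) :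
    IsCorona A fun I => (𝓕.supAvg μ φ I).dyadicFloor where
  measurable I hI := 𝓕.interval_measurable (hA I hI)
  nonempty I hI := 𝓕.nonempty_of_mem_intervals (hA I hI)
  laminar I hI J hJ _ hxI hxJ := 𝓕.subset_or_subset (hA I hI) (hA J hJ) hxI hxJ
  anti I hI J hJ h := ENNReal.dyadicFloor_mono (h0 J hJ) (ht I hI) (𝓕.supAvg_anti μ φ h)
  doubling I hI J hJ h :=
    ENNReal.two_mul_dyadicFloor_le (h0 I hI) (ht I hI) (h0 J hJ) (ht J hJ) h

/-- The average over the children of `I`. -/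
noncomputable def childAvg (ν : Measure X) (φ : X → ℝ≥0∞) (I : Set X) (x : X) : ℝ≥0∞ :=
  ∑' K : 𝓕.children I, (K : Set X).indicator (fun _ => ⨍⁻ y in (K : Set X), φ y ∂ν) x

theorem measurable_childAvg (ν : Measure X) (φ : X → ℝ≥0∞) {I : Set X} (hI : I ∈ 𝓕.intervals) :
    Measurable (𝓕.childAvg ν φ I) := by
  have := (𝓕.children_countable I).to_subtype
  exact Measurable.tsum fun K => measurable_const.indicator
    (𝓕.interval_measurable (𝓕.children_mem_intervals hI K.2))

theorem childAvg_eq (ν : Measure X) (φ : X → ℝ≥0∞) {I K : Set X} (hK : K ∈ 𝓕.children I) {x : X}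
    (hx : x ∈ K) : 𝓕.childAvg ν φ I x = ⨍⁻ y in K, φ y ∂ν := by
  unfold childAvg
  rw [tsum_eq_single ⟨K, hK⟩, Set.indicator_of_mem hx]
  intro L hL
  refine Set.indicator_of_notMem (fun hx' => hL (Subtype.ext ?_)) _
  exact 𝓕.child_eq_of_mem L.2 hK hx' hx

/-- As `β` is constant on each child, only the averages of `φ` over the children matter. -/
theorem lintegral_mul_childAvg {ν : Measure X} (hν : 𝓕.LocallyFinite ν) {φ β : X → ℝ≥0∞}
    (hφ : Measurable φ) {I : Set X} (hI : I ∈ 𝓕.intervals)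
    (hsupp : ∀ x, x ∉ I → β x = 0)
    (hconst : ∀ K ∈ 𝓕.children I, ∀ x ∈ K, ∀ y ∈ K, β x = β y) :
    ∫⁻ x, β x * φ x ∂ν = ∫⁻ x, β x * 𝓕.childAvg ν φ I x ∂ν := by
  have hc := (𝓕.children_countable I).to_subtype
  have hm : ∀ K : 𝓕.children I, MeasurableSet (K : Set X) := fun K =>
    𝓕.interval_measurable (𝓕.children_mem_intervals hI K.2)
  have hdisj : Pairwise (Function.onFun Disjoint fun K : 𝓕.children I => (K : Set X)) :=
    fun K L hne => 𝓕.children_disjoint I K.2 L.2 fun h => hne (Subtype.ext h)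
  have e : ∀ f : X → ℝ≥0∞, ∫⁻ x, β x * f x ∂ν =
      ∑' K : 𝓕.children I, ∫⁻ x in (K : Set X), β x * f x ∂ν := by
    intro f
    rw [← lintegral_iUnion hm hdisj, 𝓕.iUnion_children hI, setLIntegral_eq_of_support_subset]
    intro x hx
    by_contra hxI
    exact hx (by simp [hsupp x hxI])
  rw [e, e]
  refine tsum_congr fun K => ?_
  obtain ⟨y, hy⟩ := 𝓕.nonempty_of_mem_intervals (𝓕.children_mem_intervals hI K.2)
  rw [setLIntegral_congr_fun (f := fun x => β x * φ x) (g := fun x => β y * φ x) (hm K)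
      (fun x hx => by simp only [hconst K K.2 x hx y hy]),
    setLIntegral_congr_fun (f := fun x => β x * 𝓕.childAvg ν φ I x)
      (g := fun _ => β y * ⨍⁻ z in (K : Set X), φ z ∂ν) (hm K)
      (fun x hx => by simp only [hconst K K.2 x hx y hy, 𝓕.childAvg_eq ν φ K.2 hx]),
    lintegral_const_mul _ hφ, setLIntegral_const,
    ← measure_mul_setLAverage φ (hν K (𝓕.children_mem_intervals hI K.2)).ne]
  ring

/-- The child of `I` containing `K` is an ancestor of `K` or `K` itself. This is the link that makes
the excesses over the suprema telescope. -/
theorem childAvg_le_supAvg (ν : Measure X) (φ : X → ℝ≥0∞) {I K : Set X} (hI : I ∈ 𝓕.intervals)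
    (hK : K ∈ 𝓕.intervals) (h : K ⊂ I) {x : X} (hx : x ∈ K) :
    𝓕.childAvg ν φ I x ≤ 𝓕.supAvg ν φ K := by
  obtain ⟨L, hL, hKL⟩ := 𝓕.exists_child_of_ssubset hI hK h
  rw [𝓕.childAvg_eq ν φ hL (hKL hx)]
  exact 𝓕.setLAverage_le_supAvg ν φ (𝓕.children_mem_intervals hI hL) hKL

theorem childAvg_le_maximalFn (ν : Measure X) (φ : X → ℝ≥0∞) {I : Set X} (hI : I ∈ 𝓕.intervals)
    {x : X} (hx : x ∈ I) : 𝓕.childAvg ν φ I x ≤ 𝓕.maximalFn ν φ x := by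
  obtain ⟨L, hL, hxL⟩ := 𝓕.exists_child_mem hI hx
  rw [𝓕.childAvg_eq ν φ hL hxL]
  exact 𝓕.setLAverage_le_maximalFn ν φ (𝓕.children_mem_intervals hI hL) hxL

/-- The increments of the averages along a chain of intervals telescope. -/
theorem sum_childAvg_sub_le (ν : Measure X) (φ : X → ℝ≥0∞) {x : X} {T : Finset (Set X)}
    (hT : ∀ I ∈ T, I ∈ 𝓕.intervals ∧ x ∈ I) {H : ℝ≥0∞} (h1 : ∀ I ∈ T, 𝓕.childAvg ν φ I x ≤ H)
    (h2 : ∀ I ∈ T, 𝓕.supAvg ν φ I ≤ H) :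
    ∑ I ∈ T, (𝓕.childAvg ν φ I x - 𝓕.supAvg ν φ I) ≤ H := by
  classical
  induction T using Finset.strongInduction generalizing H with
  | H T ih =>
    rcases T.eq_empty_or_nonempty with rfl | hne
    · simp
    obtain ⟨K, hK⟩ := T.exists_minimal hne
    obtain ⟨hKi, hxK⟩ := hT K hK.1
    have hsub : ∀ I ∈ T.erase K, K ⊂ I := by
      intro I hI
      obtain ⟨hIK, hIT⟩ := Finset.mem_erase.1 hI
      have hKI : K ⊆ I := by
        rcases 𝓕.subset_or_subset hKi (hT I hIT).1 hxK (hT I hIT).2 with h | h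
        · exact h
        · exact hK.2 hIT h
      exact hKI.ssubset_of_ne hIK.symm
    -- For the intervals above the smallest one `K`, everything is bounded by `supAvg` at `K`, which
    -- is exactly what the excess at `K` leaves free.
    have hrest := ih (T.erase K) (Finset.erase_ssubset hK.1)
      (fun I hI => hT I (Finset.mem_of_mem_erase hI)) (H := 𝓕.supAvg ν φ K)
      (fun I hI => 𝓕.childAvg_le_supAvg ν φ (hT I (Finset.mem_of_mem_erase hI)).1 hKi (hsub I hI)
        hxK)
      (fun I hI => 𝓕.supAvg_anti ν φ (hsub I hI).1)
    rw [← Finset.add_sum_erase T _ hK.1]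
    calc _ ≤ (H - 𝓕.supAvg ν φ K) + 𝓕.supAvg ν φ K :=
          add_le_add (tsub_le_tsub_right (h1 K hK.1) _) hrest
      _ = H := tsub_add_cancel_of_le (h2 K hK.1)

open Classical in
/-- The testing conditions for a positive bilinear form, normalized. -/
structure IsTested (𝓕 : AtomicFiltration X) (r t : ℝ) (μ ν : Measure X) (G : Finset (Set X))
    (β : Set X → X → ℝ≥0∞) : Prop where
  mem_intervals : ∀ I ∈ G, I ∈ 𝓕.intervals
  eq_zero : ∀ I ∈ G, ∀ x, x ∉ I → β I x = 0
  const_on_children : ∀ I ∈ G, ∀ K ∈ 𝓕.children I, ∀ x ∈ K, ∀ y ∈ K, β I x = β I y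
  direct : ∀ J ∈ G, ∫⁻ x in J, (∑ I ∈ G with I ⊆ J, β I x) ^ r ∂ν ≤ μ J
  adjoint : ∀ J ∈ G, ∫⁻ x in J,
    (∑ I ∈ G with I ⊆ J, I.indicator (fun _ => (∫⁻ y, β I y ∂ν) / μ I) x) ^ t ∂μ ≤ ν J

namespace IsTested

variable {𝓕} {r t : ℝ} {μ ν : Measure X} {G A : Finset (Set X)} {β : Set X → X → ℝ≥0∞}

theorem mono (h : 𝓕.IsTested r t μ ν G β) (hr : 0 ≤ r) (ht : 0 ≤ t) (hA : A ⊆ G) :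
    𝓕.IsTested r t μ ν A β where
  mem_intervals I hI := h.mem_intervals I (hA hI)
  eq_zero I hI := h.eq_zero I (hA hI)
  const_on_children I hI := h.const_on_children I (hA hI)
  direct J hJ := by
    refine le_trans (lintegral_mono fun x => ?_) (h.direct J (hA hJ))
    gcongr
  adjoint J hJ := by
    refine le_trans (lintegral_mono fun x => ?_) (h.adjoint J (hA hJ))
    gcongr

theorem measurable (h : 𝓕.IsTested r t μ ν G β) {I : Set X} (hI : I ∈ G) : Measurable (β I) :=
  𝓕.measurable_of_const_on_children (h.mem_intervals I hI) (h.eq_zero I hI)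
    (h.const_on_children I hI)

theorem const (h : 𝓕.IsTested r t μ ν G β) {I K : Set X} (hI : I ∈ G) (hK : K ∈ G) (hKI : K ⊂ I) :
    ∀ x ∈ K, ∀ y ∈ K, β I x = β I y := by
  intro x hx y hy
  obtain ⟨L, hL, hKL⟩ := 𝓕.exists_child_of_ssubset (h.mem_intervals I hI) (h.mem_intervals K hK) hKI
  exact h.const_on_children I hI L hL x (hKL hx) y (hKL hy)

/-- The part of the bilinear form where the averages of `F` dominate. -/
theorem form_bound_left (h : 𝓕.IsTested r t μ ν G β) (hrt : r.HolderConjugate t)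
    (hν : 𝓕.LocallyFinite ν) {F φ : X → ℝ≥0∞} (hφ : Measurable φ)
    (h0 : ∀ I ∈ G, 𝓕.supAvg μ F I ≠ 0) (htop : ∀ I ∈ G, 𝓕.supAvg μ F I ≠ ∞)
    (hle : ∀ I ∈ G, (⨍⁻ x in I, φ x ∂ν) ^ t * ν I ≤ (⨍⁻ x in I, F x ∂μ) ^ r * μ I) :
    ∑ I ∈ G, (⨍⁻ x in I, F x ∂μ) * ∫⁻ x, β I x * φ x ∂ν ≤
      2 * ((4 + 2 * 2 ^ r) * ∫⁻ x, 𝓕.maximalFn μ F x ^ r ∂μ + ∫⁻ x, φ x ^ t ∂ν) := by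
  have hA := 𝓕.isCorona_dyadicFloor h.mem_intervals h0 htop
  have hav : ∀ I ∈ G, ⨍⁻ x in I, F x ∂μ ≤ 2 * (𝓕.supAvg μ F I).dyadicFloor := fun I hI =>
    (𝓕.setLAverage_le_supAvg μ F (h.mem_intervals I hI) subset_rfl).trans
      (ENNReal.le_two_mul_dyadicFloor (h0 I hI) (htop I hI))
  -- The constant `2 ^ r` is the price of replacing an average by the dyadic floor of the supremum,
  -- which may be half as large.
  have key := hA.sum_mul_lintegral_le (σ := μ) (ω := ν) (β := β) (h := 𝓕.maximalFn μ F)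
    (c := 2 ^ r) hrt hφ
    (fun I hI => (hν I (h.mem_intervals I hI)).ne) (fun I hI => h.measurable hI) h.eq_zero
    (fun I hI K hK hKI => h.const hI hK hKI) h.direct
    (fun I hI x hx => (ENNReal.dyadicFloor_le (h0 I hI) (htop I hI)).trans
      (𝓕.supAvg_le_maximalFn μ F hx))
    (fun K hK => by
      refine (hle K hK).trans ?_
      rw [← mul_assoc, ← ENNReal.mul_rpow_of_nonneg _ _ hrt.nonneg]
      gcongr
      · exact hrt.nonneg
      · exact hav K hK)
  calc _ ≤ ∑ I ∈ G, 2 * ((𝓕.supAvg μ F I).dyadicFloor * ∫⁻ x, β I x * φ x ∂ν) := by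
        refine Finset.sum_le_sum fun I hI => ?_
        rw [← mul_assoc]
        gcongr
        exact hav I hI
    _ ≤ _ := by
        rw [← Finset.mul_sum]
        gcongr

theorem lintegral_indicator_div_mul {F : X → ℝ≥0∞} (hF : Measurable F) {I : Set X}
    (hI : MeasurableSet I) (c : ℝ≥0∞) :
    ∫⁻ x, I.indicator (fun _ => c / μ I) x * F x ∂μ = (⨍⁻ x in I, F x ∂μ) * c := by
  have e : ∀ x, I.indicator (fun _ => c / μ I) x * F x = I.indicator (fun x => c / μ I * F x) x := by
    intro x
    by_cases hx : x ∈ I <;> simp [hx]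
  rw [lintegral_congr e, lintegral_indicator hI, lintegral_const_mul _ hF, setLAverage_eq,
    ENNReal.div_eq_inv_mul, ENNReal.div_eq_inv_mul]
  ring

/-- The part of the bilinear form where the averages of `φ` dominate. -/
theorem form_bound_right (h : 𝓕.IsTested r t μ ν G β) (hrt : r.HolderConjugate t)
    (hμ : 𝓕.LocallyFinite μ) (hν : 𝓕.LocallyFinite ν) {F φ : X → ℝ≥0∞} (hF : Measurable F)
    (hφ : Measurable φ)
    (h0 : ∀ I ∈ G, 𝓕.supAvg μ F I ≠ 0) (htop : ∀ I ∈ G, 𝓕.supAvg μ F I ≠ ∞)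
    (h0' : ∀ I ∈ G, 𝓕.supAvg ν φ I ≠ 0) (htop' : ∀ I ∈ G, 𝓕.supAvg ν φ I ≠ ∞)
    (hle : ∀ I ∈ G, (⨍⁻ x in I, F x ∂μ) ^ r * μ I ≤ (⨍⁻ x in I, φ x ∂ν) ^ t * ν I) :
    ∑ I ∈ G, (⨍⁻ x in I, F x ∂μ) * ∫⁻ x, β I x * φ x ∂ν ≤
      2 * ((4 + 2 * 2 ^ t) * ∫⁻ x, 𝓕.maximalFn ν φ x ^ t ∂ν + ∫⁻ x, F x ^ r ∂μ) +
      (2 ^ r * (2 * ∫⁻ x, 𝓕.maximalFn μ F x ^ r ∂μ) + ∫⁻ x, 𝓕.maximalFn ν φ x ^ t ∂ν) := by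
  classical
  have hA := 𝓕.isCorona_dyadicFloor h.mem_intervals h0 htop
  have hA' := 𝓕.isCorona_dyadicFloor h.mem_intervals h0' htop'
  set a : Set X → ℝ≥0∞ := fun I => ⨍⁻ x in I, F x ∂μ with ha
  have hm : ∀ I ∈ G, MeasurableSet I := fun I hI => 𝓕.interval_measurable (h.mem_intervals I hI)
  have hav : ∀ I ∈ G, a I ≤ 2 * (𝓕.supAvg μ F I).dyadicFloor := fun I hI =>
    (𝓕.setLAverage_le_supAvg μ F (h.mem_intervals I hI) subset_rfl).trans
      (ENNReal.le_two_mul_dyadicFloor (h0 I hI) (htop I hI))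
  have hav' : ∀ I ∈ G, ⨍⁻ x in I, φ x ∂ν ≤ 2 * (𝓕.supAvg ν φ I).dyadicFloor := fun I hI =>
    (𝓕.setLAverage_le_supAvg ν φ (h.mem_intervals I hI) subset_rfl).trans
      (ENNReal.le_two_mul_dyadicFloor (h0' I hI) (htop' I hI))
  -- Kernel of the adjoint form: only the total mass of `β I` survives, and integrating it against
  -- `F` returns the average of `F` times that mass.
  set βs : Set X → X → ℝ≥0∞ := fun I => I.indicator fun _ => (∫⁻ y, β I y ∂ν) / μ I with hβs
  have main := hA'.sum_mul_lintegral_le (σ := ν) (ω := μ) (β := βs) (h := 𝓕.maximalFn ν φ)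
    (c := 2 ^ t) hrt.symm hF
    (fun I hI => (hμ I (h.mem_intervals I hI)).ne)
    (fun I hI => measurable_const.indicator (hm I hI))
    (fun I hI x hx => Set.indicator_of_notMem hx _)
    (fun I hI K hK hKI x hx y hy => by
      simp only [hβs, Set.indicator_of_mem (hKI.1 hx), Set.indicator_of_mem (hKI.1 hy)])
    h.adjoint
    (fun I hI x hx => (ENNReal.dyadicFloor_le (h0' I hI) (htop' I hI)).trans
      (𝓕.supAvg_le_maximalFn ν φ hx))
    (fun K hK => by
      refine (hle K hK).trans ?_
      rw [← mul_assoc, ← ENNReal.mul_rpow_of_nonneg _ _ hrt.symm.nonneg]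
      gcongr
      · exact hrt.symm.nonneg
      · exact hav' K hK)
  have carl := hA.carleson_embedding (σ := μ) (ω := ν) (h := 𝓕.maximalFn μ F) hrt.lt.le
    (fun I hI => h.measurable hI) h.eq_zero h.direct
    (fun I hI x hx => (ENNReal.dyadicFloor_le (h0 I hI) (htop I hI)).trans
      (𝓕.supAvg_le_maximalFn μ F hx))
  -- The excess of the child averages over `supAvg`, truncated at zero. The part below `supAvg` sees
  -- only `∫ β I` and goes to the adjoint corona; the excess is separated by Young's inequality and
  -- paired with the Carleson embedding.
  set D : Set X → X → ℝ≥0∞ := fun I => I.indicator fun x =>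
    𝓕.childAvg ν φ I x - 𝓕.supAvg ν φ I with hD
  have hDm : ∀ I ∈ G, Measurable (D I) := fun I hI =>
    ((𝓕.measurable_childAvg ν φ (h.mem_intervals I hI)).sub_const _).indicator (hm I hI)
  have hsplit : ∀ I ∈ G, a I * ∫⁻ x, β I x * φ x ∂ν ≤
      2 * ((𝓕.supAvg ν φ I).dyadicFloor * ∫⁻ x, βs I x * F x ∂μ) +
      (2 ^ r * ((𝓕.supAvg μ F I).dyadicFloor ^ r * ∫⁻ x, β I x ^ r ∂ν) +
        ∫⁻ x, D I x ^ t ∂ν) := by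
    intro I hI
    have hIi := h.mem_intervals I hI
    have hβm := h.measurable hI
    have e1 : ∫⁻ x, β I x * φ x ∂ν ≤
        ∫⁻ x, (𝓕.supAvg ν φ I * β I x + β I x * D I x) ∂ν := by
      rw [𝓕.lintegral_mul_childAvg hν hφ hIi (h.eq_zero I hI) (h.const_on_children I hI)]
      refine lintegral_mono fun x => ?_
      by_cases hx : x ∈ I
      · simp only [hD, Set.indicator_of_mem hx]
        rw [mul_comm (𝓕.supAvg ν φ I), ← mul_add]
        gcongr
        exact le_add_tsub
      · simp [h.eq_zero I hI x hx]
    have e2 : a I * ∫⁻ x, β I x * D I x ∂ν ≤ a I ^ r * ∫⁻ x, β I x ^ r ∂ν + ∫⁻ x, D I x ^ t ∂ν := by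
      have e0 : a I * ∫⁻ x, β I x * D I x ∂ν = ∫⁻ x, a I * (β I x * D I x) ∂ν :=
        (lintegral_const_mul _ (hβm.mul (hDm I hI))).symm
      rw [e0, ← lintegral_const_mul _ (hβm.pow_const r),
        ← lintegral_add_right _ ((hDm I hI).pow_const t)]
      refine lintegral_mono fun x => ?_
      rw [← ENNReal.mul_rpow_of_nonneg _ _ hrt.nonneg, ← mul_assoc]
      exact ENNReal.mul_le_rpow_add_rpow hrt _ _
    have e3 : ∫⁻ x, βs I x * F x ∂μ = a I * ∫⁻ x, β I x ∂ν :=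
      lintegral_indicator_div_mul hF (hm I hI) _
    calc a I * ∫⁻ x, β I x * φ x ∂ν ≤
          a I * ∫⁻ x, (𝓕.supAvg ν φ I * β I x + β I x * D I x) ∂ν := by gcongr
      _ = 𝓕.supAvg ν φ I * (a I * ∫⁻ x, β I x ∂ν) + a I * ∫⁻ x, β I x * D I x ∂ν := by
          rw [lintegral_add_left (hβm.const_mul _), lintegral_const_mul _ hβm]
          ring
      _ ≤ 2 * (𝓕.supAvg ν φ I).dyadicFloor * (a I * ∫⁻ x, β I x ∂ν) +
          ((2 * (𝓕.supAvg μ F I).dyadicFloor) ^ r * ∫⁻ x, β I x ^ r ∂ν + ∫⁻ x, D I x ^ t ∂ν) := by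
          gcongr
          · exact ENNReal.le_two_mul_dyadicFloor (h0' I hI) (htop' I hI)
          · refine e2.trans ?_
            gcongr
            · exact hrt.nonneg
            · exact hav I hI
      _ = _ := by
          rw [e3, ENNReal.mul_rpow_of_nonneg _ _ hrt.nonneg]
          ring
  -- Since `t ≥ 1`, it suffices to bound `∑ D I`, which telescopes at each point.
  have hDsum : ∑ I ∈ G, ∫⁻ x, D I x ^ t ∂ν ≤ ∫⁻ x, 𝓕.maximalFn ν φ x ^ t ∂ν := by
    rw [← lintegral_finsetSum' _ fun I hI => ((hDm I hI).pow_const t).aemeasurable]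
    refine lintegral_mono fun x => ?_
    refine (ENNReal.sum_rpow_le_rpow_sum _ _ hrt.symm.lt.le).trans ?_
    refine ENNReal.rpow_le_rpow ?_ hrt.symm.nonneg
    have e : ∑ I ∈ G, D I x =
        ∑ I ∈ G.filter (x ∈ ·), (𝓕.childAvg ν φ I x - 𝓕.supAvg ν φ I) := by
      rw [Finset.sum_filter]
      exact Finset.sum_congr rfl fun I _ => by simp [hD, Set.indicator_apply]
    rw [e]
    have hmem : ∀ I ∈ G.filter (x ∈ ·), I ∈ 𝓕.intervals ∧ x ∈ I := fun I hI =>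
      ⟨h.mem_intervals I (Finset.mem_filter.1 hI).1, (Finset.mem_filter.1 hI).2⟩
    exact 𝓕.sum_childAvg_sub_le ν φ hmem
      (fun I hI => 𝓕.childAvg_le_maximalFn ν φ (hmem I hI).1 (hmem I hI).2)
      (fun I hI => 𝓕.supAvg_le_maximalFn ν φ (hmem I hI).2)
  refine (Finset.sum_le_sum hsplit).trans ?_
  rw [Finset.sum_add_distrib, Finset.sum_add_distrib, ← Finset.mul_sum, ← Finset.mul_sum]
  gcongr

end IsTested

end AtomicFiltration

/-! ### Boundedness of positive operators from testing. -/

theorem lintegral_rpow_finset_sum_ne_top {X ι : Type*} [MeasurableSpace X] {ν : Measure X}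
    {T : Finset ι} {f : ι → X → ℝ≥0∞} {r : ℝ} (hr : 1 ≤ r) (hf : ∀ i ∈ T, Measurable (f i))
    (h : ∀ i ∈ T, ∫⁻ x, f i x ^ r ∂ν ≠ ∞) : ∫⁻ x, (∑ i ∈ T, f i x) ^ r ∂ν ≠ ∞ := by
  classical
  induction T using Finset.induction_on with
  | empty => simp [zero_lt_one.trans_le hr]
  | insert i T hi ih =>
    have ih' := ih (fun j hj => hf j (Finset.mem_insert_of_mem hj))
      (fun j hj => h j (Finset.mem_insert_of_mem hj))
    simp_rw [Finset.sum_insert hi]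
    exact (ENNReal.lintegral_rpow_add_lt_top_of_lintegral_rpow_lt_top
      (hf i (Finset.mem_insert_self _ _)).aemeasurable
      (h i (Finset.mem_insert_self _ _)).lt_top ih'.lt_top hr).ne

namespace AtomicFiltration

namespace IsTested

/-- Each interval goes to the corona of the function whose normalized average is larger there; the
maximal theorem then removes the maximal functions. -/
theorem exists_form_bound {r t : ℝ} (hrt : r.HolderConjugate t) : ∃ C : ℝ≥0∞, C ≠ ∞ ∧
    ∀ {X : Type*} [MeasurableSpace X] {𝓕 : AtomicFiltration X} {μ ν : Measure X}
      {G : Finset (Set X)} {β : Set X → X → ℝ≥0∞}, 𝓕.IsTested r t μ ν G β →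
      𝓕.LocallyFinite μ → 𝓕.LocallyFinite ν → ∀ {F φ : X → ℝ≥0∞}, Measurable F → Measurable φ →
      ∫⁻ x, F x ^ r ∂μ ≠ ∞ → ∫⁻ x, φ x ^ t ∂ν ≠ ∞ →
      ∑ I ∈ G, (⨍⁻ x in I, F x ∂μ) * ∫⁻ x, β I x * φ x ∂ν ≤
        C * (∫⁻ x, F x ^ r ∂μ + ∫⁻ x, φ x ^ t ∂ν) := by
  classical
  obtain ⟨C₁, _, h₁⟩ := exists_maximal hrt.lt
  obtain ⟨C₂, _, h₂⟩ := exists_maximal hrt.symm.lt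
  refine ⟨(2 * (4 + 2 * 2 ^ r) + 2 ^ r * 2) * C₁ + 2 + ((2 * (4 + 2 * 2 ^ t) + 1) * C₂ + 2), ?_, ?_⟩
  · have e1 : (2 : ℝ≥0∞) ^ r ≠ ∞ := by simp
    have e2 : (2 : ℝ≥0∞) ^ t ≠ ∞ := by simp
    finiteness
  intro X _ 𝓕 μ ν G β h hμ hν F φ hF hφ hFr hφt
  set f0 := ∫⁻ x, F x ^ r ∂μ
  set Y := ∫⁻ x, φ x ^ t ∂ν
  have m₁ : ∫⁻ x, 𝓕.maximalFn μ F x ^ r ∂μ ≤ C₁ * f0 := h₁ hμ hF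
  have m₂ : ∫⁻ x, 𝓕.maximalFn ν φ x ^ t ∂ν ≤ C₂ * Y := h₂ hν hφ
  have m₁t := ne_top_of_le_ne_top (ENNReal.mul_ne_top ENNReal.coe_ne_top hFr) m₁
  have m₂t := ne_top_of_le_ne_top (ENNReal.mul_ne_top ENNReal.coe_ne_top hφt) m₂
  -- Terms failing `P` vanish. On the others the suprema of averages are neither zero nor infinite,
  -- so their dyadic floors are meaningful.
  set P : Set X → Prop := fun I => (⨍⁻ x in I, F x ∂μ) ≠ 0 ∧ (⨍⁻ x in I, φ x ∂ν) ≠ 0 ∧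
    μ I ≠ 0 ∧ ν I ≠ 0 with hP
  have hzero : ∀ I ∈ G, (⨍⁻ x in I, F x ∂μ) * ∫⁻ x, β I x * φ x ∂ν ≠ 0 → P I := by
    intro I hI hne
    have hIm := 𝓕.interval_measurable (h.mem_intervals I hI)
    have hint : ∫⁻ x, β I x * φ x ∂ν = ∫⁻ x in I, β I x * φ x ∂ν := by
      rw [setLIntegral_eq_of_support_subset]
      intro x hx
      by_contra hxI
      exact hx (by simp [h.eq_zero I hI x hxI])
    refine ⟨left_ne_zero_of_mul hne, fun h0 => ?_, fun h0 => ?_, fun h0 => ?_⟩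
    · apply right_ne_zero_of_mul hne
      have h1 : ∫⁻ x in I, φ x ∂ν = 0 := by
        rw [← measure_mul_setLAverage φ (hν I (h.mem_intervals I hI)).ne, h0, mul_zero]
      rw [lintegral_eq_zero_iff hφ] at h1
      rw [hint, ← lintegral_zero]
      refine lintegral_congr_ae ?_
      filter_upwards [h1] with x hx
      simp [hx]
    · apply left_ne_zero_of_mul hne
      rw [Measure.restrict_eq_zero.2 h0, laverage_zero_measure]
    · apply right_ne_zero_of_mul hne
      rw [hint, Measure.restrict_eq_zero.2 h0, lintegral_zero_measure]
  rw [← Finset.sum_filter_of_ne hzero]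
  set c : Set X → Prop := fun I =>
    (⨍⁻ x in I, φ x ∂ν) ^ t * ν I ≤ (⨍⁻ x in I, F x ∂μ) ^ r * μ I with hc
  rw [← Finset.sum_filter_add_sum_filter_not (G.filter P) c]
  have hsub1 : (G.filter P).filter c ⊆ G := (Finset.filter_subset _ _).trans (Finset.filter_subset _ _)
  have hsub2 : (G.filter P).filter (fun I => ¬ c I) ⊆ G :=
    (Finset.filter_subset _ _).trans (Finset.filter_subset _ _)
  have hpos : ∀ {κ : Measure X} {f : X → ℝ≥0∞} {I : Set X}, I ∈ G → (⨍⁻ x in I, f x ∂κ) ≠ 0 →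
      𝓕.supAvg κ f I ≠ 0 := fun {κ f I} hI hne =>
    ((pos_of_ne_zero hne).trans_le
      (𝓕.setLAverage_le_supAvg κ f (h.mem_intervals I hI) subset_rfl)).ne'
  have b1 := (h.mono hrt.nonneg hrt.symm.nonneg hsub1).form_bound_left hrt hν (F := F) hφ
    (fun I hI => hpos (hsub1 hI) (Finset.mem_filter.1 (Finset.mem_filter.1 hI).1).2.1)
    (fun I hI => 𝓕.supAvg_ne_top hrt.pos m₁t
      (Finset.mem_filter.1 (Finset.mem_filter.1 hI).1).2.2.2.1)
    (fun I hI => (Finset.mem_filter.1 hI).2)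
  have b2 := (h.mono hrt.nonneg hrt.symm.nonneg hsub2).form_bound_right hrt hμ hν hF hφ
    (fun I hI => hpos (hsub2 hI) (Finset.mem_filter.1 (Finset.mem_filter.1 hI).1).2.1)
    (fun I hI => 𝓕.supAvg_ne_top hrt.pos m₁t
      (Finset.mem_filter.1 (Finset.mem_filter.1 hI).1).2.2.2.1)
    (fun I hI => hpos (hsub2 hI) (Finset.mem_filter.1 (Finset.mem_filter.1 hI).1).2.2.1)
    (fun I hI => 𝓕.supAvg_ne_top hrt.symm.pos m₂t
      (Finset.mem_filter.1 (Finset.mem_filter.1 hI).1).2.2.2.2)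
    (fun I hI => (not_le.1 (Finset.mem_filter.1 hI).2).le)
  calc _ ≤ 2 * ((4 + 2 * 2 ^ r) * (C₁ * f0) + Y) + (2 * ((4 + 2 * 2 ^ t) * (C₂ * Y) + f0) +
        (2 ^ r * (2 * (C₁ * f0)) + C₂ * Y)) := by
        refine (add_le_add b1 b2).trans ?_
        gcongr
    _ = ((2 * (4 + 2 * 2 ^ r) + 2 ^ r * 2) * C₁ + 2) * f0 +
        ((2 * (4 + 2 * 2 ^ t) + 1) * C₂ + 2) * Y := by ring
    _ ≤ ((2 * (4 + 2 * 2 ^ r) + 2 ^ r * 2) * C₁ + 2 + ((2 * (4 + 2 * 2 ^ t) + 1) * C₂ + 2)) * f0 +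
        ((2 * (4 + 2 * 2 ^ r) + 2 ^ r * 2) * C₁ + 2 + ((2 * (4 + 2 * 2 ^ t) + 1) * C₂ + 2)) * Y := by
        exact add_le_add (mul_le_mul' le_self_add le_rfl) (mul_le_mul' le_add_self le_rfl)
    _ = _ := by ring

/-- A positive operator satisfying the two testing conditions is bounded. -/
theorem exists_operator_bound {r t : ℝ} (hrt : r.HolderConjugate t) : ∃ C : ℝ≥0∞, C ≠ ∞ ∧
    ∀ {X : Type*} [MeasurableSpace X] {𝓕 : AtomicFiltration X} {μ ν : Measure X}
      {G : Finset (Set X)} {β : Set X → X → ℝ≥0∞}, 𝓕.IsTested r t μ ν G β →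
      𝓕.LocallyFinite μ → 𝓕.LocallyFinite ν → (∀ I ∈ G, ∫⁻ x, β I x ^ r ∂ν ≠ ∞) →
      ∀ {F : X → ℝ≥0∞}, Measurable F → ∫⁻ x, F x ^ r ∂μ ≠ ∞ →
      ∫⁻ x, (∑ I ∈ G, (⨍⁻ y in I, F y ∂μ) * β I x) ^ r ∂ν ≤ C * ∫⁻ x, F x ^ r ∂μ := by
  obtain ⟨C, hC, h₀⟩ := exists_form_bound hrt
  have ht1 : 0 < t - 1 := sub_pos.2 hrt.symm.lt
  have hr1 : 0 < r - 1 := sub_pos.2 hrt.lt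
  set D : ℝ≥0∞ := 2 * C + 1 with hD
  have hDt : D ≠ ∞ := by finiteness
  have hD0 : D ≠ 0 := by simp [hD]
  -- The form bound is not homogeneous, so duality is replaced by testing against `τ S^(r-1)`. Here
  -- `τ^(t-1) = 1/D`, so the error `C τ^t` is at most `τ / 2` and can be absorbed; the `+ 1` in `D`
  -- keeps it nonzero.
  set τ : ℝ≥0∞ := D ^ (-(1 / (t - 1))) with hτ
  have hτ0 : τ ≠ 0 := by simp [hτ, ENNReal.rpow_eq_zero_iff, hD0, hDt]
  have hτt : τ ≠ ∞ := by simp [hτ, ENNReal.rpow_eq_top_iff, hD0, hDt]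
  have hτp : C * τ ^ t ≤ 2⁻¹ * τ := by
    have h1 : τ ^ t = D⁻¹ * τ := by
      have h2 : τ ^ (t - 1) = D⁻¹ := by
        rw [hτ, ← ENNReal.rpow_mul, neg_mul, one_div_mul_cancel ht1.ne', ENNReal.rpow_neg_one]
      rw [← h2]
      conv_rhs => rw [← ENNReal.rpow_one τ, ← ENNReal.rpow_mul, one_mul]
      rw [← ENNReal.rpow_add _ _ hτ0 hτt, sub_add_cancel]
    rw [h1, ← mul_assoc]
    gcongr
    rw [← div_eq_mul_inv]
    refine ENNReal.div_le_of_le_mul ?_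
    rw [hD, mul_add, ← mul_assoc, ENNReal.inv_mul_cancel two_ne_zero ENNReal.ofNat_ne_top, one_mul]
    exact le_self_add
  refine ⟨2 * C / τ, ENNReal.div_ne_top (by finiteness) hτ0, ?_⟩
  intro X _ 𝓕 μ ν G β h hμ hν hβ F hF hFr
  set S : X → ℝ≥0∞ := fun x => ∑ I ∈ G, (⨍⁻ y in I, F y ∂μ) * β I x with hS
  have hSm : Measurable S := Finset.measurable_fun_sum _ fun I hI => (h.measurable hI).const_mul _
  have hY : ∫⁻ x, S x ^ r ∂ν ≠ ∞ := by
    refine lintegral_rpow_finset_sum_ne_top hrt.lt.le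
      (fun I hI => (h.measurable hI).const_mul _) fun I hI => ?_
    simp_rw [ENNReal.mul_rpow_of_nonneg _ _ hrt.nonneg]
    rw [lintegral_const_mul _ ((h.measurable hI).pow_const r)]
    refine ENNReal.mul_ne_top (ENNReal.rpow_ne_top_of_nonneg hrt.nonneg ?_) (hβ I hI)
    exact (setLAverage_lt_top (setLIntegral_ne_top hrt.lt hFr
      (hμ I (h.mem_intervals I hI)).ne)).ne
  set Y := ∫⁻ x, S x ^ r ∂ν with hYdef
  set φ : X → ℝ≥0∞ := fun x => τ * S x ^ (r - 1) with hφ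
  have hφm : Measurable φ := (hSm.pow_const _).const_mul _
  have hφt : ∫⁻ x, φ x ^ t ∂ν = τ ^ t * Y := by
    simp_rw [hφ, ENNReal.mul_rpow_of_nonneg _ _ hrt.symm.nonneg, ← ENNReal.rpow_mul,
      hrt.sub_one_mul_conj]
    rw [lintegral_const_mul _ (hSm.pow_const r)]
  have key := h₀ h hμ hν hF hφm hFr (by
    rw [hφt]
    exact ENNReal.mul_ne_top (ENNReal.rpow_ne_top_of_nonneg hrt.symm.nonneg hτt) hY)
  have hform : ∑ I ∈ G, (⨍⁻ x in I, F x ∂μ) * ∫⁻ x, β I x * φ x ∂ν = τ * Y := by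
    have e1 : ∀ I ∈ G, (⨍⁻ x in I, F x ∂μ) * ∫⁻ x, β I x * φ x ∂ν =
        ∫⁻ x, (⨍⁻ y in I, F y ∂μ) * (β I x * φ x) ∂ν := fun I hI =>
      (lintegral_const_mul _ ((h.measurable hI).mul hφm)).symm
    have e3 : ∑ I ∈ G, ∫⁻ x, (⨍⁻ y in I, F y ∂μ) * (β I x * φ x) ∂ν =
        ∫⁻ x, ∑ I ∈ G, (⨍⁻ y in I, F y ∂μ) * (β I x * φ x) ∂ν :=
      (lintegral_finsetSum' _ fun I hI =>
        (((h.measurable hI).mul hφm).const_mul _).aemeasurable).symm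
    rw [Finset.sum_congr rfl e1, e3, hYdef, ← lintegral_const_mul _ (hSm.pow_const r)]
    refine lintegral_congr fun x => ?_
    have e2 : S x ^ r = S x * S x ^ (r - 1) := by
      conv_rhs => rw [← ENNReal.rpow_one (S x), ← ENNReal.rpow_mul, one_mul]
      rw [← ENNReal.rpow_add_of_nonneg _ _ zero_le_one hr1.le]
      congr 1; ring
    rw [e2, hφ]
    simp_rw [← mul_assoc]
    rw [← Finset.sum_mul, ← Finset.sum_mul]
    simp only [hS]
    ring
  rw [hform, hφt] at key
  have h3 : τ * Y ≤ C * ∫⁻ x, F x ^ r ∂μ + 2⁻¹ * (τ * Y) := by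
    calc τ * Y ≤ C * ∫⁻ x, F x ^ r ∂μ + C * τ ^ t * Y := by
          rw [mul_assoc, ← mul_add]; exact key
      _ ≤ C * ∫⁻ x, F x ^ r ∂μ + 2⁻¹ * τ * Y := by gcongr
      _ = _ := by rw [mul_assoc]
  have h4 : 2⁻¹ * (τ * Y) ≤ C * ∫⁻ x, F x ^ r ∂μ := by
    have h5 : τ * Y = 2⁻¹ * (τ * Y) + 2⁻¹ * (τ * Y) := by
      rw [← add_mul, ENNReal.inv_two_add_inv_two, one_mul]
    nth_rw 1 [h5] at h3
    exact (ENNReal.add_le_add_iff_right (by finiteness)).1 h3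
  calc Y = 2 * (2⁻¹ * (τ * Y)) / τ := by
        rw [← mul_assoc, ENNReal.mul_inv_cancel two_ne_zero ENNReal.ofNat_ne_top, one_mul,
          ENNReal.mul_div_right_comm, ENNReal.div_self hτ0 hτt, one_mul]
    _ ≤ 2 * (C * ∫⁻ x, F x ^ r ∂μ) / τ := by gcongr
    _ = _ := by rw [← mul_assoc, ENNReal.mul_div_right_comm]

end IsTested

end AtomicFiltration

/-! ### Limit theorems for sums over finite index sets. -/

section LpSums

variable {X : Type*} [MeasurableSpace X] {ν : Measure X}

theorem eLpNorm_ofReal_rpow {E : Type*} [NormedAddCommGroup E] {p : ℝ} (hp : 0 < p) (f : X → E) :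
    eLpNorm f (ENNReal.ofReal p) ν ^ p = ∫⁻ x, ‖f x‖ₑ ^ p ∂ν := by
  rw [eLpNorm_eq_lintegral_rpow_enorm_toReal (by simpa using hp) ENNReal.ofReal_ne_top,
    ENNReal.toReal_ofReal hp.le, ← ENNReal.rpow_mul, one_div_mul_cancel hp.ne', ENNReal.rpow_one]

theorem lintegral_tsum_rpow_le {ι : Type*} [Countable ι] {u : ι → X → ℝ≥0∞}
    (hu : ∀ i, Measurable (u i)) {q : ℝ} (hq : 0 < q) {K : ℝ≥0∞}
    (h : ∀ F : Finset ι, ∫⁻ x, (∑ i ∈ F, u i x) ^ q ∂ν ≤ K) :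
    ∫⁻ x, (∑' i, u i x) ^ q ∂ν ≤ K := by
  have e : ∀ x, (∑' i, u i x) ^ q = ⨆ F : Finset ι, (∑ i ∈ F, u i x) ^ q := fun x => by
    rw [ENNReal.tsum_eq_iSup_sum]
    exact (ENNReal.orderIsoRpow q hq).map_iSup _
  rw [lintegral_congr e, lintegral_iSup_directed]
  · exact iSup_le h
  · exact fun F => ((Finset.measurable_fun_sum F fun i _ => hu i).pow_const q).aemeasurable
  · refine Monotone.directed_le fun F F' hF x => ?_
    exact ENNReal.rpow_le_rpow (Finset.sum_le_sum_of_subset hF) hq.le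

/-- Dominated convergence: the tails are below the full sum, which is finite almost everywhere, and
tend to zero wherever it is finite. -/
theorem tendsto_lintegral_tsum_compl_rpow {ι : Type*} [Countable ι] {u : ι → X → ℝ≥0∞}
    (hu : ∀ i, Measurable (u i)) {q : ℝ} (hq : 0 < q)
    (h : ∫⁻ x, (∑' i, u i x) ^ q ∂ν ≠ ∞) :
    Tendsto (fun F : Finset ι => ∫⁻ x, (∑' i : {i // i ∉ F}, u i x) ^ q ∂ν) atTop (𝓝 0) := by
  rw [← lintegral_zero (μ := ν)]
  refine tendsto_lintegral_filter_of_dominated_convergence (fun x => (∑' i, u i x) ^ q) ?_ ?_ h ?_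
  · exact Eventually.of_forall fun F => (Measurable.tsum fun i => hu _).pow_const q
  · refine Eventually.of_forall fun F => Eventually.of_forall fun x => ?_
    exact ENNReal.rpow_le_rpow (ENNReal.tsum_comp_le_tsum_of_injective Subtype.val_injective _) hq.le
  · have hm : Measurable fun x => (∑' i, u i x) ^ q := (Measurable.tsum hu).pow_const q
    filter_upwards [ae_lt_top hm h] with x hx
    have hx' : ∑' i, u i x ≠ ∞ := by
      intro htop
      simp [htop, hq] at hx
    have := (ENNReal.tendsto_tsum_compl_atTop_zero hx').ennrpow_const q
    simpa [ENNReal.zero_rpow_of_pos hq] using this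

end LpSums

/-! ### Unconditional convergence and square functions. -/

namespace AtomicFiltration

universe u

/-- A series of martingale differences whose square function is in `L^p` converges unconditionally
in `L^p`. -/
theorem exists_isLpSum {p : ℝ} (hp : 2 < p) : ∃ C : ℝ≥0, 0 < C ∧
    ∀ {X : Type u} [MeasurableSpace X] {𝓕 : AtomicFiltration X} {ν : Measure X}
      {b : Set X → X → ℝ}, 𝓕.IsMartDiffFamily ν b → ∀ {ι : Type u} [Countable ι] (e : ι ↪ Set X),
      (∀ i, e i ∈ 𝓕.intervals) → (∀ i, MemLp (b (e i)) (ENNReal.ofReal p) ν) →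
      ∀ {K : ℝ≥0∞}, K ≠ ∞ →
      (∀ F : Finset ι, ∫⁻ x, (∑ i ∈ F, ‖b (e i) x‖ₑ ^ 2) ^ (p / 2) ∂ν ≤ K) →
      ∃ g : X → ℝ, IsLpSum p ν (fun i => b (e i)) g ∧ ∫⁻ x, ‖g x‖ₑ ^ p ∂ν ≤ C * K := by
  obtain ⟨C, hC, hB⟩ := exists_burkholder.{u} hp
  refine ⟨C, hC, ?_⟩
  classical
  intro X _ 𝓕 ν b hb ι _ e he hLp K hK hF
  have hp0 : 0 < p := by linarith
  have hp1 : Fact (1 ≤ ENNReal.ofReal p) := ⟨by simpa using (by linarith : 1 ≤ p)⟩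
  have hBF : ∀ F : Finset ι, eLpNorm (fun x => ∑ i ∈ F, b (e i) x) (ENNReal.ofReal p) ν ^ p ≤
      C * ∫⁻ x, (∑ i ∈ F, ‖b (e i) x‖ₑ ^ 2) ^ (p / 2) ∂ν := by
    intro F
    rw [eLpNorm_ofReal_rpow hp0]
    have h1 := (hB hb (F := F.map e) (by simpa using fun i _ => he i)
      (by simpa using fun i _ => hLp i)).1
    simpa [Finset.sum_map] using h1
  have hum : ∀ i, Measurable fun x => ‖b (e i) x‖ₑ ^ 2 := fun i =>
    (hb.measurable (he i)).enorm.pow_const 2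
  have htot := lintegral_tsum_rpow_le hum (by linarith : 0 < p / 2) hF
  have htail := tendsto_lintegral_tsum_compl_rpow hum (by linarith : 0 < p / 2)
    (ne_top_of_le_ne_top hK htot)
  set U : ι → Lp ℝ (ENNReal.ofReal p) ν := fun i => (hLp i).toLp (b (e i)) with hU
  have hUF : ∀ F : Finset ι, (∑ i ∈ F, U i : Lp ℝ (ENNReal.ofReal p) ν) =ᵐ[ν]
      fun x => ∑ i ∈ F, b (e i) x := by
    intro F
    induction F using Finset.induction_on with
    | empty =>
      rw [Finset.sum_empty]
      filter_upwards [Lp.coeFn_zero ℝ (ENNReal.ofReal p) ν] with x hx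
      simpa using hx
    | insert i F hi ih =>
      rw [Finset.sum_insert hi]
      filter_upwards [Lp.coeFn_add (U i) (∑ i ∈ F, U i), ih, (hLp i).coeFn_toLp] with x h1 h2 h3
      rw [h1, Pi.add_apply, h2, Finset.sum_insert hi]
      exact congrArg (· + _) h3
  -- Cauchy criterion: by Burkholder, a finite sum avoiding `s` is controlled by the square function
  -- of the tail off `s`.
  have hsum : Summable U := by
    rw [summable_iff_vanishing_norm]
    intro ε hε
    have hε' : (0 : ℝ≥0∞) < ENNReal.ofReal ε ^ p / C := by
      refine ENNReal.div_pos ?_ ENNReal.coe_ne_top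
      exact (ENNReal.rpow_pos (by simpa using hε) ENNReal.ofReal_ne_top).ne'
    obtain ⟨s, hs⟩ := (htail.eventually (gt_mem_nhds hε')).exists
    refine ⟨s, fun t ht => ?_⟩
    have h1 : eLpNorm (∑ i ∈ t, U i : Lp ℝ (ENNReal.ofReal p) ν) (ENNReal.ofReal p) ν ^ p <
        ENNReal.ofReal ε ^ p := by
      rw [eLpNorm_congr_ae (hUF t)]
      refine (hBF t).trans_lt ?_
      have h2 : ∫⁻ x, (∑ i ∈ t, ‖b (e i) x‖ₑ ^ 2) ^ (p / 2) ∂ν ≤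
          ∫⁻ x, (∑' i : {i // i ∉ s}, ‖b (e i) x‖ₑ ^ 2) ^ (p / 2) ∂ν := by
        refine lintegral_mono fun x => ENNReal.rpow_le_rpow ?_ (by linarith)
        have h3 : ∑ i ∈ t, ‖b (e i) x‖ₑ ^ 2 =
            ∑ i ∈ t.subtype (fun i => i ∉ s), ‖b (e i) x‖ₑ ^ 2 := by
          rw [Finset.sum_subtype_of_mem (fun i => ‖b (e i) x‖ₑ ^ 2)]
          exact fun i hi => Finset.disjoint_left.1 ht hi
        rw [h3]
        exact ENNReal.sum_le_tsum _
      calc _ ≤ C * ∫⁻ x, (∑' i : {i // i ∉ s}, ‖b (e i) x‖ₑ ^ 2) ^ (p / 2) ∂ν := by gcongr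
        _ < C * (ENNReal.ofReal ε ^ p / C) :=
          (ENNReal.mul_lt_mul_iff_right (by simpa using hC.ne') ENNReal.coe_ne_top).2 hs
        _ = ENNReal.ofReal ε ^ p :=
          ENNReal.mul_div_cancel (by simpa using hC.ne') ENNReal.coe_ne_top
    have h4 := (ENNReal.rpow_lt_rpow_iff hp0).1 h1
    rw [Lp.norm_def]
    rw [← ENNReal.toReal_ofReal hε.le]
    exact (ENNReal.toReal_lt_toReal h4.ne_top ENNReal.ofReal_ne_top).2 h4
  obtain ⟨g, hg⟩ := hsum
  have hconv : Tendsto (fun F : Finset ι => eLpNorm (fun x => ∑ i ∈ F, b (e i) x - g x)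
      (ENNReal.ofReal p) ν) atTop (𝓝 0) := by
    have h1 : Tendsto (fun F : Finset ι => ‖(∑ i ∈ F, U i) - g‖ₑ) atTop (𝓝 0) := by
      have h2 : Tendsto (fun F : Finset ι => (∑ i ∈ F, U i) - g) atTop (𝓝 (g - g)) :=
        Tendsto.sub_const hg g
      rw [sub_self] at h2
      simpa using h2.enorm
    refine h1.congr fun F => ?_
    rw [Lp.enorm_def]
    refine eLpNorm_congr_ae ?_
    filter_upwards [Lp.coeFn_sub (∑ i ∈ F, U i) g, hUF F] with x hx1 hx2
    rw [hx1, Pi.sub_apply, hx2]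
  have hgm : MemLp g (ENNReal.ofReal p) ν := Lp.memLp g
  refine ⟨g, ⟨hgm, hconv⟩, ?_⟩
  have hle : ∀ F : Finset ι, eLpNorm (fun x => ∑ i ∈ F, b (e i) x) (ENNReal.ofReal p) ν ≤
      (C * K) ^ p⁻¹ := by
    intro F
    rw [ENNReal.le_rpow_inv_iff hp0]
    exact (hBF F).trans (by gcongr; exact hF F)
  have h5 : eLpNorm g (ENNReal.ofReal p) ν ≤ (C * K) ^ p⁻¹ := by
    have h6 : ∀ F : Finset ι, eLpNorm g (ENNReal.ofReal p) ν ≤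
        eLpNorm (fun x => ∑ i ∈ F, b (e i) x - g x) (ENNReal.ofReal p) ν + (C * K) ^ p⁻¹ := by
      intro F
      have hFm : AEStronglyMeasurable (fun x => ∑ i ∈ F, b (e i) x) ν :=
        (memLp_finsetSum F fun i _ => hLp i).1
      have h7 := eLpNorm_sub_le (p := ENNReal.ofReal p) hFm (hFm.sub hgm.1) hp1.out
      have h8 : (fun x => ∑ i ∈ F, b (e i) x) - ((fun x => ∑ i ∈ F, b (e i) x) - (g : X → ℝ)) =
          (g : X → ℝ) := sub_sub_cancel _ _
      rw [h8, add_comm] at h7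
      exact h7.trans (add_le_add le_rfl (hle F))
    have h9 := hconv.add_const ((C * K : ℝ≥0∞) ^ p⁻¹)
    rw [zero_add] at h9
    exact ge_of_tendsto h9 (Eventually.of_forall h6)
  rw [← eLpNorm_ofReal_rpow hp0]
  exact (ENNReal.le_rpow_inv_iff hp0).1 h5

section

variable {X : Type*} [MeasurableSpace X] {𝓕 : AtomicFiltration X} {ν : Measure X}
  {b : Set X → X → ℝ}

/-- Some partial sum including `i` is at finite distance from `g`, so it is in `L^p`, and then each
of its terms is. -/
theorem IsMartDiffFamily.memLp_of_isLpSum (hb : 𝓕.IsMartDiffFamily ν b) (hν : 𝓕.LocallyFinite ν)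
    {p : ℝ} {ι : Type*} (e : ι ↪ Set X) (he : ∀ i, e i ∈ 𝓕.intervals)
    {g : X → ℝ} (hg : IsLpSum p ν (fun i => b (e i)) g) (i : ι) :
    MemLp (b (e i)) (ENNReal.ofReal p) ν := by
  have h1 : ∀ᶠ F : Finset ι in atTop,
      eLpNorm (fun x => ∑ i ∈ F, b (e i) x - g x) (ENNReal.ofReal p) ν < 1 :=
    hg.2.eventually (gt_mem_nhds one_pos)
  obtain ⟨F, hF1, hF⟩ := (h1.and (eventually_ge_atTop {i})).exists
  have hFm : AEStronglyMeasurable (fun x => ∑ i ∈ F, b (e i) x) ν :=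
    (Finset.measurable_fun_sum F fun i _ => hb.measurable (he i)).aestronglyMeasurable
  have h2 : MemLp (fun x => ∑ i ∈ F, b (e i) x - g x) (ENNReal.ofReal p) ν :=
    ⟨hFm.sub hg.1.1, hF1.trans ENNReal.one_lt_top⟩
  have h3 : MemLp (fun x => ∑ I ∈ F.map e, b I x) (ENNReal.ofReal p) ν := by
    have h4 := h2.add hg.1
    convert h4 using 1
    funext x
    simp [Finset.sum_map]
  refine hb.memLp_of_sum hν (by simpa using fun i _ => he i) h3 (e i) ?_
  simpa using hF (Finset.mem_singleton_self i)

end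

/-- The square function of a series of martingale differences converging in `L^p` is bounded by
the sum of the series. -/
theorem exists_square_le_of_isLpSum {p : ℝ} (hp : 2 < p) : ∃ C : ℝ≥0, 0 < C ∧
    ∀ {X : Type u} [MeasurableSpace X] {𝓕 : AtomicFiltration X} {ν : Measure X}
      {b : Set X → X → ℝ}, 𝓕.IsMartDiffFamily ν b → 𝓕.LocallyFinite ν →
      ∀ {ι : Type u} (e : ι ↪ Set X),
      (∀ i, e i ∈ 𝓕.intervals) → ∀ {g : X → ℝ}, IsLpSum p ν (fun i => b (e i)) g →
      ∀ F : Finset ι, ∫⁻ x, (∑ i ∈ F, ‖b (e i) x‖ₑ ^ 2) ^ (p / 2) ∂ν ≤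
        C * ∫⁻ x, ‖g x‖ₑ ^ p ∂ν := by
  obtain ⟨C, hC, hB⟩ := exists_burkholder.{u} hp
  refine ⟨C, hC, ?_⟩
  intro X _ 𝓕 ν b hb hν ι e he g hg F
  have hp0 : 0 < p := by linarith
  have hLp := hb.memLp_of_isLpSum hν e he hg
  -- Enlarging `F` only increases the square function, so the limit may be taken in `F'` with `F`
  -- fixed.
  have h1 : ∀ F' : Finset ι, F ≤ F' → ∫⁻ x, (∑ i ∈ F, ‖b (e i) x‖ₑ ^ 2) ^ (p / 2) ∂ν ≤
      C * (eLpNorm (fun x => ∑ i ∈ F', b (e i) x - g x) (ENNReal.ofReal p) ν +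
        eLpNorm g (ENNReal.ofReal p) ν) ^ p := by
    intro F' hF'
    have h2 := (hB hb (F := F'.map e) (by simpa using fun i _ => he i)
      (by simpa using fun i _ => hLp i)).2
    simp only [Finset.sum_map] at h2
    have hFm : AEStronglyMeasurable (fun x => ∑ i ∈ F', b (e i) x) ν :=
      (memLp_finsetSum F' fun i _ => hLp i).1
    calc _ ≤ ∫⁻ x, (∑ i ∈ F', ‖b (e i) x‖ₑ ^ 2) ^ (p / 2) ∂ν :=
          lintegral_mono fun x =>
            ENNReal.rpow_le_rpow (Finset.sum_le_sum_of_subset hF') (by linarith)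
      _ ≤ _ := h2
      _ = C * eLpNorm (fun x => ∑ i ∈ F', b (e i) x) (ENNReal.ofReal p) ν ^ p := by
          rw [eLpNorm_ofReal_rpow hp0]
      _ ≤ _ := by
          gcongr
          have h3 := eLpNorm_add_le (p := ENNReal.ofReal p) (hFm.sub hg.1.1) hg.1.1
            (by simpa using (by linarith : 1 ≤ p))
          rwa [sub_add_cancel] at h3
  rw [← eLpNorm_ofReal_rpow hp0]
  have h4 := (hg.2.add_const (eLpNorm g (ENNReal.ofReal p) ν)).ennrpow_const p
  rw [zero_add] at h4
  exact ge_of_tendsto (ENNReal.Tendsto.const_mul h4 (Or.inr ENNReal.coe_ne_top))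
    ((eventually_ge_atTop F).mono h1)

end AtomicFiltration

/-! ### Necessity of the direct testing condition. -/

namespace AtomicFiltration

universe u

section

variable {X : Type*} [MeasurableSpace X] {𝓕 : AtomicFiltration X} {μ ν : Measure X}
  {b : Set X → X → ℝ}

theorem IsMartDiffFamily.avg_mul (hb : 𝓕.IsMartDiffFamily ν b) {I : Set X} (hI : I ∈ 𝓕.intervals)
    (μ : Measure X) (f : X → ℝ) (x : X) :
    avg μ I f x * b I x = (⨍ y in I, f y ∂μ) * b I x := by
  by_cases hx : x ∈ I
  · simp [avg, hx]
  · simp [avg, hx, hb.eq_zero hI hx]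

theorem IsMartDiffFamily.isParaproduct_iff (hb : 𝓕.IsMartDiffFamily ν b) {p : ℝ} {f g : X → ℝ} :
    𝓕.IsParaproduct p μ ν b f g ↔
      IsLpSum p ν (fun (I : 𝓕.intervals) x => (⨍ y in (I : Set X), f y ∂μ) * b I x) g := by
  unfold IsParaproduct
  have : (fun (I : 𝓕.intervals) x => avg μ I f x * b I x) =
      fun (I : 𝓕.intervals) x => (⨍ y in (I : Set X), f y ∂μ) * b I x := by
    funext I x
    exact hb.avg_mul I.2 μ f x
  rw [this]

end

/-- A bounded paraproduct has a bounded square function. -/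
theorem exists_square_le_of_paraproductBound {p : ℝ} (hp : 2 < p) : ∃ C : ℝ≥0, 0 < C ∧
    ∀ {X : Type u} [MeasurableSpace X] {𝓕 : AtomicFiltration X} {μ ν : Measure X}
      {b : Set X → X → ℝ}, 𝓕.IsMartDiffFamily ν b → 𝓕.LocallyFinite ν →
      ∀ {A : ℝ≥0}, 𝓕.ParaproductBound p μ ν b A →
      ∀ {f : X → ℝ}, MemLp f (ENNReal.ofReal p) μ →
      (∀ I ∈ 𝓕.intervals, MemLp (fun x => (⨍ y in I, f y ∂μ) * b I x) (ENNReal.ofReal p) ν) ∧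
      ∀ F : Finset (Set X), (∀ I ∈ F, I ∈ 𝓕.intervals) →
        ∫⁻ x, (∑ I ∈ F, ‖(⨍ y in I, f y ∂μ) * b I x‖ₑ ^ 2) ^ (p / 2) ∂ν ≤
          C * (A ^ p * ∫⁻ x, ‖f x‖ₑ ^ p ∂μ) := by
  classical
  obtain ⟨C, hC, h⟩ := exists_square_le_of_isLpSum.{u} hp
  refine ⟨C, hC, ?_⟩
  intro X _ 𝓕 μ ν b hb hν A hA f hf
  have hp0 : 0 < p := by linarith
  obtain ⟨g, hg, hgA⟩ := hA f hf
  rw [hb.isParaproduct_iff] at hg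
  have hb' := hb.const_mul fun I => ⨍ y in I, f y ∂μ
  refine ⟨fun I hI => hb'.memLp_of_isLpSum hν (Function.Embedding.subtype _) (fun i => i.2) hg
    ⟨I, hI⟩, fun F hF => ?_⟩
  have h1 := h hb' hν (Function.Embedding.subtype _) (fun i => i.2) hg
    (F.subtype (· ∈ 𝓕.intervals))
  have h2 : ∫⁻ x, ‖g x‖ₑ ^ p ∂ν ≤ A ^ p * ∫⁻ x, ‖f x‖ₑ ^ p ∂μ := by
    rw [← eLpNorm_ofReal_rpow hp0, ← eLpNorm_ofReal_rpow hp0, ← ENNReal.mul_rpow_of_nonneg _ _ hp0.le]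
    gcongr
  refine le_trans (le_of_eq ?_) (h1.trans (mul_le_mul_right h2 _))
  refine lintegral_congr fun x => ?_
  congr 1
  exact (Finset.sum_subtype_of_mem (fun I => ‖(⨍ y in I, f y ∂μ) * b I x‖ₑ ^ 2) hF).symm

/-- The paraproduct is applied to `1_J`, whose averages over `I ⊆ J` equal one. When `μ I = 0` the
average is zero by convention, but then `b I` vanishes almost everywhere. -/
theorem exists_localized_square_le_of_paraproductBound {p : ℝ} (hp : 2 < p) : ∃ C : ℝ≥0, 0 < C ∧
    ∀ {X : Type u} [MeasurableSpace X] {𝓕 : AtomicFiltration X} {μ ν : Measure X}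
      {b : Set X → X → ℝ}, 𝓕.IsMartDiffFamily ν b → 𝓕.LocallyFinite μ → 𝓕.LocallyFinite ν →
      (∀ I ∈ 𝓕.intervals, μ I = 0 → b I =ᵐ[ν] 0) →
      ∀ {A : ℝ≥0}, 𝓕.ParaproductBound p μ ν b A → ∀ J ∈ 𝓕.intervals,
      MemLp (b J) (ENNReal.ofReal p) ν ∧
      ∀ F : Finset (Set X), (∀ I ∈ F, I ∈ 𝓕.intervals ∧ I ⊆ J) →
        ∫⁻ x, (∑ I ∈ F, ‖b I x‖ₑ ^ 2) ^ (p / 2) ∂ν ≤ C * (A ^ p * μ J) := by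
  obtain ⟨C, hC, h⟩ := exists_square_le_of_paraproductBound.{u} hp
  refine ⟨C, hC, ?_⟩
  intro X _ 𝓕 μ ν b hb hμ hν hbμ A hA J hJ
  have hp0 : 0 < p := by linarith
  have hJm := 𝓕.interval_measurable hJ
  have hf : MemLp (J.indicator fun _ => (1 : ℝ)) (ENNReal.ofReal p) μ :=
    memLp_indicator_const _ hJm _ (Or.inr (hμ J hJ).ne)
  obtain ⟨h1, h2⟩ := h hb hν hA hf
  have hI : ∀ I ∈ 𝓕.intervals, I ⊆ J →
      (fun x => (⨍ y in I, J.indicator (fun _ => (1 : ℝ)) y ∂μ) * b I x) =ᵐ[ν] b I := by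
    intro I hI hIJ
    by_cases h0 : μ I = 0
    · filter_upwards [hbμ I hI h0] with x hx
      simp [hx]
    · have e : ⨍ y in I, J.indicator (fun _ => (1 : ℝ)) y ∂μ = 1 := by
        rw [setAverage_eq, setIntegral_congr_fun (g := fun _ => (1 : ℝ)) (𝓕.interval_measurable hI)
          (fun x hx => by simp [hIJ hx])]
        have : μ.real I ≠ 0 := (ENNReal.toReal_pos h0 (hμ I hI).ne).ne'
        simp [this]
      simp [e]
  refine ⟨(memLp_congr_ae (hI J hJ subset_rfl)).1 (h1 J hJ), fun F hF => ?_⟩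
  have h3 := h2 F fun I hI => (hF I hI).1
  have h4 : ∫⁻ x, ‖J.indicator (fun _ => (1 : ℝ)) x‖ₑ ^ p ∂μ = μ J := by
    rw [← lintegral_indicator_one hJm]
    refine lintegral_congr fun x => ?_
    by_cases hx : x ∈ J <;> simp [hx, hp0]
  rw [h4] at h3
  refine le_trans (le_of_eq (lintegral_congr_ae ?_)) h3
  have h5 : ∀ᵐ x ∂ν, ∀ I ∈ F,
      (⨍ y in I, J.indicator (fun _ => (1 : ℝ)) y ∂μ) * b I x = b I x :=
    (ae_ball_iff F.countable_toSet).2 fun I hIF => hI I (hF I hIF).1 (hF I hIF).2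
  filter_upwards [h5] with x hx
  congr 1
  exact Finset.sum_congr rfl fun I hIF => by rw [hx I hIF]

/-- Restricting the sum to `I ⊆ J` is harmless for square functions. Burkholder is therefore used
twice, to the square function and back. -/
theorem exists_directTesting {p : ℝ} (hp : 2 < p) : ∃ κ : ℝ≥0, 0 < κ ∧
    ∀ {X : Type u} [MeasurableSpace X] {𝓕 : AtomicFiltration X} {μ ν : Measure X}
      {b : Set X → X → ℝ}, 𝓕.IsMartDiffFamily ν b → 𝓕.LocallyFinite μ → 𝓕.LocallyFinite ν →
      (∀ I ∈ 𝓕.intervals, μ I = 0 → b I =ᵐ[ν] 0) →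
      ∀ {A : ℝ≥0}, 𝓕.ParaproductBound p μ ν b A → 𝓕.DirectTesting p μ ν b (κ * A) := by
  obtain ⟨C, hC, h⟩ := exists_localized_square_le_of_paraproductBound.{u} hp
  obtain ⟨C', hC', h'⟩ := exists_isLpSum.{u} hp
  have hp0 : 0 < p := by linarith
  refine ⟨(C' * C) ^ p⁻¹, NNReal.rpow_pos (by positivity), ?_⟩
  intro X _ 𝓕 μ ν b hb hμ hν hbμ A hA J hJ
  have hct : Countable {I : Set X // I ∈ 𝓕.intervals ∧ I ⊆ J} :=
    (𝓕.intervals_countable.mono fun I hI => hI.1 :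
      {I : Set X | I ∈ 𝓕.intervals ∧ I ⊆ J}.Countable).to_subtype
  have hLp : ∀ I ∈ 𝓕.intervals, MemLp (b I) (ENNReal.ofReal p) ν := fun I hI =>
    (h hb hμ hν hbμ hA I hI).1
  obtain ⟨g, hg, hgK⟩ := h' hb (ι := {I : Set X // I ∈ 𝓕.intervals ∧ I ⊆ J})
    (Function.Embedding.subtype _) (fun i => i.2.1) (fun i => hLp _ i.2.1)
    (K := C * (A ^ p * μ J))
    (ENNReal.mul_ne_top ENNReal.coe_ne_top (ENNReal.mul_ne_top (by simp [hp0.le]) (hμ J hJ).ne))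
    (fun F => by
      have h1 := (h hb hμ hν hbμ hA J hJ).2 (F.map (Function.Embedding.subtype _))
        (by
          intro I hI
          obtain ⟨i, -, rfl⟩ := Finset.mem_map.1 hI
          exact i.2)
      simpa [Finset.sum_map] using h1)
  refine ⟨g, hg, (setLIntegral_le_lintegral _ _).trans (hgK.trans (le_of_eq ?_))⟩
  rw [← ENNReal.coe_rpow_of_nonneg _ hp0.le, ← ENNReal.coe_rpow_of_nonneg _ hp0.le,
    NNReal.mul_rpow (x := (C' * C) ^ p⁻¹), ← NNReal.rpow_mul, inv_mul_cancel₀ hp0.ne',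
    NNReal.rpow_one]
  push_cast
  ring

end AtomicFiltration

/-! ### Necessity of the adjoint testing condition. -/

theorem le_enorm_setAverage {X : Type*} [MeasurableSpace X] {μ : Measure X} {I : Set X}
    (hI : MeasurableSet I) (h0 : μ I ≠ 0) (hfin : μ I ≠ ∞) {f : X → ℝ} (hf : IntegrableOn f I μ)
    (hf0 : ∀ x, 0 ≤ f x) {m : ℝ≥0∞} (hm : ∀ᵐ x ∂μ, x ∈ I → m ≤ ENNReal.ofReal (f x)) :
    m ≤ ‖⨍ x in I, f x ∂μ‖ₑ := by
  refine le_trans ?_ (Real.ofReal_le_enorm _)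
  rw [ofReal_setAverage hf (Eventually.of_forall hf0), ENNReal.le_div_iff_mul_le (Or.inl h0)
    (Or.inl hfin), ← setLIntegral_const]
  exact lintegral_mono_ae ((ae_restrict_iff' hI).2 hm)

theorem setLIntegral_le_rpow_mul_rpow {X : Type*} [MeasurableSpace X] {ν : Measure X} {r t : ℝ}
    (hrt : r.HolderConjugate t) {u : X → ℝ≥0∞} (hu : Measurable u) (J : Set X) :
    ∫⁻ x in J, u x ∂ν ≤ (∫⁻ x, u x ^ r ∂ν) ^ r⁻¹ * ν J ^ t⁻¹ := by
  have h := ENNReal.lintegral_mul_le_Lp_mul_Lq (ν.restrict J) hrt hu.aemeasurable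
    (g := fun _ => 1) aemeasurable_const
  simp only [Pi.mul_apply, mul_one, one_div, ENNReal.one_rpow, lintegral_const,
    Measure.restrict_apply_univ, one_mul] at h
  refine h.trans ?_
  gcongr
  · exact inv_nonneg.2 hrt.nonneg
  · exact Measure.restrict_le_self

/-- Divide by `Z^(1/r)`, leaving `Z^(1/t)` on the left, and raise to the power `t`. -/
theorem ENNReal.le_rpow_mul_of_le_rpow_mul_rpow {r t : ℝ} (hrt : r.HolderConjugate t)
    {Z D N : ℝ≥0∞} (hZ : Z ≠ ∞) (h : Z ≤ (D * Z) ^ r⁻¹ * N ^ t⁻¹) : Z ≤ (D ^ r⁻¹) ^ t * N := by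
  have hr := hrt.pos
  have ht := hrt.symm.pos
  by_cases h0 : Z = 0
  · simp [h0]
  have h1 : Z ^ r⁻¹ * Z ^ t⁻¹ = Z := by
    rw [← ENNReal.rpow_add _ _ h0 hZ, hrt.inv_add_inv_eq_one, ENNReal.rpow_one]
  rw [ENNReal.mul_rpow_of_nonneg _ _ (inv_nonneg.2 hr.le)] at h
  have h2 : Z ^ r⁻¹ * Z ^ t⁻¹ ≤ Z ^ r⁻¹ * (D ^ r⁻¹ * N ^ t⁻¹) := by
    rw [h1]
    refine h.trans (le_of_eq (by ring))
  have h3 : Z ^ r⁻¹ ≠ 0 := by simp [h0, hZ]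
  have h4 : Z ^ r⁻¹ ≠ ∞ := ENNReal.rpow_ne_top_of_nonneg (inv_nonneg.2 hr.le) hZ
  have h5 := (ENNReal.mul_le_mul_iff_right h3 h4).1 h2
  rwa [ENNReal.rpow_inv_le_iff ht, ENNReal.mul_rpow_of_nonneg _ _ ht.le, ENNReal.rpow_inv_rpow ht.ne']
    at h5

theorem enorm_sq_rpow (a : ℝ) (p : ℝ) : (‖a‖ₑ ^ 2) ^ (p / 2) = ‖a‖ₑ ^ p := by
  rw [← ENNReal.rpow_natCast, ← ENNReal.rpow_mul]
  congr 1
  push_cast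
  ring

namespace AtomicFiltration

universe u

theorem lintegral_enorm_sq_ne_top {X : Type*} [MeasurableSpace X] {ν : Measure X} {p : ℝ}
    (hp : 2 < p) {f : X → ℝ} (hf : MemLp f (ENNReal.ofReal p) ν) {J : Set X} (hJ : ν J ≠ ∞) :
    ∫⁻ x in J, ‖f x‖ₑ ^ 2 ∂ν ≠ ∞ := by
  refine setLIntegral_ne_top (s := p / 2) (by linarith) ?_ hJ
  have h1 := hf.2
  have h2 : ∫⁻ x, (‖f x‖ₑ ^ 2) ^ (p / 2) ∂ν = eLpNorm f (ENNReal.ofReal p) ν ^ p := by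
    rw [eLpNorm_ofReal_rpow (by linarith)]
    exact lintegral_congr fun x => enorm_sq_rpow (f x) p
  rw [h2]
  exact ENNReal.rpow_ne_top_of_nonneg (by linarith) h1.ne

/-- With `S` the tested sum, `Z = ∫ S^t dμ` and `φ = S^(t-1)`, one has `Z = ∑ ⟨φ⟩_I ∫_I |b_I|² dν`.
The averages of `φ` are dominated by squares of averages of one function `f`, so `Z` is at most the
integral over `J` of the squared square function of the paraproduct of `f`. Hölder and the bound `∫
|f|^p dμ ≤ M Z` allow `Z` to be absorbed. -/
theorem exists_adjoint_finset {p : ℝ} (hp : 2 < p) : ∃ κ : ℝ≥0, 0 < κ ∧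
    ∀ {X : Type u} [MeasurableSpace X] {𝓕 : AtomicFiltration X} {μ ν : Measure X}
      {b : Set X → X → ℝ}, 𝓕.IsMartDiffFamily ν b → 𝓕.LocallyFinite μ → 𝓕.LocallyFinite ν →
      (∀ I ∈ 𝓕.intervals, μ I = 0 → b I =ᵐ[ν] 0) →
      ∀ {A : ℝ≥0}, 𝓕.ParaproductBound p μ ν b A → ∀ J ∈ 𝓕.intervals,
      ∀ F : Finset (Set X), (∀ I ∈ F, I ∈ 𝓕.intervals ∧ I ⊆ J) →
        ∫⁻ x, (∑ I ∈ F, I.indicator (fun _ => (∫⁻ y in I, ‖b I y‖ₑ ^ 2 ∂ν) / μ I) x)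
          ^ (p / 2).conjExponent ∂μ ≤ ((κ * A ^ 2 : ℝ≥0) : ℝ≥0∞) ^ (p / 2).conjExponent * ν J := by
  obtain ⟨C, hC, h⟩ := exists_square_le_of_paraproductBound.{u} hp
  obtain ⟨C₁, -, h₁⟩ := exists_localized_square_le_of_paraproductBound.{u} hp
  have hp0 : 0 < p := by linarith
  have hr1 : 1 < p / 2 := by linarith
  obtain ⟨M, hM, hMax⟩ := exists_maximal.{u} hr1
  have hrt := Real.HolderConjugate.conjExponent hr1
  set r := p / 2 with hr
  set t := r.conjExponent with ht
  have hr0 := hrt.pos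
  have ht0 := hrt.symm.pos
  have ht1 : 1 < t := hrt.symm.lt
  have htr : (t - 1) * r = t := by
    have := hrt.symm.sub_one_mul_conj
    linarith
  refine ⟨(C * M) ^ r⁻¹, NNReal.rpow_pos (by positivity), ?_⟩
  intro X _ 𝓕 μ ν b hb hμ hν hbμ A hA J hJ F hF
  have hLp : ∀ I ∈ 𝓕.intervals, MemLp (b I) (ENNReal.ofReal p) ν := fun I hI =>
    (h₁ hb hμ hν hbμ hA I hI).1
  set c : Set X → ℝ≥0∞ := fun I => ∫⁻ y in I, ‖b I y‖ₑ ^ 2 ∂ν with hc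
  have hcfin : ∀ I ∈ F, c I ≠ ∞ := fun I hI =>
    lintegral_enorm_sq_ne_top hp (hLp I (hF I hI).1) (hν I (hF I hI).1).ne
  have hc0 : ∀ I ∈ F, μ I = 0 → c I = 0 := by
    intro I hI h0
    have h1 : ∫⁻ y in I, ‖b I y‖ₑ ^ 2 ∂ν = ∫⁻ y in I, 0 ∂ν := by
      refine lintegral_congr_ae (ae_restrict_of_ae ?_)
      filter_upwards [hbμ I (hF I hI).1 h0] with x hx
      simp [hx]
    simpa using h1
  set S : X → ℝ≥0∞ := fun x => ∑ I ∈ F, I.indicator (fun _ => c I / μ I) x with hS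
  have hwm : ∀ I ∈ F, Measurable (I.indicator fun _ => c I / μ I) := fun I hI =>
    measurable_const.indicator (𝓕.interval_measurable (hF I hI).1)
  have hSm : Measurable S := Finset.measurable_fun_sum F hwm
  set Z := ∫⁻ x, S x ^ t ∂μ with hZ
  have hZfin : Z ≠ ∞ := by
    refine lintegral_rpow_finset_sum_ne_top ht1.le hwm fun I hI => ?_
    have e : ∀ x, I.indicator (fun _ => c I / μ I) x ^ t =
        I.indicator (fun _ => (c I / μ I) ^ t) x := fun x => by
      by_cases hx : x ∈ I <;> simp [hx, ht0]
    rw [lintegral_congr e, lintegral_indicator_const (𝓕.interval_measurable (hF I hI).1)]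
    refine ENNReal.mul_ne_top (ENNReal.rpow_ne_top_of_nonneg ht0.le ?_) (hμ I (hF I hI).1).ne
    by_cases h0 : μ I = 0
    · simp [hc0 I hI h0]
    · exact ENNReal.div_ne_top (hcfin I hI) h0
  set φ : X → ℝ≥0∞ := fun x => S x ^ (t - 1) with hφ
  have hφm : Measurable φ := hSm.pow_const _
  have hφr : ∫⁻ x, φ x ^ r ∂μ = Z := by
    refine lintegral_congr fun x => ?_
    simp only [hφ]
    rw [← ENNReal.rpow_mul, htr]
  have hMφ : ∫⁻ x, 𝓕.maximalFn μ φ x ^ r ∂μ ≤ M * Z := by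
    rw [← hφr]
    exact hMax hμ hφm
  have hMm := 𝓕.measurable_maximalFn μ φ
  have hMfin : ∀ᵐ x ∂μ, 𝓕.maximalFn μ φ x ≠ ∞ := by
    filter_upwards [ae_lt_top (hMm.pow_const r)
      (ne_top_of_le_ne_top (ENNReal.mul_ne_top ENNReal.coe_ne_top hZfin) hMφ)] with x hx hx'
    simp [hx', hr0] at hx
  -- On `I` the maximal function is at least the average of `φ`, so the square of the average of `f`
  -- dominates that average; `φ^(1/2)` itself would give the opposite inequality.
  set f : X → ℝ := fun x => (𝓕.maximalFn μ φ x ^ (1 / 2 : ℝ)).toReal with hf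
  have hf_of : ∀ᵐ x ∂μ, ENNReal.ofReal (f x) = 𝓕.maximalFn μ φ x ^ (1 / 2 : ℝ) := by
    filter_upwards [hMfin] with x hx
    exact ENNReal.ofReal_toReal (ENNReal.rpow_ne_top_of_nonneg (by norm_num) hx)
  have hfm : Measurable f := (hMm.pow_const _).ennreal_toReal
  have hf_norm : ∫⁻ x, ‖f x‖ₑ ^ p ∂μ ≤ M * Z := by
    refine le_trans (le_of_eq (lintegral_congr_ae ?_)) hMφ
    filter_upwards [hf_of] with x hx
    rw [Real.enorm_of_nonneg ENNReal.toReal_nonneg, hx, ← ENNReal.rpow_mul]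
    congr 1
    rw [hr]
    ring
  have hfLp : MemLp f (ENNReal.ofReal p) μ := by
    refine ⟨hfm.aestronglyMeasurable, ?_⟩
    rw [← eLpNorm_ofReal_rpow hp0] at hf_norm
    have := ne_top_of_le_ne_top (ENNReal.mul_ne_top ENNReal.coe_ne_top hZfin) hf_norm
    rw [lt_top_iff_ne_top]
    intro htop
    simp [htop, hp0] at this
  have hfint : ∀ I ∈ F, IntegrableOn f I μ := by
    intro I hI
    have : IsFiniteMeasure (μ.restrict I) := ⟨by simpa using hμ I (hF I hI).1⟩
    exact (hfLp.restrict I).integrable (by simpa using (by linarith : 1 ≤ p))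
  have havg : ∀ I ∈ F, μ I ≠ 0 → ⨍⁻ y in I, φ y ∂μ ≤ ‖⨍ y in I, f y ∂μ‖ₑ ^ 2 := by
    intro I hI h0
    have h1 : (⨍⁻ y in I, φ y ∂μ) ^ (1 / 2 : ℝ) ≤ ‖⨍ y in I, f y ∂μ‖ₑ := by
      refine le_enorm_setAverage (𝓕.interval_measurable (hF I hI).1) h0 (hμ I (hF I hI).1).ne
        (hfint I hI) (fun x => ENNReal.toReal_nonneg) ?_
      filter_upwards [hf_of] with x hx hxI
      rw [hx]
      exact ENNReal.rpow_le_rpow (𝓕.setLAverage_le_maximalFn μ φ (hF I hI).1 hxI) (by norm_num)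
    calc ⨍⁻ y in I, φ y ∂μ = ((⨍⁻ y in I, φ y ∂μ) ^ (1 / 2 : ℝ)) ^ 2 := by
          rw [← ENNReal.rpow_natCast, ← ENNReal.rpow_mul]
          norm_num
      _ ≤ _ := by gcongr
  have hZle : Z ≤ ∫⁻ x in J, ∑ I ∈ F, ‖(⨍ y in I, f y ∂μ) * b I x‖ₑ ^ 2 ∂ν := by
    have h1 : Z = ∑ I ∈ F, c I / μ I * ∫⁻ x in I, φ x ∂μ := by
      have e : ∀ x, S x ^ t = ∑ I ∈ F, I.indicator (fun _ => c I / μ I) x * φ x := by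
        intro x
        rw [← Finset.sum_mul]
        change S x ^ t = S x * S x ^ (t - 1)
        nth_rewrite 2 [← ENNReal.rpow_one (S x)]
        rw [← ENNReal.rpow_add_of_nonneg _ _ zero_le_one (by linarith)]
        congr 1
        ring
      rw [hZ, lintegral_congr e,
        lintegral_finsetSum (f := fun I x => I.indicator (fun _ => c I / μ I) x * φ x) _
          fun I hI => (hwm I hI).mul hφm]
      refine Finset.sum_congr rfl fun I hI => ?_
      have hIm := 𝓕.interval_measurable (hF I hI).1
      rw [← lintegral_const_mul _ hφm, ← lintegral_indicator hIm]
      refine lintegral_congr fun x => ?_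
      by_cases hx : x ∈ I <;> simp [hx]
    rw [h1, lintegral_finsetSum _ fun I hI =>
      ((hb.measurable (hF I hI).1).const_mul _).enorm.pow_const 2]
    refine Finset.sum_le_sum fun I hI => ?_
    by_cases h0 : μ I = 0
    · simp [hc0 I hI h0]
    calc c I / μ I * ∫⁻ x in I, φ x ∂μ = (⨍⁻ y in I, φ y ∂μ) * c I := by
          rw [setLAverage_eq, ENNReal.div_eq_inv_mul, ENNReal.div_eq_inv_mul]
          ring
      _ ≤ ‖⨍ y in I, f y ∂μ‖ₑ ^ 2 * c I := by gcongr; exact havg I hI h0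
      _ = ∫⁻ x in I, ‖(⨍ y in I, f y ∂μ) * b I x‖ₑ ^ 2 ∂ν := by
          rw [hc, ← lintegral_const_mul _ ((hb.measurable (hF I hI).1).enorm.pow_const 2)]
          refine lintegral_congr fun x => ?_
          rw [enorm_mul, mul_pow]
      _ ≤ _ := lintegral_mono_set (hF I hI).2
  have hum : Measurable fun x => ∑ I ∈ F, ‖(⨍ y in I, f y ∂μ) * b I x‖ₑ ^ 2 :=
    Finset.measurable_fun_sum F fun I hI =>
      ((hb.measurable (hF I hI).1).const_mul _).enorm.pow_const 2
  have hsq := (h hb hν hA hfLp).2 F fun I hI => (hF I hI).1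
  have hmain : Z ≤ ((C * M * A ^ p : ℝ≥0∞) * Z) ^ r⁻¹ * ν J ^ t⁻¹ := by
    refine (hZle.trans (setLIntegral_le_rpow_mul_rpow hrt hum J)).trans ?_
    gcongr
    refine hsq.trans ?_
    calc (C : ℝ≥0∞) * (A ^ p * ∫⁻ x, ‖f x‖ₑ ^ p ∂μ) ≤ C * (A ^ p * (M * Z)) := by gcongr
      _ = _ := by ring
  refine (ENNReal.le_rpow_mul_of_le_rpow_mul_rpow hrt hZfin hmain).trans (le_of_eq ?_)
  congr 2
  rw [ENNReal.mul_rpow_of_nonneg _ _ (inv_nonneg.2 hr0.le), ← ENNReal.rpow_mul, hr]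
  have e2 : p * (p / 2)⁻¹ = 2 := by field_simp
  rw [e2]
  push_cast
  rw [ENNReal.coe_rpow_of_nonneg _ (by positivity)]
  push_cast
  norm_num

theorem exists_adjointTesting {p : ℝ} (hp : 2 < p) : ∃ κ : ℝ≥0, 0 < κ ∧
    ∀ {X : Type u} [MeasurableSpace X] {𝓕 : AtomicFiltration X} {μ ν : Measure X}
      {b : Set X → X → ℝ}, 𝓕.IsMartDiffFamily ν b → 𝓕.LocallyFinite μ → 𝓕.LocallyFinite ν →
      (∀ I ∈ 𝓕.intervals, μ I = 0 → b I =ᵐ[ν] 0) →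
      ∀ {A : ℝ≥0}, 𝓕.ParaproductBound p μ ν b A → 𝓕.AdjointTesting p μ ν b (κ * A ^ 2) := by
  obtain ⟨κ, hκ, h⟩ := exists_adjoint_finset.{u} hp
  refine ⟨κ, hκ, ?_⟩
  intro X _ 𝓕 μ ν b hb hμ hν hbμ A hA J hJ
  have hct : Countable {I : Set X // I ∈ 𝓕.intervals ∧ I ⊆ J} :=
    (𝓕.intervals_countable.mono fun I hI => hI.1 :
      {I : Set X | I ∈ 𝓕.intervals ∧ I ⊆ J}.Countable).to_subtype
  have ht0 : 0 < (p / 2).conjExponent :=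
    (Real.HolderConjugate.conjExponent (by linarith : 1 < p / 2)).symm.pos
  refine lintegral_tsum_rpow_le (fun I => ?_) ht0 fun F => ?_
  · exact (measurable_const.indicator (𝓕.interval_measurable I.2.1)).const_mul _
  · refine (setLIntegral_le_lintegral _ _).trans ?_
    have h1 := h hb hμ hν hbμ hA J hJ (F.map (Function.Embedding.subtype _))
      (by
        intro I hI
        obtain ⟨i, -, rfl⟩ := Finset.mem_map.1 hI
        exact i.2)
    refine le_trans (le_of_eq (lintegral_congr fun x => ?_)) h1
    congr 1
    rw [Finset.sum_map]
    refine Finset.sum_congr rfl fun I _ => ?_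
    by_cases hx : x ∈ (I : Set X)
    · simp only [Set.indicator_of_mem hx, Function.Embedding.subtype_apply]
      rw [← measure_mul_setLAverage _ (hν I I.2.1).ne, ENNReal.div_eq_inv_mul,
        ENNReal.div_eq_inv_mul, mul_assoc]
    · simp [hx]

end AtomicFiltration

/-! ### Sufficiency of the testing conditions. -/

theorem enorm_setAverage_sq_le {X : Type*} [MeasurableSpace X] {μ : Measure X} {f : X → ℝ}
    (hf : Measurable f) (I : Set X) :
    ‖⨍ x in I, f x ∂μ‖ₑ ^ 2 ≤ ⨍⁻ x in I, ‖f x‖ₑ ^ 2 ∂μ := by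
  -- The normalized measure may degenerate when `μ I` is zero or infinite; total mass at most one is
  -- enough for Cauchy–Schwarz.
  set m : Measure X := ((μ.restrict I) Set.univ)⁻¹ • μ.restrict I with hm
  have hm1 : m Set.univ ≤ 1 := by
    simp only [hm, Measure.smul_apply, smul_eq_mul]
    exact ENNReal.inv_mul_le_one _
  have h1 : ‖⨍ x in I, f x ∂μ‖ₑ ≤ ∫⁻ x, ‖f x‖ₑ ∂m := enorm_integral_le_lintegral_enorm f
  have h2 := setLIntegral_le_rpow_mul_rpow (ν := m) Real.HolderConjugate.two_two
    (u := fun x => ‖f x‖ₑ) hf.enorm Set.univ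
  rw [setLIntegral_univ] at h2
  have h3 : ∫⁻ x, ‖f x‖ₑ ∂m ≤ (∫⁻ x, ‖f x‖ₑ ^ (2 : ℝ) ∂m) ^ (2 : ℝ)⁻¹ := by
    refine h2.trans ?_
    calc _ ≤ (∫⁻ x, ‖f x‖ₑ ^ (2 : ℝ) ∂m) ^ (2 : ℝ)⁻¹ * 1 ^ (2 : ℝ)⁻¹ := by gcongr
      _ = _ := by simp
  calc ‖⨍ x in I, f x ∂μ‖ₑ ^ 2 ≤ ((∫⁻ x, ‖f x‖ₑ ^ (2 : ℝ) ∂m) ^ (2 : ℝ)⁻¹) ^ 2 := by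
        gcongr
        exact h1.trans h3
    _ = ∫⁻ x, ‖f x‖ₑ ^ (2 : ℝ) ∂m := by
        rw [← ENNReal.rpow_natCast, ← ENNReal.rpow_mul]
        norm_num
    _ = ⨍⁻ x in I, ‖f x‖ₑ ^ 2 ∂μ := by
        simp only [ENNReal.rpow_ofNat]
        rfl

namespace AtomicFiltration

universe u

/-- The partial sums vanish off `J`, hence so does their limit almost everywhere. Testing over `J`
thus controls the whole norm of `g`, as Burkholder requires. -/
theorem IsMartDiffFamily.setLIntegral_eq_of_isLpSum {X : Type*} [MeasurableSpace X]
    {𝓕 : AtomicFiltration X} {ν : Measure X} {b : Set X → X → ℝ} (hb : 𝓕.IsMartDiffFamily ν b)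
    {p : ℝ} (hp : 0 < p) {J : Set X} (hJ : J ∈ 𝓕.intervals) {g : X → ℝ}
    (hg : IsLpSum p ν (fun I : {I : Set X // I ∈ 𝓕.intervals ∧ I ⊆ J} => b I) g) :
    ∫⁻ x in J, ‖g x‖ₑ ^ p ∂ν = ∫⁻ x, ‖g x‖ₑ ^ p ∂ν := by
  have hJm := 𝓕.interval_measurable hJ
  have h1 : eLpNorm g (ENNReal.ofReal p) (ν.restrict Jᶜ) ≤ 0 := by
    refine ge_of_tendsto hg.2 (Eventually.of_forall fun F => ?_)
    have h2 : eLpNorm g (ENNReal.ofReal p) (ν.restrict Jᶜ) =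
        eLpNorm (fun x => ∑ I ∈ F, b I x - g x) (ENNReal.ofReal p) (ν.restrict Jᶜ) := by
      rw [← eLpNorm_neg]
      refine eLpNorm_congr_ae ?_
      filter_upwards [ae_restrict_mem hJm.compl] with x hx
      rw [Finset.sum_eq_zero fun (I : {I : Set X // I ∈ 𝓕.intervals ∧ I ⊆ J}) _ =>
        hb.eq_zero I.2.1 fun hxI => hx (I.2.2 hxI)]
      simp
    rw [h2]
    exact eLpNorm_mono_measure _ Measure.restrict_le_self
  have h3 : ∫⁻ x in Jᶜ, ‖g x‖ₑ ^ p ∂ν = 0 := by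
    rw [← eLpNorm_ofReal_rpow hp, nonpos_iff_eq_zero.1 h1, ENNReal.zero_rpow_of_pos hp]
  rw [← lintegral_add_compl (μ := ν) (fun x => ‖g x‖ₑ ^ p) hJm, h3, add_zero]

/-- The direct testing condition bounds the localized square functions. -/
theorem exists_square_le_of_directTesting {p : ℝ} (hp : 2 < p) : ∃ C : ℝ≥0, 0 < C ∧
    ∀ {X : Type u} [MeasurableSpace X] {𝓕 : AtomicFiltration X} {μ ν : Measure X}
      {b : Set X → X → ℝ}, 𝓕.IsMartDiffFamily ν b → 𝓕.LocallyFinite ν →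
      ∀ {B : ℝ≥0}, 𝓕.DirectTesting p μ ν b B → ∀ J ∈ 𝓕.intervals,
      MemLp (b J) (ENNReal.ofReal p) ν ∧
      ∀ F : Finset (Set X), (∀ I ∈ F, I ∈ 𝓕.intervals ∧ I ⊆ J) →
        ∫⁻ x, (∑ I ∈ F, ‖b I x‖ₑ ^ 2) ^ (p / 2) ∂ν ≤ C * (B ^ p * μ J) := by
  classical
  obtain ⟨C, hC, h⟩ := exists_square_le_of_isLpSum.{u} hp
  refine ⟨C, hC, ?_⟩
  intro X _ 𝓕 μ ν b hb hν B hB J hJ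
  have hp0 : 0 < p := by linarith
  obtain ⟨g, hg, hgB⟩ := hB J hJ
  refine ⟨hb.memLp_of_isLpSum hν (Function.Embedding.subtype _) (fun i => i.2.1) hg
    ⟨J, hJ, subset_rfl⟩, fun F hF => ?_⟩
  have h1 := h hb hν (Function.Embedding.subtype _) (fun i => i.2.1) hg
    (F.subtype fun I => I ∈ 𝓕.intervals ∧ I ⊆ J)
  rw [hb.setLIntegral_eq_of_isLpSum hp0 hJ hg] at hgB
  refine le_trans (le_of_eq (lintegral_congr fun x => ?_)) (h1.trans (mul_le_mul_right hgB _))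
  congr 1
  exact (Finset.sum_subtype_of_mem (fun I => ‖b I x‖ₑ ^ 2) hF).symm

/-- A single `D` normalizes both conditions: `D^(p/2) ≥ K` serves the direct one, `D ≥ B` the
adjoint one. -/
theorem isTested_of_testing {X : Type*} [MeasurableSpace X]
    {𝓕 : AtomicFiltration X} {μ ν : Measure X} {b : Set X → X → ℝ} (hb : 𝓕.IsMartDiffFamily ν b)
    (hν : 𝓕.LocallyFinite ν) {p : ℝ} (hp : 2 < p) {B D : ℝ≥0} (hD : 0 < D)
    {K : ℝ≥0∞} (hK : K ≤ (D : ℝ≥0∞) ^ (p / 2)) (hBD : B ≤ D)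
    (hdir : ∀ J ∈ 𝓕.intervals, ∀ F : Finset (Set X), (∀ I ∈ F, I ∈ 𝓕.intervals ∧ I ⊆ J) →
        ∫⁻ x, (∑ I ∈ F, ‖b I x‖ₑ ^ 2) ^ (p / 2) ∂ν ≤ K * μ J)
    (hadj : 𝓕.AdjointTesting p μ ν b B) {G : Finset (Set X)} (hG : ∀ I ∈ G, I ∈ 𝓕.intervals) :
    𝓕.IsTested (p / 2) (p / 2).conjExponent μ ν G fun I x => (D : ℝ≥0∞)⁻¹ * ‖b I x‖ₑ ^ 2 where
  mem_intervals := hG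
  eq_zero I hI x hx := by simp [hb.eq_zero (hG I hI) hx]
  const_on_children I hI K hK x hx y hy := by
    rw [hb.const_on_children I (hG I hI) K hK x hx y hy]
  direct J hJ := by
    classical
    have hr0 : 0 < p / 2 := by linarith
    have hD0 : (D : ℝ≥0∞) ≠ 0 := by simpa using hD.ne'
    have h1 := hdir J (hG J hJ) (G.filter (· ⊆ J)) fun I hI =>
      ⟨hG I (Finset.mem_filter.1 hI).1, (Finset.mem_filter.1 hI).2⟩
    refine (setLIntegral_le_lintegral _ _).trans ?_
    simp_rw [← Finset.mul_sum, ENNReal.mul_rpow_of_nonneg _ _ hr0.le]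
    rw [lintegral_const_mul']
    · calc _ ≤ (D : ℝ≥0∞)⁻¹ ^ (p / 2) * (D ^ (p / 2) * μ J) := by
            gcongr
            refine le_trans (le_of_eq ?_) (h1.trans (mul_le_mul_left hK _))
            congr!
        _ = μ J := by
            rw [← mul_assoc, ← ENNReal.mul_rpow_of_nonneg _ _ hr0.le,
              ENNReal.inv_mul_cancel hD0 ENNReal.coe_ne_top, ENNReal.one_rpow, one_mul]
    · exact ENNReal.rpow_ne_top_of_nonneg hr0.le (ENNReal.inv_ne_top.2 hD0)
  adjoint J hJ := by
    classical
    have ht0 : 0 < (p / 2).conjExponent :=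
      (Real.HolderConjugate.conjExponent (by linarith : 1 < p / 2)).symm.pos
    have hD0 : (D : ℝ≥0∞) ≠ 0 := by simpa using hD.ne'
    have h1 := hadj J (hG J hJ)
    set S : X → ℝ≥0∞ := fun x => ∑' I : {I : Set X // I ∈ 𝓕.intervals ∧ I ⊆ J},
        ν I / μ I * (I : Set X).indicator (fun _ => ⨍⁻ y in (I : Set X), ‖b I y‖ₑ ^ 2 ∂ν) x with hS
    have h2 : ∀ x, (∑ I ∈ G with I ⊆ J, I.indicator
        (fun _ => (∫⁻ y, (D : ℝ≥0∞)⁻¹ * ‖b I y‖ₑ ^ 2 ∂ν) / μ I) x) ≤ (D : ℝ≥0∞)⁻¹ * S x := by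
      intro x
      have hGJ : ∀ I ∈ G.filter (· ⊆ J), I ∈ 𝓕.intervals ∧ I ⊆ J := fun I hI =>
        ⟨hG I (Finset.mem_filter.1 hI).1, (Finset.mem_filter.1 hI).2⟩
      rw [← Finset.sum_subtype_of_mem _ hGJ, hS, ← ENNReal.tsum_mul_left]
      refine le_trans (Finset.sum_le_sum fun I _ => ?_) (ENNReal.sum_le_tsum
        ((G.filter (· ⊆ J)).subtype fun I => I ∈ 𝓕.intervals ∧ I ⊆ J))
      by_cases hx : x ∈ (I : Set X)
      · simp only [Set.indicator_of_mem hx]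
        rw [lintegral_const_mul _ ((hb.measurable I.2.1).enorm.pow_const 2),
          ENNReal.div_eq_inv_mul, ENNReal.div_eq_inv_mul, mul_assoc (μ I)⁻¹,
          measure_mul_setLAverage _ (hν I I.2.1).ne, ← lintegral_indicator
            (𝓕.interval_measurable I.2.1)]
        refine le_of_eq ?_
        rw [mul_left_comm]
        congr 2
        refine lintegral_congr fun y => ?_
        by_cases hy : y ∈ (I : Set X)
        · simp [hy]
        · simp [hy, hb.eq_zero I.2.1 hy]
      · simp [hx]
    calc _ ≤ ∫⁻ x in J, ((D : ℝ≥0∞)⁻¹ * S x) ^ (p / 2).conjExponent ∂μ := by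
          refine lintegral_mono fun x => ENNReal.rpow_le_rpow ?_ ht0.le
          refine le_trans (le_of_eq ?_) (h2 x)
          congr!
      _ = (D : ℝ≥0∞)⁻¹ ^ (p / 2).conjExponent *
            ∫⁻ x in J, S x ^ (p / 2).conjExponent ∂μ := by
          simp_rw [ENNReal.mul_rpow_of_nonneg _ _ ht0.le]
          rw [lintegral_const_mul']
          exact ENNReal.rpow_ne_top_of_nonneg ht0.le (ENNReal.inv_ne_top.2 hD0)
      _ ≤ (D : ℝ≥0∞)⁻¹ ^ (p / 2).conjExponent * ((D : ℝ≥0∞) ^ (p / 2).conjExponent * ν J) := by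
          gcongr
          refine h1.trans ?_
          gcongr
      _ = ν J := by
          rw [← mul_assoc, ← ENNReal.mul_rpow_of_nonneg _ _ ht0.le,
            ENNReal.inv_mul_cancel hD0 ENNReal.coe_ne_top, ENNReal.one_rpow, one_mul]

/-- The positive operator bound is applied to `F = |f|²` and Burkholder returns to the paraproduct.
The adjoint constant is quadratic in `b`, hence the common scale `q` for the direct and `q ^ 2` for
the adjoint condition. -/
theorem exists_paraproductBound {p : ℝ} (hp : 2 < p) : ∃ κ : ℝ≥0, 0 < κ ∧
    ∀ {X : Type u} [MeasurableSpace X] {𝓕 : AtomicFiltration X} {μ ν : Measure X}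
      {b : Set X → X → ℝ}, 𝓕.IsMartDiffFamily ν b → 𝓕.LocallyFinite μ → 𝓕.LocallyFinite ν →
      ∀ {q : ℝ≥0}, 0 < q → 𝓕.DirectTesting p μ ν b q → 𝓕.AdjointTesting p μ ν b (q ^ 2) →
      𝓕.ParaproductBound p μ ν b (κ * q) := by
  have hp0 : 0 < p := by linarith
  have hr1 : 1 < p / 2 := by linarith
  have hr0 : 0 < p / 2 := by linarith
  obtain ⟨C, hC, hdir⟩ := exists_square_le_of_directTesting.{u} hp
  obtain ⟨C', hC', hsum⟩ := exists_isLpSum.{u} hp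
  obtain ⟨M, hM, hop⟩ := IsTested.exists_operator_bound.{u}
    (Real.HolderConjugate.conjExponent hr1)
  lift M to ℝ≥0 using hM
  -- Chosen so that `E^(p/2) ≥ C` and `E ≥ 1`, which makes `D = E q²` large enough for both
  -- conditions.
  set E : ℝ≥0 := C ^ (p / 2)⁻¹ + 1 with hE
  refine ⟨(C' * (E ^ (p / 2) * (M + 1))) ^ p⁻¹, NNReal.rpow_pos (by positivity), ?_⟩
  intro X _ 𝓕 μ ν b hb hμ hν q hq hdq haq f hf
  set D : ℝ≥0 := E * q ^ 2 with hD
  have hD0 : 0 < D := by positivity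
  have hD0' : (D : ℝ≥0∞) ≠ 0 := by simpa using hD0.ne'
  have hqp : ((q : ℝ≥0∞) ^ 2) ^ (p / 2) = (q : ℝ≥0∞) ^ p := by
    rw [← ENNReal.rpow_natCast, ← ENNReal.rpow_mul]
    congr 1
    push_cast
    ring
  have hDr : (D : ℝ≥0∞) ^ (p / 2) = (E : ℝ≥0∞) ^ (p / 2) * q ^ p := by
    rw [hD]
    push_cast
    rw [ENNReal.mul_rpow_of_nonneg _ _ hr0.le, hqp]
  have hCE : (C : ℝ≥0∞) ≤ (E : ℝ≥0∞) ^ (p / 2) := by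
    rw [← ENNReal.rpow_inv_le_iff hr0, ← ENNReal.coe_rpow_of_nonneg _ (inv_nonneg.2 hr0.le)]
    exact_mod_cast (le_self_add : C ^ (p / 2)⁻¹ ≤ C ^ (p / 2)⁻¹ + 1)
  have hT : ∀ G : Finset (Set X), (∀ I ∈ G, I ∈ 𝓕.intervals) →
      𝓕.IsTested (p / 2) (p / 2).conjExponent μ ν G fun I x => (D : ℝ≥0∞)⁻¹ * ‖b I x‖ₑ ^ 2 := by
    intro G hG
    refine isTested_of_testing hb hν hp (B := q ^ 2) (K := C * q ^ p) hD0 ?_ ?_ ?_ haq hG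
    · rw [hDr]
      gcongr
    · rw [hD]
      exact le_mul_of_one_le_left (by positivity) le_add_self
    · intro J hJ F hF
      rw [mul_assoc]
      exact (hdir hb hν hdq J hJ).2 F hF
  have hLp : ∀ I ∈ 𝓕.intervals, MemLp (b I) (ENNReal.ofReal p) ν := fun I hI =>
    (hdir hb hν hdq I hI).1
  have hf'm := hf.1.stronglyMeasurable_mk.measurable
  set f' := hf.1.mk f with hf'
  have hff' : f =ᵐ[μ] f' := hf.1.ae_eq_mk
  have havg : ∀ I, ⨍ y in I, f y ∂μ = ⨍ y in I, f' y ∂μ := fun I =>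
    average_congr (ae_restrict_of_ae hff')
  have hfr : ∫⁻ x, (‖f' x‖ₑ ^ 2) ^ (p / 2) ∂μ = ∫⁻ x, ‖f x‖ₑ ^ p ∂μ := by
    refine lintegral_congr_ae ?_
    filter_upwards [hff'] with x hx
    rw [enorm_sq_rpow, hx]
  have hffin : ∫⁻ x, ‖f x‖ₑ ^ p ∂μ ≠ ∞ := by
    rw [← eLpNorm_ofReal_rpow hp0]
    exact ENNReal.rpow_ne_top_of_nonneg hp0.le hf.2.ne
  have hb' := hb.const_mul fun I => ⨍ y in I, f y ∂μ
  have hct : Countable 𝓕.intervals := 𝓕.intervals_countable.to_subtype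
  have hsq : ∀ G : Finset (Set X), (∀ I ∈ G, I ∈ 𝓕.intervals) →
      ∫⁻ x, (∑ I ∈ G, ‖(⨍ y in I, f y ∂μ) * b I x‖ₑ ^ 2) ^ (p / 2) ∂ν ≤
        D ^ (p / 2) * (M * ∫⁻ x, ‖f x‖ₑ ^ p ∂μ) := by
    intro G hG
    have h1 := hop (hT G hG) hμ hν (fun I hI => by
      simp_rw [ENNReal.mul_rpow_of_nonneg _ _ hr0.le, enorm_sq_rpow]
      rw [lintegral_const_mul', ← eLpNorm_ofReal_rpow hp0]
      · exact ENNReal.mul_ne_top (ENNReal.rpow_ne_top_of_nonneg hr0.le (ENNReal.inv_ne_top.2 hD0'))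
          (ENNReal.rpow_ne_top_of_nonneg hp0.le (hLp I (hG I hI)).2.ne)
      · exact ENNReal.rpow_ne_top_of_nonneg hr0.le (ENNReal.inv_ne_top.2 hD0'))
      (F := fun x => ‖f' x‖ₑ ^ 2) (hf'm.enorm.pow_const 2) (by rwa [hfr])
    rw [hfr] at h1
    calc _ ≤ ∫⁻ x, (D : ℝ≥0∞) ^ (p / 2) * (∑ I ∈ G, (⨍⁻ y in I, ‖f' y‖ₑ ^ 2 ∂μ) *
          ((D : ℝ≥0∞)⁻¹ * ‖b I x‖ₑ ^ 2)) ^ (p / 2) ∂ν := by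
          refine lintegral_mono fun x => ?_
          rw [← ENNReal.mul_rpow_of_nonneg _ _ hr0.le, Finset.mul_sum]
          refine ENNReal.rpow_le_rpow (Finset.sum_le_sum fun I _ => ?_) hr0.le
          rw [enorm_mul, mul_pow, havg I]
          calc _ ≤ (⨍⁻ y in I, ‖f' y‖ₑ ^ 2 ∂μ) * ‖b I x‖ₑ ^ 2 := by
                gcongr
                exact enorm_setAverage_sq_le hf'm I
            _ = (D * (D : ℝ≥0∞)⁻¹) * ((⨍⁻ y in I, ‖f' y‖ₑ ^ 2 ∂μ) * ‖b I x‖ₑ ^ 2) := by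
                rw [ENNReal.mul_inv_cancel hD0' ENNReal.coe_ne_top, one_mul]
            _ = _ := by ring
      _ = (D : ℝ≥0∞) ^ (p / 2) * ∫⁻ x, (∑ I ∈ G, (⨍⁻ y in I, ‖f' y‖ₑ ^ 2 ∂μ) *
          ((D : ℝ≥0∞)⁻¹ * ‖b I x‖ₑ ^ 2)) ^ (p / 2) ∂ν :=
          lintegral_const_mul' _ _ (ENNReal.rpow_ne_top_of_nonneg hr0.le ENNReal.coe_ne_top)
      _ ≤ _ := by gcongr
  obtain ⟨g, hg, hgK⟩ := hsum hb' (ι := 𝓕.intervals) (Function.Embedding.subtype _) (fun i => i.2)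
    (fun i => (hLp i i.2).const_mul _) (K := D ^ (p / 2) * (M * ∫⁻ x, ‖f x‖ₑ ^ p ∂μ))
    (ENNReal.mul_ne_top (ENNReal.rpow_ne_top_of_nonneg hr0.le ENNReal.coe_ne_top)
      (ENNReal.mul_ne_top ENNReal.coe_ne_top hffin))
    (fun F => by
      have h1 := hsq (F.map (Function.Embedding.subtype _)) (by
        intro I hI
        obtain ⟨i, -, rfl⟩ := Finset.mem_map.1 hI
        exact i.2)
      simpa [Finset.sum_map] using h1)
  refine ⟨g, hb.isParaproduct_iff.2 hg, ?_⟩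
  rw [← ENNReal.rpow_le_rpow_iff hp0, ENNReal.mul_rpow_of_nonneg _ _ hp0.le,
    eLpNorm_ofReal_rpow hp0, eLpNorm_ofReal_rpow hp0]
  refine hgK.trans ?_
  rw [hDr, ← ENNReal.coe_rpow_of_nonneg (_ * q) hp0.le,
    NNReal.mul_rpow (x := (C' * (E ^ (p / 2) * (M + 1))) ^ p⁻¹), ← NNReal.rpow_mul,
    inv_mul_cancel₀ hp0.ne', NNReal.rpow_one]
  push_cast
  rw [ENNReal.coe_rpow_of_nonneg _ hr0.le, ENNReal.coe_rpow_of_nonneg _ hp0.le]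
  calc (C' : ℝ≥0∞) * ((E : ℝ≥0∞) ^ (p / 2) * q ^ p * (M * ∫⁻ x, ‖f x‖ₑ ^ p ∂μ))
      ≤ (C' : ℝ≥0∞) * ((E : ℝ≥0∞) ^ (p / 2) * q ^ p * ((M + 1) * ∫⁻ x, ‖f x‖ₑ ^ p ∂μ)) := by
        gcongr
        exact le_self_add
    _ = _ := by ring

end AtomicFiltration

/-! ### Best constants and the main theorem. -/

namespace AtomicFiltration

theorem bestConst_le {P : ℝ≥0 → Prop} {A : ℝ≥0} (h : P A) : bestConst P ≤ A := iInf₂_le A h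

theorem bestConst_lt_iff {P : ℝ≥0 → Prop} {a : ℝ≥0∞} : bestConst P < a ↔ ∃ A, P A ∧ (A : ℝ≥0∞) < a := by
  simp [bestConst, iInf_lt_iff]

section

variable {X : Type*} [MeasurableSpace X] {𝓕 : AtomicFiltration X} {μ ν : Measure X}
  {b : Set X → X → ℝ} {p : ℝ} {B B' : ℝ≥0}

theorem DirectTesting.mono (hp : 0 ≤ p) (h : 𝓕.DirectTesting p μ ν b B) (hB : B ≤ B') :
    𝓕.DirectTesting p μ ν b B' := fun J hJ => by
  obtain ⟨g, hg, h⟩ := h J hJ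
  exact ⟨g, hg, h.trans (by gcongr)⟩

theorem AdjointTesting.mono (hp : 2 < p) (h : 𝓕.AdjointTesting p μ ν b B) (hB : B ≤ B') :
    𝓕.AdjointTesting p μ ν b B' := fun J hJ => by
  have := (Real.HolderConjugate.conjExponent (by linarith : 1 < p / 2)).symm.nonneg
  exact (h J hJ).trans (by gcongr)

end

end AtomicFiltration

theorem theorem1p2 (p : ℝ) (hp : 2 < p) :
    ∃ c C : ℝ≥0, 0 < c ∧ 0 < C ∧
      ∀ (X : Type*) [MeasurableSpace X] (𝓕 : AtomicFiltration X) (μ ν : Measure X)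
        (_hμ : 𝓕.LocallyFinite μ) (_hν : 𝓕.LocallyFinite ν)
        (b : Set X → X → ℝ) (_hb : 𝓕.IsMartDiffFamily ν b)
        (_hbμ : ∀ I ∈ 𝓕.intervals, μ I = 0 → b I =ᵐ[ν] 0),
        ((∃ A, 𝓕.ParaproductBound p μ ν b A) ↔
          (∃ B, 𝓕.DirectTesting p μ ν b B) ∧ ∃ B', 𝓕.AdjointTesting p μ ν b B') ∧
        c * max (AtomicFiltration.bestConst (𝓕.DirectTesting p μ ν b))
            (AtomicFiltration.bestConst (𝓕.AdjointTesting p μ ν b) ^ (1 / 2 : ℝ)) ≤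
          AtomicFiltration.bestConst (𝓕.ParaproductBound p μ ν b) ∧
        AtomicFiltration.bestConst (𝓕.ParaproductBound p μ ν b) ≤
          C * max (AtomicFiltration.bestConst (𝓕.DirectTesting p μ ν b))
            (AtomicFiltration.bestConst (𝓕.AdjointTesting p μ ν b) ^ (1 / 2 : ℝ)) := by
  obtain ⟨κ₁, hκ₁, h₁⟩ := AtomicFiltration.exists_directTesting hp
  obtain ⟨κ₂, hκ₂, h₂⟩ := AtomicFiltration.exists_adjointTesting hp
  obtain ⟨κ₃, hκ₃, h₃⟩ := AtomicFiltration.exists_paraproductBound hp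
  set κ : ℝ≥0 := max κ₁ (κ₂ ^ (1 / 2 : ℝ)) with hκ
  have hκ0 : 0 < κ := lt_max_of_lt_left hκ₁
  have hκ0' : (κ : ℝ≥0∞) ≠ 0 := by simpa using hκ0.ne'
  refine ⟨κ⁻¹, κ₃, by positivity, hκ₃, ?_⟩
  intro X _ 𝓕 μ ν hμ hν b hb hbμ
  have hsuff : ∀ {B B' : ℝ≥0}, 𝓕.DirectTesting p μ ν b B → 𝓕.AdjointTesting p μ ν b B' →
      ∀ {q : ℝ≥0}, 0 < q → B ≤ q → B' ≤ q ^ 2 → 𝓕.ParaproductBound p μ ν b (κ₃ * q) :=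
    fun hB hB' q hq h h' => h₃ hb hμ hν hq (hB.mono (by linarith) h) (hB'.mono hp h')
  refine ⟨⟨?_, ?_⟩, ?_, ?_⟩
  · rintro ⟨A, hA⟩
    exact ⟨⟨_, h₁ hb hμ hν hbμ hA⟩, ⟨_, h₂ hb hμ hν hbμ hA⟩⟩
  · rintro ⟨⟨B, hB⟩, ⟨B', hB'⟩⟩
    -- The summand one makes `q ≤ q ^ 2`, so that `B' ≤ q ^ 2`, and keeps `q` positive.
    refine ⟨_, hsuff hB hB' (q := 1 + B + B') (by positivity) ?_ ?_⟩
    · rw [add_right_comm]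
      exact le_add_self
    · calc B' ≤ 1 + B + B' := le_add_self
        _ ≤ _ := le_self_pow₀ (by rw [add_assoc]; exact le_self_add) two_ne_zero
  · refine le_iInf₂ fun A hA => ?_
    rw [ENNReal.coe_inv hκ0.ne', ENNReal.inv_mul_le_iff hκ0' ENNReal.coe_ne_top]
    refine max_le ?_ ?_
    · refine (AtomicFiltration.bestConst_le (h₁ hb hμ hν hbμ hA)).trans ?_
      exact_mod_cast mul_le_mul_left (le_max_left _ _) A
    · calc AtomicFiltration.bestConst (𝓕.AdjointTesting p μ ν b) ^ (1 / 2 : ℝ)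
          ≤ ((κ₂ * A ^ 2 : ℝ≥0) : ℝ≥0∞) ^ (1 / 2 : ℝ) := by
            gcongr
            exact AtomicFiltration.bestConst_le (h₂ hb hμ hν hbμ hA)
        _ = ((κ₂ ^ (1 / 2 : ℝ) * A : ℝ≥0) : ℝ≥0∞) := by
            rw [← ENNReal.coe_rpow_of_nonneg _ (by norm_num), NNReal.mul_rpow,
              ← NNReal.rpow_natCast A, ← NNReal.rpow_mul]
            norm_num
        _ ≤ κ * A := by exact_mod_cast mul_le_mul_left (le_max_right _ _) A
  · set m := max (AtomicFiltration.bestConst (𝓕.DirectTesting p μ ν b))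
      (AtomicFiltration.bestConst (𝓕.AdjointTesting p μ ν b) ^ (1 / 2 : ℝ)) with hm
    rw [mul_comm, ← ENNReal.div_le_iff_le_mul (Or.inl (by simpa using hκ₃.ne'))
      (Or.inl ENNReal.coe_ne_top)]
    refine le_of_forall_gt_imp_ge_of_dense fun a ha => ?_
    by_cases hat : a = ∞
    · simp [hat]
    lift a to ℝ≥0 using hat
    have hq' : (0 : ℝ≥0∞) < a := zero_le.trans_lt ha
    have hq : 0 < a := by exact_mod_cast hq'
    obtain ⟨B, hB, hBa⟩ := AtomicFiltration.bestConst_lt_iff.1 ((le_max_left _ _).trans_lt ha)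
    have h4 := (le_max_right _ _).trans_lt ha
    rw [one_div, ENNReal.rpow_inv_lt_iff two_pos] at h4
    obtain ⟨B', hB', hBa'⟩ := AtomicFiltration.bestConst_lt_iff.1 h4
    have h5 := AtomicFiltration.bestConst_le (hsuff hB hB' hq (by exact_mod_cast hBa.le)
      (by rw [ENNReal.rpow_ofNat] at hBa'; exact_mod_cast hBa'.le))
    rw [ENNReal.div_le_iff_le_mul (Or.inl (by simpa using hκ₃.ne')) (Or.inl ENNReal.coe_ne_top)]
    refine h5.trans (le_of_eq ?_)
    push_cast
    ring
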